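/- **The language SCI.** Types are $A ::= \mathtt{nat}\mid\mathtt{comm}\mid\mathtt{var}\mid A\multimap A$. Fix a set of binary operations $\odot:\mathbb N\times\mathbb N\to\mathbb N$ that contains addition and (truncated) subtraction. Terms, up to $\alpha$-equivalence, are $$M ::= n \mid M\odot M\mid \mathtt{skip}\mid M;M\mid M:=M\mid\ !M\mid \mathtt{while}\ M\ \mathtt{do}\ M\mid \mathtt{if0}\ M\ \mathtt{then}\ M\ \mathtt{else}\ M\mid x\mid\lambda x^A.M\mid MM\mid \mathtt{new}\ x\ \mathtt{in}\ M .$$ Typing judgements $x_1:A_1,\dots,x_n:A_n\vdash M:A$ (distinct identifiers) admit weakening and exchange. Identifiers and abstractions are typed as in the simply typed $\lambda$-calculus, but application is affine: from $\Gamma\vdash M:A\multimap B$ and $\Delta\vdash N:A$, where $\Gamma$ and $\Delta$ have no common identifier, infer $\Gamma,\Delta\vdash MN:B$. The other rules share the context $\Gamma$: $n:\mathtt{nat}$; $M\odot N:\mathtt{nat}$ if $M,N:\mathtt{nat}$; $\mathtt{skip}:\mathtt{comm}$; $M;N:B$ if $M:\mathtt{comm}$, $N:B$; $M:=N:\mathtt{comm}$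 if $M:\mathtt{var}$, $N:\mathtt{nat}$; $!M:\mathtt{nat}$ if $M:\mathtt{var}$; $\mathtt{while}\ M\ \mathtt{do}\ N:\mathtt{comm}$ if $M:\mathtt{nat}$, $N:\mathtt{comm}$; $\mathtt{if0}\ M\ \mathtt{then}\ N_1\ \mathtt{else}\ N_2:B$ if $M:\mathtt{nat}$, $N_1,N_2:B$ (here and for $;$, $B\in\{\mathtt{comm},\mathtt{nat},\mathtt{var}\}$); $\Gamma\vdash\mathtt{new}\ x\ \mathtt{in}\ M:B$ if $\Gamma,x:\mathtt{var}\vdash M:B$, $B\in\{\mathtt{comm},\mathtt{nat}\}$. **Evaluation.** For terms whose free identifiers all have type $\mathtt{var}$ and stores $\sigma$ (maps from these identifiers to $\mathbb N$), $\sigma,M\Downarrow\sigma',V$ is the usual big-step call-by-name evaluation, which threads the store through the subterms from left to right. Values are numerals, $\mathtt{skip}$, identifiers and abstractions. An assignment $M:=N$ evaluates $N$ to a numeral $n$, then $M$ to an identifier $x$, updates $x$ to $n$ and returns $\mathtt{skip}$; $!M$ evaluates $M$ to $x$ and returns the value stored at $x$; $\mathtt{while}$ repeats its body as long as the guard evaluates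 to $0$; $\mathtt{if0}$ selects its first branch if the guard evaluates to $0$ and its second branch otherwise; $\mathtt{new}\ x\ \mathtt{in}\ M$ evaluates $M$ with a fresh $x$ initialised to $0$, which is discarded afterwards. For closed terms, $M\Downarrow V$ refers to the empty store. **The extension $SCI_{\mathtt{mk}}$** adds terms $\mathtt{mkvar}\,M\,N$, with $\Gamma\vdash\mathtt{mkvar}\,M\,N:\mathtt{var}$ if $\Gamma\vdash M:\mathtt{nat}\multimap\mathtt{comm}$ and $\Gamma\vdash N:\mathtt{nat}$. Such a term is a value. If $N$ evaluates to $n$ and then $M$ to $\mathtt{mkvar}\,M_1\,M_2$, then $M:=N$ continues with the evaluation of $M_1\,n$; if $M$ evaluates to $\mathtt{mkvar}\,M_1\,M_2$, then $!M$ continues with the evaluation of $M_2$. **Contextual equivalence.** For terms $\Gamma\vdash M,N:A$ of SCI, $M\cong N$ means that for every SCI context $C[-]$ (possibly binding free identifiers of $M$ and $N$, at the types given by $\Gamma$) with $\vdash C[M],C[N]:B$, $B\in\{\mathtt{comm},\mathtt{nat}\}$, and every value $\vdash V:B$, we have $C[M]\Downarrow V\iff C[N]\Downarrow V$. The contextual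 preorder $M\sqsubseteq N$ is defined in the same way with $\Longrightarrow$ in place of $\iff$. Write $\cong_{\mathtt{mk}}$ and $\sqsubseteq_{\mathtt{mk}}$ for the corresponding relations in which $C[-]$ ranges over the contexts of $SCI_{\mathtt{mk}}$. **Lemma ($\mathtt{mkvar}$ is conservative).** Let $\Gamma\vdash M,N:A$ be terms of SCI such that $M\cong N$. Then $M\cong_{\mathtt{mk}}N$. On the other hand, $\mathtt{mkvar}$ is not conservative for the contextual preorder: there are terms $\Gamma\vdash M,N:A$ of SCI such that $M\sqsubseteq N$ but $M\not\sqsubseteq_{\mathtt{mk}}N$. -/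

import Mathlib

namespace SCI

/-- Types of SCI: `nat`, `comm`, `var` and affine function types `A ⊸ B`. -/
inductive Ty : Type
  | nat : Ty
  | comm : Ty
  | var : Ty
  | fn : Ty → Ty → Ty

/-- Terms up to α-equivalence, in de Bruijn style: identifier `i` refers to the `i`-th enclosing
binder, counted from the inside, and then to the entries of the typing context. The binders are
`lam` and `newvar`. A binary operation `⊙` is given by the function on `ℕ` that it computes.
`mkvar` belongs to the extended language only; the typing rules exclude it from SCI. -/
inductive Term : Type
  | num : ℕ → Term
  | op : (ℕ → ℕ → ℕ) → Term → Term → Term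
  | skip : Term
  | seq : Term → Term → Term
  | assign : Term → Term → Term
  | deref : Term → Term
  | whileDo : Term → Term → Term
  | ifZero : Term → Term → Term → Term
  | var : ℕ → Term
  | lam : Ty → Term → Term
  | app : Term → Term → Term
  | newvar : Term → Term
  | mkvar : Term → Term → Term

namespace Term

/-- The set of free identifiers of a term. -/
def fv : Term → Set ℕ
  | num _ => ∅
  | op _ M N => fv M ∪ fv N
  | skip => ∅
  | seq M N => fv M ∪ fv N
  | assign M N => fv M ∪ fv N
  | deref M => fv M
  | whileDo M N => fv M ∪ fv N
  | ifZero M N P => fv M ∪ fv N ∪ fv P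
  | var i => {i}
  | lam _ M => {i | i + 1 ∈ fv M}
  | app M N => fv M ∪ fv N
  | newvar M => {i | i + 1 ∈ fv M}
  | mkvar M N => fv M ∪ fv N

/-- Extension of a renaming of identifiers under a binder. -/
def liftRen (ρ : ℕ → ℕ) : ℕ → ℕ
  | 0 => 0
  | i + 1 => ρ i + 1

/-- Capture-avoiding renaming of the free identifiers. -/
def rename : (ℕ → ℕ) → Term → Term
  | _, num n => num n
  | ρ, op f M N => op f (rename ρ M) (rename ρ N)
  | _, skip => skip
  | ρ, seq M N => seq (rename ρ M) (rename ρ N)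
  | ρ, assign M N => assign (rename ρ M) (rename ρ N)
  | ρ, deref M => deref (rename ρ M)
  | ρ, whileDo M N => whileDo (rename ρ M) (rename ρ N)
  | ρ, ifZero M N P => ifZero (rename ρ M) (rename ρ N) (rename ρ P)
  | ρ, var i => var (ρ i)
  | ρ, lam A M => lam A (rename (liftRen ρ) M)
  | ρ, app M N => app (rename ρ M) (rename ρ N)
  | ρ, newvar M => newvar (rename (liftRen ρ) M)
  | ρ, mkvar M N => mkvar (rename ρ M) (rename ρ N)

/-- Extension of a simultaneous substitution under a binder. -/
def liftSub (s : ℕ → Term) : ℕ → Term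
  | 0 => var 0
  | i + 1 => rename Nat.succ (s i)

/-- Capture-avoiding simultaneous substitution. -/
def subst : (ℕ → Term) → Term → Term
  | _, num n => num n
  | s, op f M N => op f (subst s M) (subst s N)
  | _, skip => skip
  | s, seq M N => seq (subst s M) (subst s N)
  | s, assign M N => assign (subst s M) (subst s N)
  | s, deref M => deref (subst s M)
  | s, whileDo M N => whileDo (subst s M) (subst s N)
  | s, ifZero M N P => ifZero (subst s M) (subst s N) (subst s P)
  | s, var i => s i
  | s, lam A M => lam A (subst (liftSub s) M)
  | s, app M N => app (subst s M) (subst s N)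
  | s, newvar M => newvar (subst (liftSub s) M)
  | s, mkvar M N => mkvar (subst s M) (subst s N)

/-- The substitution that replaces identifier `0` by `N`, the other identifiers moving down. -/
def instSub (N : Term) : ℕ → Term
  | 0 => N
  | i + 1 => var i

/-- `M[N/x]`, where `x` is the identifier `0` of `M`. -/
def inst (M N : Term) : Term := subst (instSub N) M

/-- Values: numerals, `skip`, identifiers, abstractions, and (in the extended language) `mkvar`
terms. -/
inductive IsValue : Term → Prop
  | num (n : ℕ) : IsValue (num n)
  | skip : IsValue skip
  | var (i : ℕ) : IsValue (var i)
  | lam (A : Ty) (M : Term) : IsValue (lam A M)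
  | mkvar (M N : Term) : IsValue (mkvar M N)

/-- Values of type `comm` or `nat`: `skip` and the numerals. -/
inductive IsConst : Term → Prop
  | num (n : ℕ) : IsConst (num n)
  | skip : IsConst skip

end Term

/-- The two languages: SCI, and SCI extended with `mkvar`. -/
inductive Lang : Type
  | sci : Lang
  | sciMk : Lang

/-- `HasType Ops L Γ M A` is the judgement `Γ ⊢ M : A` of the language `L` whose binary arithmetic
operations are those in `Ops`. A context is the list of the types of the identifiers `0, 1, 2, …`.

Weakening and exchange are absorbed in the rule for identifiers, which picks any entry of the
context. In the rule for application, that the function and the argument are typed in two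
contexts without common identifiers means, in the presence of weakening, that they are typed in
the common context and share no free identifier; this is the affine discipline. -/
inductive HasType (Ops : Set (ℕ → ℕ → ℕ)) (L : Lang) : List Ty → Term → Ty → Prop
  | var {Γ : List Ty} {i : ℕ} {A : Ty} :
      Γ[i]? = some A → HasType Ops L Γ (.var i) A
  | lam {Γ : List Ty} {A B : Ty} {M : Term} :
      HasType Ops L (A :: Γ) M B → HasType Ops L Γ (.lam A M) (.fn A B)
  | app {Γ : List Ty} {A B : Ty} {M N : Term} :
      HasType Ops L Γ M (.fn A B) → HasType Ops L Γ N A → Disjoint M.fv N.fv →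
      HasType Ops L Γ (.app M N) B
  | num {Γ : List Ty} (n : ℕ) : HasType Ops L Γ (.num n) .nat
  | op {Γ : List Ty} {f : ℕ → ℕ → ℕ} {M N : Term} :
      f ∈ Ops → HasType Ops L Γ M .nat → HasType Ops L Γ N .nat →
      HasType Ops L Γ (.op f M N) .nat
  | skip {Γ : List Ty} : HasType Ops L Γ .skip .comm
  | seq {Γ : List Ty} {B : Ty} {M N : Term} :
      (B = .comm ∨ B = .nat ∨ B = .var) →
      HasType Ops L Γ M .comm → HasType Ops L Γ N B → HasType Ops L Γ (.seq M N) B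
  | assign {Γ : List Ty} {M N : Term} :
      HasType Ops L Γ M .var → HasType Ops L Γ N .nat → HasType Ops L Γ (.assign M N) .comm
  | deref {Γ : List Ty} {M : Term} :
      HasType Ops L Γ M .var → HasType Ops L Γ (.deref M) .nat
  | whileDo {Γ : List Ty} {M N : Term} :
      HasType Ops L Γ M .nat → HasType Ops L Γ N .comm → HasType Ops L Γ (.whileDo M N) .comm
  | ifZero {Γ : List Ty} {B : Ty} {M N₁ N₂ : Term} :
      (B = .comm ∨ B = .nat ∨ B = .var) →
      HasType Ops L Γ M .nat → HasType Ops L Γ N₁ B → HasType Ops L Γ N₂ B →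
      HasType Ops L Γ (.ifZero M N₁ N₂) B
  | newvar {Γ : List Ty} {B : Ty} {M : Term} :
      (B = .comm ∨ B = .nat) →
      HasType Ops L (.var :: Γ) M B → HasType Ops L Γ (.newvar M) B
  | mkvar {Γ : List Ty} {M N : Term} :
      L = .sciMk →
      HasType Ops L Γ M (.fn .nat .comm) → HasType Ops L Γ N .nat →
      HasType Ops L Γ (.mkvar M N) .var

/-- A store over the identifiers `0, …, k - 1` is the list of their `k` values. -/
abbrev Store : Type := List ℕ

/-- `Eval σ M σ' V` is the big-step judgement `σ, M ⇓ σ', V`. It is meant for terms typed in a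
context that gives type `var` to each identifier in the domain of the stores. The last two rules
apply to `mkvar` terms only, so on terms of SCI this is the evaluation relation of SCI. -/
inductive Eval : Store → Term → Store → Term → Prop
  | value {σ : Store} {V : Term} : V.IsValue → Eval σ V σ V
  | app {σ σ' σ'' : Store} {M N M' V : Term} {A : Ty} :
      Eval σ M σ' (.lam A M') → Eval σ' (M'.inst N) σ'' V → Eval σ (.app M N) σ'' V
  | op {σ σ' σ'' : Store} {f : ℕ → ℕ → ℕ} {M₁ M₂ : Term} {n₁ n₂ : ℕ} :
      Eval σ M₁ σ' (.num n₁) → Eval σ' M₂ σ'' (.num n₂) →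
      Eval σ (.op f M₁ M₂) σ'' (.num (f n₁ n₂))
  | assign {σ σ' σ'' : Store} {M N : Term} {n x : ℕ} :
      Eval σ N σ' (.num n) → Eval σ' M σ'' (.var x) →
      Eval σ (.assign M N) (σ''.set x n) .skip
  | deref {σ σ' : Store} {M : Term} {n x : ℕ} :
      Eval σ M σ' (.var x) → σ'[x]? = some n → Eval σ (.deref M) σ' (.num n)
  | seq {σ σ' σ'' : Store} {M N V : Term} :
      Eval σ M σ' .skip → Eval σ' N σ'' V → Eval σ (.seq M N) σ'' V
  | whileExit {σ σ' : Store} {M N : Term} {n : ℕ} :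
      n ≠ 0 → Eval σ M σ' (.num n) → Eval σ (.whileDo M N) σ' .skip
  | whileStep {σ σ' σ'' σ''' : Store} {M N : Term} :
      Eval σ M σ' (.num 0) → Eval σ' N σ'' .skip → Eval σ'' (.whileDo M N) σ''' .skip →
      Eval σ (.whileDo M N) σ''' .skip
  | ifTrue {σ σ' σ'' : Store} {M N₁ N₂ V : Term} :
      Eval σ M σ' (.num 0) → Eval σ' N₁ σ'' V → Eval σ (.ifZero M N₁ N₂) σ'' V
  | ifFalse {σ σ' σ'' : Store} {M N₁ N₂ V : Term} {n : ℕ} :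
      n ≠ 0 → Eval σ M σ' (.num n) → Eval σ' N₂ σ'' V → Eval σ (.ifZero M N₁ N₂) σ'' V
  /- The new identifier is `0` inside the block. A block has type `comm` or `nat`, so that its
  value is a constant, which has no free identifiers to adjust on leaving the block. -/
  | newvar {σ σ' : Store} {M V : Term} {n : ℕ} :
      V.IsConst → Eval (0 :: σ) M (n :: σ') V → Eval σ (.newvar M) σ' V
  | assignMk {σ σ' σ'' σ''' : Store} {M N M₁ M₂ V : Term} {n : ℕ} :
      Eval σ N σ' (.num n) → Eval σ' M σ'' (.mkvar M₁ M₂) →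
      Eval σ'' (.app M₁ (.num n)) σ''' V → Eval σ (.assign M N) σ''' V
  | derefMk {σ σ' σ'' : Store} {M M₁ M₂ V : Term} :
      Eval σ M σ' (.mkvar M₁ M₂) → Eval σ' M₂ σ'' V → Eval σ (.deref M) σ'' V

/-- Term contexts `C[-]`: terms that may contain (any number of) holes. The hole may stand under
binders, which capture free identifiers of the term put into it. An occurrence `hole ρ` records
which ones: identifier `i` of that term becomes the identifier `ρ i` at the hole. (With names for
bound identifiers, `ρ` is determined by the choice of the names.) -/
inductive Ctx : Type
  | hole : (ℕ → ℕ) → Ctx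
  | num : ℕ → Ctx
  | op : (ℕ → ℕ → ℕ) → Ctx → Ctx → Ctx
  | skip : Ctx
  | seq : Ctx → Ctx → Ctx
  | assign : Ctx → Ctx → Ctx
  | deref : Ctx → Ctx
  | whileDo : Ctx → Ctx → Ctx
  | ifZero : Ctx → Ctx → Ctx → Ctx
  | var : ℕ → Ctx
  | lam : Ty → Ctx → Ctx
  | app : Ctx → Ctx → Ctx
  | newvar : Ctx → Ctx
  | mkvar : Ctx → Ctx → Ctx

namespace Ctx

/-- `C[M]`. -/
def fill : Ctx → Term → Term
  | hole ρ, M => M.rename ρ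
  | num n, _ => .num n
  | op f C D, M => .op f (fill C M) (fill D M)
  | skip, _ => .skip
  | seq C D, M => .seq (fill C M) (fill D M)
  | assign C D, M => .assign (fill C M) (fill D M)
  | deref C, M => .deref (fill C M)
  | whileDo C D, M => .whileDo (fill C M) (fill D M)
  | ifZero C D E, M => .ifZero (fill C M) (fill D M) (fill E M)
  | var i, _ => .var i
  | lam A C, M => .lam A (fill C M)
  | app C D, M => .app (fill C M) (fill D M)
  | newvar C, M => .newvar (fill C M)
  | mkvar C D, M => .mkvar (fill C M) (fill D M)

/-- `C.Fits Γ Δ`: in `C`, which stands in the scope of identifiers of types `Δ`, the holes are for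
terms over the context `Γ`. At each hole, distinct identifiers of `Γ` stay distinct, and an
identifier of `Γ` that is captured is bound at the type which `Γ` gives to it. -/
def Fits (Γ : List Ty) : List Ty → Ctx → Prop
  | Δ, hole ρ =>
      Set.InjOn ρ {i | i < Γ.length} ∧
        ∀ (i : ℕ) (A A' : Ty), Γ[i]? = some A → Δ[ρ i]? = some A' → A = A'
  | _, num _ => True
  | Δ, op _ C D => Fits Γ Δ C ∧ Fits Γ Δ D
  | _, skip => True
  | Δ, seq C D => Fits Γ Δ C ∧ Fits Γ Δ D
  | Δ, assign C D => Fits Γ Δ C ∧ Fits Γ Δ D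
  | Δ, deref C => Fits Γ Δ C
  | Δ, whileDo C D => Fits Γ Δ C ∧ Fits Γ Δ D
  | Δ, ifZero C D E => Fits Γ Δ C ∧ Fits Γ Δ D ∧ Fits Γ Δ E
  | _, var _ => True
  | Δ, lam A C => Fits Γ (A :: Δ) C
  | Δ, app C D => Fits Γ Δ C ∧ Fits Γ Δ D
  | Δ, newvar C => Fits Γ (.var :: Δ) C
  | Δ, mkvar C D => Fits Γ Δ C ∧ Fits Γ Δ D

end Ctx

/-- `M ⇓ V` for closed terms, with the unique store over no identifiers. -/
def Converges (M V : Term) : Prop := Eval [] M [] V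

/-- The contextual preorder of the language `L`, on terms over `Γ`: for every context `C[-]` with
`⊢ C[M], C[N] : B`, `B ∈ {comm, nat}`, and every value `⊢ V : B`, if `C[M] ⇓ V` then `C[N] ⇓ V`. -/
def CtxLE (Ops : Set (ℕ → ℕ → ℕ)) (L : Lang) (Γ : List Ty) (M N : Term) : Prop :=
  ∀ (C : Ctx) (B : Ty), C.Fits Γ [] → (B = .comm ∨ B = .nat) →
    HasType Ops L [] (C.fill M) B → HasType Ops L [] (C.fill N) B →
    ∀ V : Term, V.IsValue → HasType Ops L [] V B →
      Converges (C.fill M) V → Converges (C.fill N) V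

/-- Contextual equivalence of the language `L`, on terms over `Γ`: for every context `C[-]` with
`⊢ C[M], C[N] : B`, `B ∈ {comm, nat}`, and every value `⊢ V : B`, `C[M] ⇓ V` iff `C[N] ⇓ V`. -/
def CtxEquiv (Ops : Set (ℕ → ℕ → ℕ)) (L : Lang) (Γ : List Ty) (M N : Term) : Prop :=
  ∀ (C : Ctx) (B : Ty), C.Fits Γ [] → (B = .comm ∨ B = .nat) →
    HasType Ops L [] (C.fill M) B → HasType Ops L [] (C.fill N) B →
    ∀ V : Term, V.IsValue → HasType Ops L [] V B →
      (Converges (C.fill M) V ↔ Converges (C.fill N) V)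

end SCI

namespace SCI

open Term

/-! ### Evaluation, one construct at a time -/

/-! Conservativity is proved by removing the `mkvar`s of a context one at a time, innermost first.
An innermost `mkvar P Q` is replaced by a program of SCI (`oracle`) which knows beforehand, from a
finite list of guesses, how each successive use will go: an assignment of a given `n`, or a read. At
each use it carries out the guessed action (it runs `P n`, or stores the result of `Q`), hands out
an ordinary location `l`, and keeps in a cell `e` the content that `l` should have once the use is
over. For a guessed assignment of `n` it puts `n + 1` into `l` and `n` into `e`, so that only an
assignment of `n` makes the two agree; for a guessed read it puts the value of `Q` into both. The
next use, or the final check, diverges if `l` and `e` differ. A run with `mkvar` therefore passes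
when the guesses are its own trace.

One kind of cheating remains: where a read is guessed, an assignment of exactly the number that `Q`
has just returned also leaves `l = e`. Here an equivalence is needed rather than a preorder. A
falsified read puts `q + 1` into `l` and `q` into `e`: a genuine read is then doomed to fail the
next check, while the cheating assignment passes as before. Let `M` run with `mkvar` and trace `t`.
Then the oracle version of `M` passes with `t`, hence so does that of `N`. If the run of `N` is
honest, it translates back into a run with `mkvar`. If not, falsify the reads at which `N` cheated.
`N` still passes, hence so does `M`; but `M` really reads at these places and must fail. This
argument is `eval_of_passes_iff`. It rests on `outcome_of_evalN` (what a passing run of oracle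
programs tells about `mkvar`) and `Eval.exists_shadow` (a run with `mkvar` determines the behaviour
of the oracle version, with its own trace and with any falsification of it).

The elimination stays within affine typing, because the cells of the oracle never get into both
sides of an application (`Ctx.Elim.hasType`). It lowers the number of `mkvar`s, because the copied
`P` and `Q` contain none. Induction on this number gives the theorem (`CtxEquiv.equivUpTo`).

For the preorder, compare the command that diverges unless `x` contains `0` with `x := 0`. In SCI
the first is below the second, since writing `0` over `0` changes nothing (`Sub.eval`). A `mkvar`
that is read as `0` but diverges when assigned separates them. -/

lemma Eval.isValue {σ τ : Store} {M V : Term} (h : Eval σ M τ V) : V.IsValue := by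
  induction h with
  | value h => exact h
  | newvar h => cases h <;> constructor
  | _ => first | assumption | constructor

lemma Eval.length_eq {σ τ : Store} {M V : Term} (h : Eval σ M τ V) : τ.length = σ.length := by
  induction h <;> simp_all

lemma eval_of_isValue {σ τ : Store} {V U : Term} (hV : V.IsValue) :
    Eval σ V τ U ↔ τ = σ ∧ U = V := by
  constructor
  · intro h
    cases hV <;> cases h <;> exact ⟨rfl, rfl⟩
  · rintro ⟨rfl, rfl⟩
    exact .value hV

@[simp] lemma eval_num {σ τ : Store} {n : ℕ} {U : Term} :
    Eval σ (num n) τ U ↔ τ = σ ∧ U = num n := eval_of_isValue (.num n)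

@[simp] lemma eval_skip {σ τ : Store} {U : Term} :
    Eval σ skip τ U ↔ τ = σ ∧ U = skip := eval_of_isValue .skip

@[simp] lemma eval_var {σ τ : Store} {i : ℕ} {U : Term} :
    Eval σ (var i) τ U ↔ τ = σ ∧ U = var i := eval_of_isValue (.var i)

@[simp] lemma eval_lam {σ τ : Store} {A : Ty} {M U : Term} :
    Eval σ (lam A M) τ U ↔ τ = σ ∧ U = lam A M := eval_of_isValue (.lam A M)

@[simp] lemma eval_mkvar {σ τ : Store} {M N U : Term} :
    Eval σ (mkvar M N) τ U ↔ τ = σ ∧ U = mkvar M N := eval_of_isValue (.mkvar M N)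

lemma eval_op {σ τ : Store} {f : ℕ → ℕ → ℕ} {M N U : Term} :
    Eval σ (op f M N) τ U ↔
      ∃ σ₁ a b, Eval σ M σ₁ (num a) ∧ Eval σ₁ N τ (num b) ∧ U = num (f a b) := by
  constructor
  · intro h
    cases h with
    | value h => cases h
    | op h₁ h₂ => exact ⟨_, _, _, h₁, h₂, rfl⟩
  · rintro ⟨σ₁, a, b, h₁, h₂, rfl⟩
    exact .op h₁ h₂

lemma eval_seq {σ τ : Store} {M N U : Term} :
    Eval σ (seq M N) τ U ↔ ∃ σ₁, Eval σ M σ₁ skip ∧ Eval σ₁ N τ U := by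
  constructor
  · intro h
    cases h with
    | value h => cases h
    | seq h₁ h₂ => exact ⟨_, h₁, h₂⟩
  · rintro ⟨σ₁, h₁, h₂⟩
    exact .seq h₁ h₂

lemma eval_app {σ τ : Store} {M N U : Term} :
    Eval σ (app M N) τ U ↔
      ∃ σ₁ A M', Eval σ M σ₁ (lam A M') ∧ Eval σ₁ (M'.inst N) τ U := by
  constructor
  · intro h
    cases h with
    | value h => cases h
    | app h₁ h₂ => exact ⟨_, _, _, h₁, h₂⟩
  · rintro ⟨σ₁, A, M', h₁, h₂⟩
    exact .app h₁ h₂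

lemma eval_ifZero {σ τ : Store} {M N₁ N₂ U : Term} :
    Eval σ (ifZero M N₁ N₂) τ U ↔
      ∃ σ₁ n, Eval σ M σ₁ (num n) ∧ (n = 0 ∧ Eval σ₁ N₁ τ U ∨ n ≠ 0 ∧ Eval σ₁ N₂ τ U) := by
  constructor
  · intro h
    cases h with
    | value h => cases h
    | ifTrue h₁ h₂ => exact ⟨_, _, h₁, .inl ⟨rfl, h₂⟩⟩
    | ifFalse hn h₁ h₂ => exact ⟨_, _, h₁, .inr ⟨hn, h₂⟩⟩
  · rintro ⟨σ₁, n, h₁, ⟨rfl, h₂⟩ | ⟨hn, h₂⟩⟩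
    · exact .ifTrue h₁ h₂
    · exact .ifFalse hn h₁ h₂

lemma eval_whileDo {σ τ : Store} {M N U : Term} :
    Eval σ (whileDo M N) τ U ↔
      ∃ σ₁ n, Eval σ M σ₁ (num n) ∧ (n ≠ 0 ∧ τ = σ₁ ∧ U = skip ∨
        n = 0 ∧ ∃ σ₂, Eval σ₁ N σ₂ skip ∧ Eval σ₂ (whileDo M N) τ skip ∧ U = skip) := by
  constructor
  · intro h
    cases h with
    | value h => cases h
    | whileExit hn h₁ => exact ⟨_, _, h₁, .inl ⟨hn, rfl, rfl⟩⟩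
    | whileStep h₁ h₂ h₃ => exact ⟨_, _, h₁, .inr ⟨rfl, _, h₂, h₃, rfl⟩⟩
  · rintro ⟨σ₁, n, h₁, ⟨hn, rfl, rfl⟩ | ⟨rfl, σ₂, h₂, h₃, rfl⟩⟩
    · exact .whileExit hn h₁
    · exact .whileStep h₁ h₂ h₃

lemma eval_newvar {σ τ : Store} {M U : Term} :
    Eval σ (newvar M) τ U ↔ U.IsConst ∧ ∃ n, Eval (0 :: σ) M (n :: τ) U := by
  constructor
  · intro h
    cases h with
    | value h => cases h
    | newvar h₁ h₂ => exact ⟨h₁, _, h₂⟩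
  · rintro ⟨h₁, n, h₂⟩
    exact .newvar h₁ h₂

lemma eval_assign {σ τ : Store} {M N U : Term} :
    Eval σ (assign M N) τ U ↔ ∃ σ₁ n σ₂ W, Eval σ N σ₁ (num n) ∧ Eval σ₁ M σ₂ W ∧
      ((∃ x, W = var x ∧ τ = σ₂.set x n ∧ U = skip) ∨
        ∃ M₁ M₂, W = mkvar M₁ M₂ ∧ Eval σ₂ (app M₁ (num n)) τ U) := by
  constructor
  · intro h
    cases h with
    | value h => cases h
    | assign h₁ h₂ => exact ⟨_, _, _, _, h₁, h₂, .inl ⟨_, rfl, rfl, rfl⟩⟩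
    | assignMk h₁ h₂ h₃ => exact ⟨_, _, _, _, h₁, h₂, .inr ⟨_, _, rfl, h₃⟩⟩
  · rintro ⟨σ₁, n, σ₂, W, h₁, h₂, ⟨x, rfl, rfl, rfl⟩ | ⟨M₁, M₂, rfl, h₃⟩⟩
    · exact .assign h₁ h₂
    · exact .assignMk h₁ h₂ h₃

lemma eval_deref {σ τ : Store} {M U : Term} :
    Eval σ (deref M) τ U ↔ ∃ σ₁ W, Eval σ M σ₁ W ∧
      ((∃ x n, W = var x ∧ τ = σ₁ ∧ σ₁[x]? = some n ∧ U = num n) ∨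
        ∃ M₁ M₂, W = mkvar M₁ M₂ ∧ Eval σ₁ M₂ τ U) := by
  constructor
  · intro h
    cases h with
    | value h => cases h
    | deref h₁ h₂ => exact ⟨_, _, h₁, .inl ⟨_, _, rfl, rfl, h₂, rfl⟩⟩
    | derefMk h₁ h₂ => exact ⟨_, _, h₁, .inr ⟨_, _, rfl, h₂⟩⟩
  · rintro ⟨σ₁, W, h₁, ⟨x, n, rfl, rfl, hx, rfl⟩ | ⟨M₁, M₂, rfl, h₂⟩⟩
    · exact .deref h₁ hx
    · exact .derefMk h₁ h₂

/-- The diverging command. -/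
def omega : Term := whileDo (num 0) skip

lemma not_eval_omega {σ τ : Store} {U : Term} : ¬ Eval σ omega τ U := by
  intro h
  generalize hM : omega = M at h
  induction h with
  | value h => subst hM; cases h
  | whileExit hn h => cases hM; simp at h; omega
  | whileStep _ _ _ _ _ ih => exact ih hM
  | _ => cases hM

/-! ### Evaluation with a bound on the height of derivations -/

/-- `EvalN k` is evaluation by a derivation of height at most `k`. -/
inductive EvalN : ℕ → Store → Term → Store → Term → Prop
  | value {k : ℕ} {σ : Store} {V : Term} : V.IsValue → EvalN k σ V σ V
  | app {k : ℕ} {σ σ' σ'' : Store} {M N M' V : Term} {A : Ty} :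
      EvalN k σ M σ' (.lam A M') → EvalN k σ' (M'.inst N) σ'' V → EvalN (k + 1) σ (.app M N) σ'' V
  | op {k : ℕ} {σ σ' σ'' : Store} {f : ℕ → ℕ → ℕ} {M₁ M₂ : Term} {n₁ n₂ : ℕ} :
      EvalN k σ M₁ σ' (.num n₁) → EvalN k σ' M₂ σ'' (.num n₂) →
      EvalN (k + 1) σ (.op f M₁ M₂) σ'' (.num (f n₁ n₂))
  | assign {k : ℕ} {σ σ' σ'' : Store} {M N : Term} {n x : ℕ} :
      EvalN k σ N σ' (.num n) → EvalN k σ' M σ'' (.var x) →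
      EvalN (k + 1) σ (.assign M N) (σ''.set x n) .skip
  | deref {k : ℕ} {σ σ' : Store} {M : Term} {n x : ℕ} :
      EvalN k σ M σ' (.var x) → σ'[x]? = some n → EvalN (k + 1) σ (.deref M) σ' (.num n)
  | seq {k : ℕ} {σ σ' σ'' : Store} {M N V : Term} :
      EvalN k σ M σ' .skip → EvalN k σ' N σ'' V → EvalN (k + 1) σ (.seq M N) σ'' V
  | whileExit {k : ℕ} {σ σ' : Store} {M N : Term} {n : ℕ} :
      n ≠ 0 → EvalN k σ M σ' (.num n) → EvalN (k + 1) σ (.whileDo M N) σ' .skip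
  | whileStep {k : ℕ} {σ σ' σ'' σ''' : Store} {M N : Term} :
      EvalN k σ M σ' (.num 0) → EvalN k σ' N σ'' .skip → EvalN k σ'' (.whileDo M N) σ''' .skip →
      EvalN (k + 1) σ (.whileDo M N) σ''' .skip
  | ifTrue {k : ℕ} {σ σ' σ'' : Store} {M N₁ N₂ V : Term} :
      EvalN k σ M σ' (.num 0) → EvalN k σ' N₁ σ'' V → EvalN (k + 1) σ (.ifZero M N₁ N₂) σ'' V
  | ifFalse {k : ℕ} {σ σ' σ'' : Store} {M N₁ N₂ V : Term} {n : ℕ} :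
      n ≠ 0 → EvalN k σ M σ' (.num n) → EvalN k σ' N₂ σ'' V →
      EvalN (k + 1) σ (.ifZero M N₁ N₂) σ'' V
  | newvar {k : ℕ} {σ σ' : Store} {M V : Term} {n : ℕ} :
      V.IsConst → EvalN k (0 :: σ) M (n :: σ') V → EvalN (k + 1) σ (.newvar M) σ' V
  | assignMk {k : ℕ} {σ σ' σ'' σ''' : Store} {M N M₁ M₂ V : Term} {n : ℕ} :
      EvalN k σ N σ' (.num n) → EvalN k σ' M σ'' (.mkvar M₁ M₂) →
      EvalN k σ'' (.app M₁ (.num n)) σ''' V → EvalN (k + 1) σ (.assign M N) σ''' V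
  | derefMk {k : ℕ} {σ σ' σ'' : Store} {M M₁ M₂ V : Term} :
      EvalN k σ M σ' (.mkvar M₁ M₂) → EvalN k σ' M₂ σ'' V → EvalN (k + 1) σ (.deref M) σ'' V

lemma EvalN.eval {k : ℕ} {σ τ : Store} {M U : Term} (h : EvalN k σ M τ U) : Eval σ M τ U := by
  induction h with
  | value h => exact .value h
  | app _ _ h₁ h₂ => exact .app h₁ h₂
  | op _ _ h₁ h₂ => exact .op h₁ h₂
  | assign _ _ h₁ h₂ => exact .assign h₁ h₂
  | deref _ h₂ h₁ => exact .deref h₁ h₂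
  | seq _ _ h₁ h₂ => exact .seq h₁ h₂
  | whileExit hn _ h₁ => exact .whileExit hn h₁
  | whileStep _ _ _ h₁ h₂ h₃ => exact .whileStep h₁ h₂ h₃
  | ifTrue _ _ h₁ h₂ => exact .ifTrue h₁ h₂
  | ifFalse hn _ _ h₁ h₂ => exact .ifFalse hn h₁ h₂
  | newvar hc _ h₁ => exact .newvar hc h₁
  | assignMk _ _ _ h₁ h₂ h₃ => exact .assignMk h₁ h₂ h₃
  | derefMk _ _ h₁ h₂ => exact .derefMk h₁ h₂

lemma exists_eq_succ_of_succ_le {k m : ℕ} (h : k + 1 ≤ m) : ∃ m', m = m' + 1 ∧ k ≤ m' :=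
  ⟨m - 1, by omega, by omega⟩

lemma EvalN.mono {k m : ℕ} {σ τ : Store} {M U : Term} (h : EvalN k σ M τ U) (hkm : k ≤ m) :
    EvalN m σ M τ U := by
  induction h generalizing m with
  | value h => exact .value h
  | app _ _ h₁ h₂ =>
    obtain ⟨m, rfl, hk⟩ := exists_eq_succ_of_succ_le hkm
    exact .app (h₁ hk) (h₂ hk)
  | op _ _ h₁ h₂ =>
    obtain ⟨m, rfl, hk⟩ := exists_eq_succ_of_succ_le hkm
    exact .op (h₁ hk) (h₂ hk)
  | assign _ _ h₁ h₂ =>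
    obtain ⟨m, rfl, hk⟩ := exists_eq_succ_of_succ_le hkm
    exact .assign (h₁ hk) (h₂ hk)
  | deref _ h₂ h₁ =>
    obtain ⟨m, rfl, hk⟩ := exists_eq_succ_of_succ_le hkm
    exact .deref (h₁ hk) h₂
  | seq _ _ h₁ h₂ =>
    obtain ⟨m, rfl, hk⟩ := exists_eq_succ_of_succ_le hkm
    exact .seq (h₁ hk) (h₂ hk)
  | whileExit hn _ h₁ =>
    obtain ⟨m, rfl, hk⟩ := exists_eq_succ_of_succ_le hkm
    exact .whileExit hn (h₁ hk)
  | whileStep _ _ _ h₁ h₂ h₃ =>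
    obtain ⟨m, rfl, hk⟩ := exists_eq_succ_of_succ_le hkm
    exact .whileStep (h₁ hk) (h₂ hk) (h₃ hk)
  | ifTrue _ _ h₁ h₂ =>
    obtain ⟨m, rfl, hk⟩ := exists_eq_succ_of_succ_le hkm
    exact .ifTrue (h₁ hk) (h₂ hk)
  | ifFalse hn _ _ h₁ h₂ =>
    obtain ⟨m, rfl, hk⟩ := exists_eq_succ_of_succ_le hkm
    exact .ifFalse hn (h₁ hk) (h₂ hk)
  | newvar hc _ h₁ =>
    obtain ⟨m, rfl, hk⟩ := exists_eq_succ_of_succ_le hkm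
    exact .newvar hc (h₁ hk)
  | assignMk _ _ _ h₁ h₂ h₃ =>
    obtain ⟨m, rfl, hk⟩ := exists_eq_succ_of_succ_le hkm
    exact .assignMk (h₁ hk) (h₂ hk) (h₃ hk)
  | derefMk _ _ h₁ h₂ =>
    obtain ⟨m, rfl, hk⟩ := exists_eq_succ_of_succ_le hkm
    exact .derefMk (h₁ hk) (h₂ hk)

lemma Eval.exists_evalN {σ τ : Store} {M U : Term} (h : Eval σ M τ U) : ∃ k, EvalN k σ M τ U := by
  induction h with
  | value h => exact ⟨0, .value h⟩
  | app _ _ h₁ h₂ =>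
    obtain ⟨k, h₁⟩ := h₁; obtain ⟨m, h₂⟩ := h₂
    exact ⟨_, .app (h₁.mono (le_max_left k m)) (h₂.mono (le_max_right k m))⟩
  | op _ _ h₁ h₂ =>
    obtain ⟨k, h₁⟩ := h₁; obtain ⟨m, h₂⟩ := h₂
    exact ⟨_, .op (h₁.mono (le_max_left k m)) (h₂.mono (le_max_right k m))⟩
  | assign _ _ h₁ h₂ =>
    obtain ⟨k, h₁⟩ := h₁; obtain ⟨m, h₂⟩ := h₂
    exact ⟨_, .assign (h₁.mono (le_max_left k m)) (h₂.mono (le_max_right k m))⟩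
  | deref _ h₂ h₁ =>
    obtain ⟨k, h₁⟩ := h₁
    exact ⟨_, .deref h₁ h₂⟩
  | seq _ _ h₁ h₂ =>
    obtain ⟨k, h₁⟩ := h₁; obtain ⟨m, h₂⟩ := h₂
    exact ⟨_, .seq (h₁.mono (le_max_left k m)) (h₂.mono (le_max_right k m))⟩
  | whileExit hn _ h₁ =>
    obtain ⟨k, h₁⟩ := h₁
    exact ⟨_, .whileExit hn h₁⟩
  | whileStep _ _ _ h₁ h₂ h₃ =>
    obtain ⟨k, h₁⟩ := h₁; obtain ⟨m, h₂⟩ := h₂; obtain ⟨j, h₃⟩ := h₃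
    exact ⟨_, .whileStep (h₁.mono (by omega : k ≤ k + m + j)) (h₂.mono (by omega))
      (h₃.mono (by omega))⟩
  | ifTrue _ _ h₁ h₂ =>
    obtain ⟨k, h₁⟩ := h₁; obtain ⟨m, h₂⟩ := h₂
    exact ⟨_, .ifTrue (h₁.mono (le_max_left k m)) (h₂.mono (le_max_right k m))⟩
  | ifFalse hn _ _ h₁ h₂ =>
    obtain ⟨k, h₁⟩ := h₁; obtain ⟨m, h₂⟩ := h₂
    exact ⟨_, .ifFalse hn (h₁.mono (le_max_left k m)) (h₂.mono (le_max_right k m))⟩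
  | newvar hc _ h₁ =>
    obtain ⟨k, h₁⟩ := h₁
    exact ⟨_, .newvar hc h₁⟩
  | assignMk _ _ _ h₁ h₂ h₃ =>
    obtain ⟨k, h₁⟩ := h₁; obtain ⟨m, h₂⟩ := h₂; obtain ⟨j, h₃⟩ := h₃
    exact ⟨_, .assignMk (h₁.mono (by omega : k ≤ k + m + j)) (h₂.mono (by omega))
      (h₃.mono (by omega))⟩
  | derefMk _ _ h₁ h₂ =>
    obtain ⟨k, h₁⟩ := h₁; obtain ⟨m, h₂⟩ := h₂
    exact ⟨_, .derefMk (h₁.mono (le_max_left k m)) (h₂.mono (le_max_right k m))⟩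

@[simp] lemma eval_assign_var {σ τ : Store} {x : ℕ} {N U : Term} :
    Eval σ (assign (var x) N) τ U ↔
      ∃ σ₁ n, Eval σ N σ₁ (num n) ∧ τ = σ₁.set x n ∧ U = skip := by
  rw [eval_assign]
  constructor
  · rintro ⟨σ₁, n, σ₂, W, h₁, h₂, h₃⟩
    obtain ⟨rfl, rfl⟩ := eval_var.1 h₂
    rcases h₃ with ⟨x, h, rfl, rfl⟩ | ⟨M₁, M₂, h, -⟩
    · cases h
      exact ⟨_, _, h₁, rfl, rfl⟩
    · cases h
  · rintro ⟨σ₁, n, h₁, rfl, rfl⟩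
    exact ⟨_, _, _, _, h₁, eval_var.2 ⟨rfl, rfl⟩, .inl ⟨_, rfl, rfl, rfl⟩⟩

@[simp] lemma eval_deref_var {σ τ : Store} {x : ℕ} {U : Term} :
    Eval σ (deref (var x)) τ U ↔ ∃ n, σ[x]? = some n ∧ τ = σ ∧ U = num n := by
  rw [eval_deref]
  constructor
  · rintro ⟨σ₁, W, h₂, h₃⟩
    obtain ⟨rfl, rfl⟩ := eval_var.1 h₂
    rcases h₃ with ⟨x, n, h, rfl, hx, rfl⟩ | ⟨M₁, M₂, h, -⟩
    · cases h
      exact ⟨_, hx, rfl, rfl⟩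
    · cases h
  · rintro ⟨n, hx, rfl, rfl⟩
    exact ⟨_, _, eval_var.2 ⟨rfl, rfl⟩, .inl ⟨_, _, rfl, rfl, hx, rfl⟩⟩

/-! ### The oracle program that stands for an `mkvar` term -/

/-- A guess how the next use of an `mkvar` term goes: it is assigned the given number, or it is
read. In the case `read true` the guess is meant to be wrong: the number read is falsified, but an
assignment of the correct number goes through. -/
inductive Guess : Type
  | write : ℕ → Guess
  | read : Bool → Guess

/-- By how much the number stored for the reader differs from the number expected afterwards. -/
def Guess.offset : Guess → ℕ
  -- After a guessed write the two cells differ until the guessed number is assigned; a read leaves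
  -- them different.
  | write _ => 1
  | read b => b.toNat

/-- A store extended by the four identifiers of the oracle program: the number of uses so far, the
location handed out, its expected content, and an auxiliary location. -/
def extStore (σ : Store) (c l e r : ℕ) : Store := σ ++ [c, l, e, r]

/-! ### Access to the four cells of the oracle -/

section extStore

variable (σ : Store) (c l e r n : ℕ)

@[simp] lemma extStore_length : (extStore σ c l e r).length = σ.length + 4 := by simp [extStore]

lemma extStore_get_one : (extStore σ c l e r)[σ.length + 1]? = some l := by simp [extStore]

lemma extStore_get_two : (extStore σ c l e r)[σ.length + 2]? = some e := by simp [extStore]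

@[simp] lemma extStore_getElem_zero (h) : (extStore σ c l e r)[σ.length]'h = c := by
  simp [extStore]

@[simp] lemma extStore_getElem_three (h) : (extStore σ c l e r)[σ.length + 3]'h = r := by
  simp [extStore]

@[simp] lemma extStore_set_zero :
    (extStore σ c l e r).set σ.length n = extStore σ n l e r := by simp [extStore]

@[simp] lemma extStore_set_one :
    (extStore σ c l e r).set (σ.length + 1) n = extStore σ c n e r := by simp [extStore]

@[simp] lemma extStore_set_two :
    (extStore σ c l e r).set (σ.length + 2) n = extStore σ c l n r := by simp [extStore]

@[simp] lemma extStore_set_three :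
    (extStore σ c l e r).set (σ.length + 3) n = extStore σ c l e n := by simp [extStore]

lemma extStore_get_of_lt {x : ℕ} (hx : x < σ.length) : (extStore σ c l e r)[x]? = σ[x]? := by
  simp [extStore, List.getElem?_append_left hx]

lemma extStore_set_of_lt {x : ℕ} (hx : x < σ.length) :
    (extStore σ c l e r).set x n = extStore (σ.set x n) c l e r := by
  simp [extStore, List.set_append_left _ _ hx]

lemma cons_extStore : n :: extStore σ c l e r = extStore (n :: σ) c l e r := rfl

end extStore

lemma extStore_inj {σ σ' : Store} {c l e r c' l' e' r' : ℕ}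
    (h : extStore σ c l e r = extStore σ' c' l' e' r') :
    σ = σ' ∧ c = c' ∧ l = l' ∧ e = e' ∧ r = r' := by
  have := List.append_inj' h rfl
  simpa using this

lemma exists_extStore {τ : Store} {k : ℕ} (h : τ.length = k + 4) :
    ∃ σ c l e r, σ.length = k ∧ τ = extStore σ c l e r := by
  have h4 : (τ.drop k).length = 4 := by simp [h]
  obtain ⟨c, l, e, r, hd⟩ : ∃ c l e r, τ.drop k = [c, l, e, r] := by
    match hτ : τ.drop k, h4 with
    | [c, l, e, r], _ => exact ⟨c, l, e, r, rfl⟩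
  refine ⟨τ.take k, c, l, e, r, by simp [h], ?_⟩
  rw [extStore, ← hd, List.take_append_drop]

lemma Eval.exists_extStore {σ τ : Store} {c l e r : ℕ} {M U : Term}
    (h : Eval (extStore σ c l e r) M τ U) :
    ∃ σ' c' l' e' r', σ'.length = σ.length ∧ τ = extStore σ' c' l' e' r' :=
  SCI.exists_extStore (by simpa using h.length_eq)

/-- A program for the distance of two numbers. -/
def dist (M N : Term) : Term :=
  op (fun m n => m + n) (op (fun m n => m - n) M N) (op (fun m n => m - n) N M)

/-- Check that the location of the oracle has the expected content, and diverge otherwise. -/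
def check (d : ℕ) : Term :=
  ifZero (dist (deref (var (d + 1))) (deref (var (d + 2)))) skip omega

/-- Publish the content of the auxiliary location, shifted by `b`. -/
def publish (d b : ℕ) : Term :=
  -- The check precedes the overwriting of both cells, which would destroy the evidence of an
  -- earlier use that went against its guess. It comes after `perform`, so it also covers uses made
  -- inside `P` or `Q`.
  seq (check d) (seq (assign (var (d + 2)) (deref (var (d + 3))))
    (seq (assign (var (d + 1)) (op (fun m n => m + n) (deref (var (d + 3))) (num b)))
      (var (d + 1))))

/-- Perform the part of an `mkvar P Q` that the guess asks for. -/
def perform (d : ℕ) : Guess → Term → Term → Term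
  | .write n, P, _ => seq (app P (num n)) (assign (var (d + 3)) (num n))
  | .read _, _, Q => assign (var (d + 3)) Q

/-- The oracle program for `mkvar P Q`, with the guesses from number `j` on. -/
def oracleFrom (d : ℕ) (P Q : Term) : ℕ → List Guess → Term
  -- The guesses are exhausted, so this diverges; the identifier only provides the type `var`.
  | _, [] => seq omega (var (d + 1))
  | j, x :: o =>
    -- Truncated subtraction tests that the counter is at most `j`. The tests come with increasing
    -- `j`, starting from `0`, so the first success is at the value of the counter. The counter is
    -- advanced before the guess is performed; uses inside `P` or `Q` thus take the numbers that
    -- follow.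
    ifZero (op (fun m n => m - n) (deref (var d)) (num j))
      (seq (assign (var d) (num (j + 1))) (seq (perform d x P Q) (publish d x.offset)))
      (oracleFrom d P Q (j + 1) o)

/-- The oracle program that stands for `mkvar P Q` in the scope of `d` identifiers, the identifiers
`d, …, d + 3` being those of the oracle. -/
def oracle (d : ℕ) (o : List Guess) (P Q : Term) : Term := oracleFrom d P Q 0 o

lemma not_isValue_oracleFrom {d j : ℕ} {P Q : Term} {o : List Guess} :
    ¬ (oracleFrom d P Q j o).IsValue := by
  intro h
  cases o <;> cases h

lemma not_isValue_oracle {d : ℕ} {P Q : Term} {o : List Guess} :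
    ¬ (oracle d o P Q).IsValue := not_isValue_oracleFrom

lemma eval_dist_deref {σ τ : Store} {x y m n : ℕ} {U : Term} (hm : σ[x]? = some m)
    (hn : σ[y]? = some n) :
    Eval σ (dist (deref (var x)) (deref (var y))) τ U ↔ τ = σ ∧ U = num (m - n + (n - m)) := by
  simp [dist, eval_op, hm, hn]

lemma eval_check {σ τ : Store} {c l e r : ℕ} {U : Term} :
    Eval (extStore σ c l e r) (check σ.length) τ U ↔
      l = e ∧ τ = extStore σ c l e r ∧ U = skip := by
  rw [check, eval_ifZero]
  simp only [eval_dist_deref (extStore_get_one ..) (extStore_get_two ..), eval_skip,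
    not_eval_omega, and_false, or_false]
  constructor
  · rintro ⟨σ₁, n, ⟨rfl, h⟩, rfl, h'⟩
    rw [Term.num.injEq] at h
    exact ⟨by omega, h'⟩
  · rintro ⟨rfl, h'⟩
    exact ⟨_, _, ⟨rfl, rfl⟩, by omega, h'⟩

lemma eval_publish {σ τ : Store} {c l e r b : ℕ} {U : Term} :
    Eval (extStore σ c l e r) (publish σ.length b) τ U ↔
      l = e ∧ τ = extStore σ c (r + b) r r ∧ U = var (σ.length + 1) := by
  rw [publish, eval_seq]
  constructor
  · rintro ⟨σ₁, h₁, h⟩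
    obtain ⟨rfl, rfl, -⟩ := eval_check.1 h₁
    refine ⟨rfl, ?_⟩
    simpa [eval_seq, eval_op] using h
  · rintro ⟨rfl, h⟩
    refine ⟨_, eval_check.2 ⟨rfl, rfl, rfl⟩, ?_⟩
    simpa [eval_seq, eval_op] using h

/-- The point of the bound `k' < k` is the later induction. The action inside an oracle program is
analysed only when its result is used, from a run that need not be a subderivation of the one at
hand; heights still decrease. -/
lemma evalN_oracleFrom {k : ℕ} {σ τ : Store} {c l e r j : ℕ} {o : List Guess} {P Q U : Term}
    (hj : j ≤ c) (h : EvalN k (extStore σ c l e r) (oracleFrom σ.length P Q j o) τ U) :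
    ∃ x, o[c - j]? = some x ∧ ∃ k' < k, ∃ τ₁,
      EvalN k' (extStore σ (c + 1) l e r) (perform σ.length x P Q) τ₁ skip ∧
      Eval τ₁ (publish σ.length x.offset) τ U := by
  induction o generalizing j k with
  | nil =>
    obtain ⟨_, h, -⟩ := eval_seq.1 h.eval
    exact absurd h not_eval_omega
  | cons x o ih =>
    have key : ∀ {σ₁ n}, Eval (extStore σ c l e r)
        (op (fun m n => m - n) (deref (var σ.length)) (num j)) σ₁ (num n) →
        σ₁ = extStore σ c l e r ∧ n = c - j := by
      intro σ₁ n h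
      simpa [eval_op] using h
    cases h with
    | value h => cases h
    | ifTrue h₁ h₂ =>
      obtain ⟨rfl, hn⟩ := key h₁.eval
      obtain rfl : j = c := by omega
      cases h₂ with
      | value h => cases h
      | seq h₂ h₃ =>
        have h₂ := h₂.eval
        simp only [eval_assign_var, eval_num] at h₂
        obtain ⟨_, _, ⟨rfl, hn⟩, rfl, -⟩ := h₂
        cases hn
        rw [extStore_set_zero] at h₃
        cases h₃ with
        | value h => cases h
        | seq h₃ h₄ => exact ⟨x, by simp, _, by omega, _, h₃, h₄.eval⟩
    | ifFalse hn h₁ h₂ =>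
      obtain ⟨rfl, rfl⟩ := key h₁.eval
      obtain ⟨y, hy, k', hk, h⟩ := ih (by omega) h₂
      refine ⟨y, ?_, k', by omega, h⟩
      obtain ⟨i, hi⟩ : ∃ i, c - j = i + 1 := ⟨c - j - 1, by omega⟩
      rw [hi, List.getElem?_cons_succ, ← hy]
      congr 1
      omega

/-- The check in `publish` forces the two cells to agree after the action, hence the repeated `l₁`.
-/
lemma evalN_oracle {k : ℕ} {σ τ : Store} {c l e r : ℕ} {o : List Guess} {P Q U : Term}
    (h : EvalN k (extStore σ c l e r) (oracle σ.length o P Q) τ U) :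
    ∃ x, o[c]? = some x ∧ ∃ k' < k, ∃ σ₁ c₁ l₁ r₁, σ₁.length = σ.length ∧
      EvalN k' (extStore σ (c + 1) l e r) (perform σ.length x P Q)
        (extStore σ₁ c₁ l₁ l₁ r₁) skip ∧
      τ = extStore σ₁ c₁ (r₁ + x.offset) r₁ r₁ ∧ U = var (σ.length + 1) := by
  obtain ⟨x, hx, k', hk, τ₁, h₁, h₂⟩ := evalN_oracleFrom (Nat.zero_le c) h
  obtain ⟨σ₁, c₁, l₁, e₁, r₁, hσ, rfl⟩ := h₁.eval.exists_extStore
  rw [← hσ] at h₂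
  obtain ⟨rfl, rfl, rfl⟩ := eval_publish.1 h₂
  exact ⟨x, hx, k', hk, σ₁, c₁, l₁, r₁, hσ, h₁, rfl, by rw [hσ]⟩

lemma eval_oracleFrom {σ τ : Store} {c l e r j : ℕ} {o : List Guess} {P Q U : Term} {x : Guess}
    {τ₁ : Store} (hj : j ≤ c) (hx : o[c - j]? = some x)
    (h₁ : Eval (extStore σ (c + 1) l e r) (perform σ.length x P Q) τ₁ skip)
    (h₂ : Eval τ₁ (publish σ.length x.offset) τ U) :
    Eval (extStore σ c l e r) (oracleFrom σ.length P Q j o) τ U := by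
  induction o generalizing j with
  | nil => simp at hx
  | cons y o ih =>
    rw [oracleFrom, eval_ifZero]
    refine ⟨extStore σ c l e r, c - j, by simp [eval_op], ?_⟩
    rcases hj.eq_or_lt with rfl | hj
    · simp only [Nat.sub_self, List.getElem?_cons_zero, Option.some.injEq] at hx
      subst hx
      refine .inl ⟨by simp, ?_⟩
      refine eval_seq.2 ⟨_, eval_assign_var.2 ⟨_, _, eval_num.2 ⟨rfl, rfl⟩, rfl, rfl⟩, ?_⟩
      rw [extStore_set_zero]
      exact eval_seq.2 ⟨_, h₁, h₂⟩
    · refine .inr ⟨by omega, ih (by omega) ?_⟩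
      obtain ⟨i, hi⟩ : ∃ i, c - j = i + 1 := ⟨c - j - 1, by omega⟩
      rw [hi, List.getElem?_cons_succ] at hx
      rw [← hx]
      congr 1
      omega

lemma eval_oracle {σ τ : Store} {c l e r : ℕ} {o : List Guess} {P Q U : Term} :
    Eval (extStore σ c l e r) (oracle σ.length o P Q) τ U ↔
    ∃ x, o[c]? = some x ∧ ∃ σ₁ c₁ l₁ r₁, σ₁.length = σ.length ∧
      Eval (extStore σ (c + 1) l e r) (perform σ.length x P Q)
        (extStore σ₁ c₁ l₁ l₁ r₁) skip ∧
      τ = extStore σ₁ c₁ (r₁ + x.offset) r₁ r₁ ∧ U = var (σ.length + 1) := by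
  constructor
  · intro h
    obtain ⟨k, h⟩ := h.exists_evalN
    obtain ⟨x, hx, k', -, σ₁, c₁, l₁, r₁, hσ, h₁, h₂⟩ := evalN_oracle h
    exact ⟨x, hx, σ₁, c₁, l₁, r₁, hσ, h₁.eval, h₂⟩
  · rintro ⟨x, hx, σ₁, c₁, l₁, r₁, hσ, h₁, rfl, rfl⟩
    refine eval_oracleFrom (Nat.zero_le c) hx h₁ ?_
    rw [← hσ, eval_publish]
    exact ⟨rfl, rfl, rfl⟩

/-- Apart from `P` and `Q`, only the four identifiers of the oracle occur free. The hypothesis says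
that they are carried to those of the new scope. -/
lemma subst_oracleFrom {d d' j : ℕ} {o : List Guess} {P Q : Term} {s : ℕ → Term}
    (hs : ∀ i < 4, s (d + i) = var (d' + i)) :
    (oracleFrom d P Q j o).subst s = oracleFrom d' (P.subst s) (Q.subst s) j o := by
  have h₀ := hs 0 (by omega)
  simp only [add_zero] at h₀
  induction o generalizing j with
  | nil => simp [oracleFrom, subst, omega, hs]
  | cons x o ih =>
    cases x <;>
      simp [oracleFrom, subst, omega, hs, h₀, ih, perform, publish, check, dist]

lemma rename_oracleFrom {d d' j : ℕ} {o : List Guess} {P Q : Term} {ρ : ℕ → ℕ}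
    (hρ : ∀ i < 4, ρ (d + i) = d' + i) :
    (oracleFrom d P Q j o).rename ρ = oracleFrom d' (P.rename ρ) (Q.rename ρ) j o := by
  have h₀ := hρ 0 (by omega)
  simp only [add_zero] at h₀
  induction o generalizing j with
  | nil => simp [oracleFrom, rename, omega, hρ]
  | cons x o ih =>
    cases x <;>
      simp [oracleFrom, rename, omega, hρ, h₀, ih, perform, publish, check, dist]

/-! ### Replacement of `mkvar` terms by oracle programs -/

/-- `Rel Γ M A F`: the term `M` has the simple type `A` in the context `Γ`, and `F o` arises from
`M` by the replacement of some `mkvar` terms by oracle programs with the guesses `o`. -/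
inductive Rel : List Ty → Term → Ty → (List Guess → Term) → Prop
  | var {Γ : List Ty} {i : ℕ} {A : Ty} : Γ[i]? = some A → Rel Γ (.var i) A (fun _ => .var i)
  | lam {Γ : List Ty} {A B : Ty} {M : Term} {F : List Guess → Term} :
      Rel (A :: Γ) M B F → Rel Γ (.lam A M) (.fn A B) (fun o => .lam A (F o))
  | app {Γ : List Ty} {A B : Ty} {M N : Term} {F G : List Guess → Term} :
      Rel Γ M (.fn A B) F → Rel Γ N A G → Rel Γ (.app M N) B (fun o => .app (F o) (G o))
  | num {Γ : List Ty} (n : ℕ) : Rel Γ (.num n) .nat (fun _ => .num n)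
  | op {Γ : List Ty} {f : ℕ → ℕ → ℕ} {M N : Term} {F G : List Guess → Term} :
      Rel Γ M .nat F → Rel Γ N .nat G → Rel Γ (.op f M N) .nat (fun o => .op f (F o) (G o))
  | skip {Γ : List Ty} : Rel Γ .skip .comm (fun _ => .skip)
  | seq {Γ : List Ty} {B : Ty} {M N : Term} {F G : List Guess → Term} :
      Rel Γ M .comm F → Rel Γ N B G → Rel Γ (.seq M N) B (fun o => .seq (F o) (G o))
  | assign {Γ : List Ty} {M N : Term} {F G : List Guess → Term} :
      Rel Γ M .var F → Rel Γ N .nat G → Rel Γ (.assign M N) .comm (fun o => .assign (F o) (G o))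
  | deref {Γ : List Ty} {M : Term} {F : List Guess → Term} :
      Rel Γ M .var F → Rel Γ (.deref M) .nat (fun o => .deref (F o))
  | whileDo {Γ : List Ty} {M N : Term} {F G : List Guess → Term} :
      Rel Γ M .nat F → Rel Γ N .comm G →
      Rel Γ (.whileDo M N) .comm (fun o => .whileDo (F o) (G o))
  | ifZero {Γ : List Ty} {B : Ty} {M N₁ N₂ : Term} {F G₁ G₂ : List Guess → Term} :
      Rel Γ M .nat F → Rel Γ N₁ B G₁ → Rel Γ N₂ B G₂ →
      Rel Γ (.ifZero M N₁ N₂) B (fun o => .ifZero (F o) (G₁ o) (G₂ o))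
  | newvar {Γ : List Ty} {B : Ty} {M : Term} {F : List Guess → Term} :
      Rel (.var :: Γ) M B F → Rel Γ (.newvar M) B (fun o => .newvar (F o))
  | mkvar {Γ : List Ty} {M N : Term} {F G : List Guess → Term} :
      Rel Γ M (.fn .nat .comm) F → Rel Γ N .nat G →
      Rel Γ (.mkvar M N) .var (fun o => .mkvar (F o) (G o))
  -- The only constructor that introduces a dependence on the guesses. The cells of the oracle come
  -- right after the identifiers of `Γ`, so that no term typed over `Γ` can name them.
  | mark {Γ : List Ty} {M N : Term} {F G : List Guess → Term} :
      Rel Γ M (.fn .nat .comm) F → Rel Γ N .nat G →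
      Rel Γ (.mkvar M N) .var (fun o => oracle Γ.length o (F o) (G o))

/-- Affinity is forgotten here: the analysis of runs needs simple types only, and these are stable
under arbitrary call-by-name substitution. -/
lemma HasType.rel {Ops : Set (ℕ → ℕ → ℕ)} {L : Lang} {Γ : List Ty} {M : Term} {A : Ty}
    (h : HasType Ops L Γ M A) : Rel Γ M A (fun _ => M) := by
  induction h with
  | var h => exact .var h
  | lam _ h => exact .lam h
  | app _ _ _ h₁ h₂ => exact .app h₁ h₂
  | num n => exact .num n
  | op _ _ _ h₁ h₂ => exact .op h₁ h₂
  | skip => exact .skip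
  | seq _ _ _ h₁ h₂ => exact .seq h₁ h₂
  | assign _ _ h₁ h₂ => exact .assign h₁ h₂
  | deref _ h => exact .deref h
  | whileDo _ _ h₁ h₂ => exact .whileDo h₁ h₂
  | ifZero _ _ _ _ h₁ h₂ h₃ => exact .ifZero h₁ h₂ h₃
  | newvar _ _ h => exact .newvar h
  | mkvar _ _ _ h₁ h₂ => exact .mkvar h₁ h₂

/-- The second hypothesis is for the oracle cells, which lie beyond the context and are not covered
by the first. -/
lemma Rel.rename {Γ Δ : List Ty} {M : Term} {A : Ty} {F : List Guess → Term} {ρ : ℕ → ℕ}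
    (h : Rel Γ M A F) (hρ : ∀ i B, Γ[i]? = some B → Δ[ρ i]? = some B)
    (hρ' : ∀ i < 4, ρ (Γ.length + i) = Δ.length + i) :
    Rel Δ (M.rename ρ) A (fun o => (F o).rename ρ) := by
  have lift : ∀ {Γ Δ : List Ty} {ρ : ℕ → ℕ} (A : Ty), (∀ i B, Γ[i]? = some B → Δ[ρ i]? = some B) →
      (∀ i < 4, ρ (Γ.length + i) = Δ.length + i) →
      (∀ i B, (A :: Γ)[i]? = some B → (A :: Δ)[liftRen ρ i]? = some B) ∧
      (∀ i < 4, liftRen ρ ((A :: Γ).length + i) = (A :: Δ).length + i) := by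
    intro Γ Δ ρ A h h'
    refine ⟨fun i B hi => ?_, fun i hi => ?_⟩
    · cases i with
      | zero => simpa [liftRen] using hi
      | succ i => simpa [liftRen] using h i B (by simpa using hi)
    · rw [List.length_cons, show Γ.length + 1 + i = Γ.length + i + 1 by omega, liftRen, h' i hi,
        List.length_cons]
      omega
  induction h generalizing Δ ρ with
  | var h => exact .var (hρ _ _ h)
  | lam _ ih => exact .lam (ih (lift _ hρ hρ').1 (lift _ hρ hρ').2)
  | app _ _ h₁ h₂ => exact .app (h₁ hρ hρ') (h₂ hρ hρ')
  | num n => exact .num n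
  | op _ _ h₁ h₂ => exact .op (h₁ hρ hρ') (h₂ hρ hρ')
  | skip => exact .skip
  | seq _ _ h₁ h₂ => exact .seq (h₁ hρ hρ') (h₂ hρ hρ')
  | assign _ _ h₁ h₂ => exact .assign (h₁ hρ hρ') (h₂ hρ hρ')
  | deref _ h => exact .deref (h hρ hρ')
  | whileDo _ _ h₁ h₂ => exact .whileDo (h₁ hρ hρ') (h₂ hρ hρ')
  | ifZero _ _ _ h₁ h₂ h₃ => exact .ifZero (h₁ hρ hρ') (h₂ hρ hρ') (h₃ hρ hρ')
  | newvar _ ih => exact .newvar (ih (lift _ hρ hρ').1 (lift _ hρ hρ').2)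
  | mkvar _ _ h₁ h₂ => exact .mkvar (h₁ hρ hρ') (h₂ hρ hρ')
  | mark _ _ h₁ h₂ =>
    simp only [oracle, rename_oracleFrom hρ']
    exact .mark (h₁ hρ hρ') (h₂ hρ hρ')

lemma Rel.subst {Γ Δ : List Ty} {M : Term} {A : Ty} {F : List Guess → Term} {s : ℕ → Term}
    {S : List Guess → ℕ → Term}
    (h : Rel Γ M A F) (hs : ∀ i B, Γ[i]? = some B → Rel Δ (s i) B (fun o => S o i))
    (hS : ∀ o, ∀ i < 4, S o (Γ.length + i) = .var (Δ.length + i)) :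
    Rel Δ (M.subst s) A (fun o => (F o).subst (S o)) := by
  have lift : ∀ {Γ Δ : List Ty} {s : ℕ → Term} {S : List Guess → ℕ → Term} (A : Ty),
      (∀ i B, Γ[i]? = some B → Rel Δ (s i) B (fun o => S o i)) →
      (∀ o, ∀ i < 4, S o (Γ.length + i) = .var (Δ.length + i)) →
      (∀ i B, (A :: Γ)[i]? = some B → Rel (A :: Δ) (liftSub s i) B (fun o => liftSub (S o) i)) ∧
      (∀ o, ∀ i < 4, liftSub (S o) ((A :: Γ).length + i) = .var ((A :: Δ).length + i)) := by
    intro Γ Δ s S A h h'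
    refine ⟨fun i B hi => ?_, fun o i hi => ?_⟩
    · cases i with
      | zero => exact .var (by simpa using hi)
      | succ i =>
        refine (h i B (by simpa using hi)).rename (fun j C hj => by simpa using hj) ?_
        intro j _
        simp only [List.length_cons]
        omega
    · rw [List.length_cons, show Γ.length + 1 + i = Γ.length + i + 1 by omega, liftSub, h' o i hi,
        List.length_cons, Term.rename]
      congr 1
      omega
  induction h generalizing Δ s S with
  | var h => exact hs _ _ h
  | lam _ ih => exact .lam (ih (lift _ hs hS).1 (lift _ hs hS).2)
  | app _ _ h₁ h₂ => exact .app (h₁ hs hS) (h₂ hs hS)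
  | num n => exact .num n
  | op _ _ h₁ h₂ => exact .op (h₁ hs hS) (h₂ hs hS)
  | skip => exact .skip
  | seq _ _ h₁ h₂ => exact .seq (h₁ hs hS) (h₂ hs hS)
  | assign _ _ h₁ h₂ => exact .assign (h₁ hs hS) (h₂ hs hS)
  | deref _ h => exact .deref (h hs hS)
  | whileDo _ _ h₁ h₂ => exact .whileDo (h₁ hs hS) (h₂ hs hS)
  | ifZero _ _ _ h₁ h₂ h₃ => exact .ifZero (h₁ hs hS) (h₂ hs hS) (h₃ hs hS)
  | newvar _ ih => exact .newvar (ih (lift _ hs hS).1 (lift _ hs hS).2)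
  | mkvar _ _ h₁ h₂ => exact .mkvar (h₁ hs hS) (h₂ hs hS)
  | mark _ _ h₁ h₂ =>
    simp only [oracle, subst_oracleFrom (hS _)]
    exact .mark (h₁ hs hS) (h₂ hs hS)

lemma Rel.inst {Γ : List Ty} {M N : Term} {A B : Ty} {F G : List Guess → Term}
    (h : Rel (A :: Γ) M B F) (hN : Rel Γ N A G) :
    Rel Γ (M.inst N) B (fun o => (F o).inst (G o)) := by
  refine h.subst (fun i C hi => ?_) (fun o i _ => ?_)
  · cases i with
    | zero =>
      cases hi
      exact hN
    | succ i => exact .var (by simpa using hi)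
  · rw [List.length_cons, show Γ.length + 1 + i = Γ.length + i + 1 by omega, instSub]

/-! ### Inversion of the replacement relation at values -/

section shapes

variable {Γ : List Ty} {V : Term} {A : Ty} {F : List Guess → Term} {o : List Guess}

/-- An oracle program is never a value. So a value produced from `V` for one list of guesses reveals
the constructor of the relation, and with it `V` and the whole family `F`. -/
lemma Rel.eq_num (h : Rel Γ V A F) {n : ℕ} (hF : F o = .num n) :
    V = .num n ∧ A = .nat ∧ F = fun _ => .num n := by
  cases h with
  | num m => cases hF; exact ⟨rfl, rfl, rfl⟩
  | mark => exact absurd (hF ▸ IsValue.num n) not_isValue_oracle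
  | _ => cases hF

lemma Rel.eq_skip (h : Rel Γ V A F) (hF : F o = .skip) :
    V = .skip ∧ A = .comm ∧ F = fun _ => .skip := by
  cases h with
  | skip => exact ⟨rfl, rfl, rfl⟩
  | mark => exact absurd (hF ▸ IsValue.skip) not_isValue_oracle
  | _ => cases hF

lemma Rel.eq_var (h : Rel Γ V A F) {x : ℕ} (hF : F o = .var x) :
    V = .var x ∧ Γ[x]? = some A ∧ F = fun _ => .var x := by
  cases h with
  | var hx => cases hF; exact ⟨rfl, hx, rfl⟩
  | mark => exact absurd (hF ▸ IsValue.var x) not_isValue_oracle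
  | _ => cases hF

lemma Rel.eq_lam (h : Rel Γ V A F) {B : Ty} {U : Term} (hF : F o = .lam B U) :
    ∃ C M G, V = .lam B M ∧ A = .fn B C ∧ F = (fun o => .lam B (G o)) ∧ G o = U ∧
      Rel (B :: Γ) M C G := by
  cases h with
  | lam h => cases hF; exact ⟨_, _, _, rfl, rfl, rfl, rfl, h⟩
  | mark => exact absurd (hF ▸ IsValue.lam B U) not_isValue_oracle
  | _ => cases hF

lemma Rel.eq_mkvar (h : Rel Γ V A F) {P Q : Term} (hF : F o = .mkvar P Q) :
    ∃ M N G H, V = .mkvar M N ∧ F = (fun o => .mkvar (G o) (H o)) ∧ G o = P ∧ H o = Q ∧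
      Rel Γ M (.fn .nat .comm) G ∧ Rel Γ N .nat H := by
  cases h with
  | mkvar h₁ h₂ => cases hF; exact ⟨_, _, _, _, rfl, rfl, rfl, rfl, h₁, h₂⟩
  | mark => exact absurd (hF ▸ IsValue.mkvar P Q) not_isValue_oracle
  | _ => cases hF

/-- A value stays a value, or it is an `mkvar` term that has been replaced. -/
lemma Rel.isValue_or (h : Rel Γ V A F) (hV : V.IsValue) :
    (∀ o, (F o).IsValue) ∨ ∃ M N G H, V = .mkvar M N ∧
      F = (fun o => oracle Γ.length o (G o) (H o)) ∧ Rel Γ M (.fn .nat .comm) G ∧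
      Rel Γ N .nat H := by
  cases hV <;> cases h <;>
    first
      | exact .inl fun _ => by constructor
      | exact .inr ⟨_, _, _, _, rfl, rfl, by assumption, by assumption⟩

lemma Rel.skip_of_isValue (hΓ : ∀ B ∈ Γ, B = .var) (h : Rel Γ V .comm F) (hV : V.IsValue) :
    V = .skip ∧ F = fun _ => .skip := by
  cases hV <;> cases h
  · exact ⟨rfl, rfl⟩
  · rename_i h
    cases hΓ _ (List.mem_of_getElem? h)

lemma Rel.num_of_isValue (hΓ : ∀ B ∈ Γ, B = .var) (h : Rel Γ V .nat F) (hV : V.IsValue) :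
    ∃ n, V = .num n ∧ F = fun _ => .num n := by
  cases hV <;> cases h
  · exact ⟨_, rfl, rfl⟩
  · rename_i h
    cases hΓ _ (List.mem_of_getElem? h)

end shapes

/-! ### Sequences of guesses -/

/-- The property `p` holds of the entries of a list, which are numbered from `c` on. -/
def Along (p : ℕ → Guess → Prop) (c : ℕ) (t : List Guess) : Prop :=
  ∀ i x, t[i]? = some x → p (c + i) x

lemma along_nil (p : ℕ → Guess → Prop) (c : ℕ) : Along p c [] := by
  intro i x h
  simp at h

lemma along_append {p : ℕ → Guess → Prop} {c : ℕ} {t u : List Guess} :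
    Along p c (t ++ u) ↔ Along p c t ∧ Along p (c + t.length) u := by
  constructor
  · refine fun h => ⟨fun i x hi => h i x ?_, fun i x hi => ?_⟩
    · rw [List.getElem?_append_left (List.getElem?_eq_some_iff.1 hi).1, hi]
    · rw [add_assoc]
      refine h _ x ?_
      rwa [List.getElem?_append_right (Nat.le_add_right _ _), Nat.add_sub_cancel_left]
  · rintro ⟨h₁, h₂⟩ i x hi
    rcases lt_or_ge i t.length with h | h
    · exact h₁ i x (by rwa [List.getElem?_append_left h] at hi)
    · rw [List.getElem?_append_right h] at hi
      have := h₂ _ x hi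
      rwa [add_assoc, Nat.add_sub_cancel' h] at this

lemma along_singleton {p : ℕ → Guess → Prop} {c : ℕ} {x : Guess} : Along p c [x] ↔ p c x := by
  constructor
  · intro h
    simpa using h 0 x rfl
  · intro h i y hi
    cases i with
    | zero => cases hi; exact h
    | succ i => simp at hi

/-- Two guesses are equal, or a reading is honest in the first and falsified in the second. -/
def Flip (x y : Guess) : Prop := x = y ∨ x = .read false ∧ y = .read true

/-- The guesses `t` are those found in `o` from number `c` on. -/
def Occurs (o : List Guess) : ℕ → List Guess → Prop := Along fun i x => o[i]? = some x

/-- `Trk o c c' R Q`: for certain guesses, which are obtained from those in `o` with the numbers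
from `c` to `c' - 1` by falsifying some readings, `R` holds of all sequences with these guesses, and
`Q` holds if no reading is falsified. -/
def Trk (o : List Guess) (c c' : ℕ) (R : List Guess → Prop) (Q : Prop) : Prop :=
  ∃ t : List Guess, c' = c + t.length ∧
    Along (fun i x => ∃ y, o[i]? = some y ∧ Flip y x) c t ∧
    (∀ o', Occurs o' c t → R o') ∧ (.read true ∉ t → Q)

section Trk

variable {o : List Guess} {c c₁ c₂ : ℕ} {R R' : List Guess → Prop} {Q Q' : Prop}

lemma Trk.refl (hR : ∀ o', R o') (hQ : Q) : Trk o c c R Q :=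
  ⟨[], rfl, along_nil _ _, fun o' _ => hR o', fun _ => hQ⟩

lemma Trk.single {x y : Guess} (hx : o[c]? = some x) (hxy : Flip x y) :
    Trk o c (c + 1) (fun o' => o'[c]? = some y) (y ≠ .read true) :=
  ⟨[y], rfl, along_singleton.2 ⟨x, hx, hxy⟩, fun _ h => along_singleton.1 h,
    fun h h' => h (by simp [h'])⟩

/-- Consecutive runs concatenate their guesses; no falsification in the whole means none in either
part. -/
lemma Trk.and (h : Trk o c c₁ R Q) (h' : Trk o c₁ c₂ R' Q') :
    Trk o c c₂ (fun o' => R o' ∧ R' o') (Q ∧ Q') := by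
  obtain ⟨t, rfl, h₁, h₂, h₃⟩ := h
  obtain ⟨t', rfl, h₁', h₂', h₃'⟩ := h'
  refine ⟨t ++ t', by rw [List.length_append, add_assoc], along_append.2 ⟨h₁, h₁'⟩, ?_, ?_⟩
  · intro o' ho
    obtain ⟨ho, ho'⟩ := along_append.1 ho
    exact ⟨h₂ o' ho, h₂' o' ho'⟩
  · intro ht
    rw [List.mem_append, not_or] at ht
    exact ⟨h₃ ht.1, h₃' ht.2⟩

lemma Trk.imp (h : Trk o c c₁ R Q) (hR : ∀ o', R o' → R' o') (hQ : Q → Q') :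
    Trk o c c₁ R' Q' := by
  obtain ⟨t, ht, h₁, h₂, h₃⟩ := h
  exact ⟨t, ht, h₁, fun o' ho => hR o' (h₂ o' ho), fun h => hQ (h₃ h)⟩

end Trk

/-! ### Runs of the oracle program are runs with `mkvar` -/

/-- The evaluation has ended in a store in which the location of the oracle does not have the
expected content. -/
def Doomed (Γ : List Ty) (o : List Guess) (A : Ty) (τ : Store) (U : Term) : Prop :=
  ∃ σ c l e r V F, τ = extStore σ c l e r ∧ σ.length = Γ.length ∧ l ≠ e ∧ Rel Γ V A F ∧ F o = U

/-- The outcome of an evaluation of `F o`, where `Rel Γ M A F`. -/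
def Outcome (Γ : List Ty) (A : Ty) (k : ℕ) (M : Term) (F : List Guess → Term) (o : List Guess)
    (σ : Store) (c l e r : ℕ) (τ : Store) (U : Term) : Prop :=
  Doomed Γ o A τ U ∨ l = e ∧ ∃ σ' c' l' r' V F', σ'.length = Γ.length ∧ V.IsValue ∧ Rel Γ V A F' ∧
    (∃ k' ≤ k, EvalN k' (extStore σ' c' l' l' r') (F' o) τ U) ∧
    Trk o c c' (fun o' => ∀ τ U, Eval (extStore σ' c' l' l' r') (F' o') τ U →
      Eval (extStore σ c l e r) (F o') τ U) (Eval σ M σ' V)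

/-- The outcome of an evaluation whose result is not an oracle program. -/
def Reach (Γ : List Ty) (M : Term) (F : List Guess → Term) (o : List Guess)
    (σ : Store) (c l e r : ℕ) (τ : Store) (V : Term) (F' : List Guess → Term) : Prop :=
  ∃ σ' c' l' e' r', σ'.length = Γ.length ∧ τ = extStore σ' c' l' e' r' ∧
    (l' = e' → l = e ∧
      Trk o c c' (fun o' => Eval (extStore σ c l e r) (F o') τ (F' o')) (Eval σ M σ' V))

section Outcome

variable {Γ : List Ty} {A : Ty} {k : ℕ} {M : Term} {F : List Guess → Term} {o : List Guess}
  {σ : Store} {c l e r : ℕ} {τ : Store} {U : Term}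

lemma Outcome.of_reach {V : Term} {F' : List Guess → Term}
    (h : Reach Γ M F o σ c l e r τ V F') (hV : V.IsValue) (hF : ∀ o, (F' o).IsValue)
    (hr : Rel Γ V A F') : Outcome Γ A k M F o σ c l e r τ (F' o) := by
  obtain ⟨σ', c', l', e', r', hσ, rfl, h⟩ := h
  by_cases hl : l' = e'
  · obtain ⟨he, ht⟩ := h hl
    subst hl
    refine .inr ⟨he, σ', c', l', r', V, F', hσ, hV, hr, ⟨k, le_rfl, .value (hF o)⟩, ?_⟩
    refine ht.imp (fun o' h τ U hU => ?_) id
    obtain ⟨rfl, rfl⟩ := (eval_of_isValue (hF o')).1 hU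
    exact h
  · exact .inl ⟨_, _, _, _, _, V, F', rfl, hσ, hl, hr, rfl⟩

/-- If the value of `M` is not a replaced `mkvar`, the pending run in `Outcome` is trivial.
Otherwise the pending run is that of an oracle program, which cannot be judged before it is known
whether the location handed out gets assigned or read. -/
lemma Outcome.reach_or (h : Outcome Γ A k M F o σ c l e r τ U) :
    (∃ V F', Rel Γ V A F' ∧ F' o = U ∧ Reach Γ M F o σ c l e r τ V F') ∨
    l = e ∧ U = var (Γ.length + 1) ∧ ∃ σ' c' l' r' P Q G H, σ'.length = Γ.length ∧
      Rel Γ P (.fn .nat .comm) G ∧ Rel Γ Q .nat H ∧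
      (∃ k' ≤ k, EvalN k' (extStore σ' c' l' l' r') (oracle Γ.length o (G o) (H o)) τ U) ∧
      Trk o c c' (fun o' => ∀ τ U,
        Eval (extStore σ' c' l' l' r') (oracle Γ.length o' (G o') (H o')) τ U →
        Eval (extStore σ c l e r) (F o') τ U) (Eval σ M σ' (.mkvar P Q)) := by
  rcases h with ⟨σ', c', l', e', r', V, F', rfl, hσ, hl, hr, hU⟩ |
    ⟨rfl, σ', c', l', r', V, F', hσ, hV, hr, ⟨k', hk, hrun⟩, ht⟩
  · exact .inl ⟨V, F', hr, hU, σ', c', l', e', r', hσ, rfl, fun h => absurd h hl⟩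
  · rcases hr.isValue_or hV with hF | ⟨P, Q, G, H, rfl, rfl, hP, hQ⟩
    · obtain ⟨rfl, rfl⟩ := (eval_of_isValue (hF o)).1 hrun.eval
      refine .inl ⟨V, F', hr, rfl, σ', c', l', l', r', hσ, rfl, fun _ => ⟨rfl, ?_⟩⟩
      exact ht.imp (fun o' h => h _ _ ((eval_of_isValue (hF o')).2 ⟨rfl, rfl⟩)) id
    · refine .inr ⟨rfl, ?_, σ', c', l', r', P, Q, G, H, hσ, hP, hQ, ⟨k', hk, hrun⟩, ht⟩
      rw [← hσ] at hrun
      obtain ⟨-, -, -, -, -, -, -, -, -, -, -, rfl⟩ := evalN_oracle hrun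
      rw [hσ]

lemma Outcome.num {n : ℕ} (h : Outcome Γ A k M F o σ c l e r τ (.num n)) :
    Reach Γ M F o σ c l e r τ (.num n) (fun _ => .num n) := by
  obtain ⟨V, F', hr, hF, h⟩ | ⟨-, h, -⟩ := h.reach_or
  · obtain ⟨rfl, -, rfl⟩ := hr.eq_num hF
    exact h
  · cases h

lemma Outcome.skip (h : Outcome Γ A k M F o σ c l e r τ .skip) :
    Reach Γ M F o σ c l e r τ .skip (fun _ => .skip) := by
  obtain ⟨V, F', hr, hF, h⟩ | ⟨-, h, -⟩ := h.reach_or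
  · obtain ⟨rfl, -, rfl⟩ := hr.eq_skip hF
    exact h
  · cases h

lemma Outcome.lam {B : Ty} (h : Outcome Γ A k M F o σ c l e r τ (.lam B U)) :
    ∃ C V G, A = .fn B C ∧ G o = U ∧ Rel (B :: Γ) V C G ∧
      Reach Γ M F o σ c l e r τ (.lam B V) (fun o => .lam B (G o)) := by
  obtain ⟨V, F', hr, hF, h⟩ | ⟨-, h, -⟩ := h.reach_or
  · obtain ⟨C, V, G, rfl, rfl, rfl, hG, hV⟩ := hr.eq_lam hF
    exact ⟨C, V, G, rfl, hG, hV, h⟩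
  · cases h

lemma Outcome.mkvar {M₁ M₂ : Term} (h : Outcome Γ A k M F o σ c l e r τ (.mkvar M₁ M₂)) :
    ∃ P Q G H, G o = M₁ ∧ H o = M₂ ∧ Rel Γ P (.fn .nat .comm) G ∧ Rel Γ Q .nat H ∧
      Reach Γ M F o σ c l e r τ (.mkvar P Q) (fun o => .mkvar (G o) (H o)) := by
  obtain ⟨V, F', hr, hF, h⟩ | ⟨-, h, -⟩ := h.reach_or
  · obtain ⟨P, Q, G, H, rfl, rfl, hG, hH, hP, hQ⟩ := hr.eq_mkvar hF
    exact ⟨P, Q, G, H, hG, hH, hP, hQ, h⟩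
  · cases h

/-- For constructs whose result is that of their last premise. A doomed end is passed on. In the
other case the cells agree at the intermediate store, hence also at the initial one, and the two
traces are joined. -/
lemma Outcome.bind {k' : ℕ} {M' : Term} {F' : List Guess → Term} {σ' : Store} {c' l' e' r' : ℕ}
    {R : List Guess → Prop} {Q : Prop} (h : l' = e' → l = e ∧ Trk o c c' R Q)
    (h' : Outcome Γ A k' M' F' o σ' c' l' e' r' τ U) (hk : k' ≤ k)
    (hR : ∀ o', R o' → ∀ τ U, Eval (extStore σ' c' l' e' r') (F' o') τ U →
      Eval (extStore σ c l e r) (F o') τ U)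
    (hQ : Q → ∀ τ V, Eval σ' M' τ V → Eval σ M τ V) :
    Outcome Γ A k M F o σ c l e r τ U := by
  rcases h' with h' | ⟨hl, σ'', c'', l'', r'', V, F'', hσ, hV, hr, ⟨m, hm, hrun⟩, ht⟩
  · exact .inl h'
  · obtain ⟨he, ht'⟩ := h hl
    refine .inr ⟨he, σ'', c'', l'', r'', V, F'', hσ, hV, hr, ⟨m, hm.trans hk, hrun⟩, ?_⟩
    exact (ht'.and ht).imp (fun o' h τ U hU => hR o' h.1 τ U (h.2 τ U hU))
      (fun h => hQ h.1 _ _ h.2)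

end Outcome

/-- The statement of `outcome_of_evalN` for derivations of height less than `k`. -/
def OutcomeBelow (k : ℕ) : Prop :=
  ∀ m < k, ∀ {Γ : List Ty} {M : Term} {A : Ty} {F : List Guess → Term} {o : List Guess}
    {σ τ : Store} {c l e r : ℕ} {U : Term}, Rel Γ M A F → σ.length = Γ.length →
    EvalN m (extStore σ c l e r) (F o) τ U → Outcome Γ A m M F o σ c l e r τ U

/-! ### The action of the oracle, under the induction hypothesis -/

section perform

variable {k m : ℕ} {Γ : List Ty} {P Q : Term} {G H : List Guess → Term} {o : List Guess}
  {σ σ' : Store} {c l e r c' l' r' : ℕ}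

/-- The final assignment touches only the auxiliary cell. The cells thus agree already after `P n`,
and the induction hypothesis for the shorter run of `P n` applies without the doomed case. -/
lemma OutcomeBelow.perform_write (ih : OutcomeBelow k) (hm : m ≤ k)
    (hP : Rel Γ P (.fn .nat .comm) G) (hσ : σ.length = Γ.length) {n : ℕ}
    (h : EvalN m (extStore σ c l e r) (perform Γ.length (.write n) (G o) (H o))
      (extStore σ' c' l' l' r') .skip) :
    l = e ∧ r' = n ∧
      Trk o c c' (fun o' => Eval (extStore σ c l e r)
          (perform Γ.length (.write n) (G o') (H o')) (extStore σ' c' l' l' r') .skip)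
        (Eval σ (.app P (.num n)) σ' .skip) := by
  generalize hτ : extStore σ' c' l' l' r' = τ at h
  cases h with
  | seq h₁ h₂ =>
    obtain ⟨σ₁, c₁, l₁, e₁, r₁, hσ₁, rfl, h⟩ := (ih _ (by omega) (hP.app (.num n)) hσ h₁).skip
    have h₂ := h₂.eval
    simp only [eval_assign_var, eval_num] at h₂
    obtain ⟨_, _, ⟨rfl, hn⟩, rfl, -⟩ := h₂
    cases hn
    rw [← hσ₁, extStore_set_three] at hτ
    obtain ⟨rfl, rfl, rfl, rfl, rfl⟩ := extStore_inj hτ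
    obtain ⟨rfl, ht⟩ := h rfl
    refine ⟨rfl, rfl, ht.imp (fun o' h => ?_) id⟩
    refine eval_seq.2 ⟨_, h, eval_assign_var.2 ⟨_, _, eval_num.2 ⟨rfl, rfl⟩, ?_, rfl⟩⟩
    rw [← hσ₁, extStore_set_three]

/-- The action of a read does not look at the Boolean, so the run can be repeated with every
Boolean. This makes the falsification of a read possible afterwards. -/
lemma OutcomeBelow.perform_read (ih : OutcomeBelow k) (hm : m ≤ k)
    (hQ : Rel Γ Q .nat H) (hσ : σ.length = Γ.length) {b : Bool}
    (h : EvalN m (extStore σ c l e r) (perform Γ.length (.read b) (G o) (H o))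
      (extStore σ' c' l' l' r') .skip) :
    l = e ∧
      Trk o c c' (fun o' => ∀ b, Eval (extStore σ c l e r)
          (perform Γ.length (.read b) (G o') (H o')) (extStore σ' c' l' l' r') .skip)
        (Eval σ Q σ' (.num r')) := by
  generalize hτ : extStore σ' c' l' l' r' = τ at h
  cases h with
  | assign h₁ h₂ =>
    obtain ⟨σ₁, c₁, l₁, e₁, r₁, hσ₁, rfl, h⟩ := (ih _ (by omega) hQ hσ h₁).num
    obtain ⟨rfl, hx⟩ := eval_var.1 h₂.eval
    cases hx
    rw [← hσ₁, extStore_set_three] at hτ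
    obtain ⟨rfl, rfl, rfl, rfl, rfl⟩ := extStore_inj hτ
    obtain ⟨rfl, ht⟩ := h rfl
    refine ⟨rfl, ht.imp (fun o' h b => ?_) id⟩
    refine eval_assign_var.2 ⟨_, _, h, ?_, rfl⟩
    rw [← hσ₁, extStore_set_three]
  | assignMk h₁ h₂ => cases eval_var.1 h₂.eval |>.2

end perform

/-- The critical case is a target that is a replaced `mkvar`. With a write guess, agreement of the
cells means that the guessed number was assigned, and `P` was indeed run on it. With a read guess,
agreement means that the assigned number happens to be the value of `Q`; the read is then falsified
in the trace, and no run with `mkvar` is claimed. -/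
lemma outcome_assign {k : ℕ} {Γ : List Ty} {M N : Term} {F G : List Guess → Term} {o : List Guess}
    {σ τ : Store} {c l e r : ℕ} {U : Term} (ih : OutcomeBelow k) (hM : Rel Γ M .var F)
    (hN : Rel Γ N .nat G) (hσ : σ.length = Γ.length)
    (h : EvalN k (extStore σ c l e r) (.assign (F o) (G o)) τ U) :
    Outcome Γ .comm k (.assign M N) (fun o => .assign (F o) (G o)) o σ c l e r τ U := by
  cases h with
  | value h => cases h
  | @assign _ _ _ _ _ _ n x h₁ h₂ =>
    obtain ⟨σ₁, c₁, l₁, e₁, r₁, hσ₁, rfl, ht₁⟩ := (ih _ (by omega) hN hσ h₁).num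
    refine Outcome.of_reach ?_ .skip (F' := fun _ => .skip) (fun _ => .skip) .skip
    rcases (ih _ (by omega) hM hσ₁ h₂).reach_or with ⟨V, F', hr, hF, h⟩ |
      ⟨rfl, hx, σ₂, c₂, l₂, r₂, P, Q, G', H', hσ₂, hP, hQ, ⟨k', hk', hrun⟩, ht₂⟩
    · obtain ⟨rfl, hx, rfl⟩ := hr.eq_var hF
      obtain ⟨σ₂, c₂, l₂, e₂, r₂, hσ₂, rfl, ht₂⟩ := h
      have hx : x < σ₂.length := hσ₂ ▸ (List.getElem?_eq_some_iff.1 hx).1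
      rw [extStore_set_of_lt _ _ _ _ _ _ hx]
      refine ⟨_, _, _, _, _, by simpa using hσ₂, rfl, fun hl => ?_⟩
      obtain ⟨hl₁, ht₂⟩ := ht₂ hl
      obtain ⟨hl₀, ht₁⟩ := ht₁ hl₁
      refine ⟨hl₀, (ht₁.and ht₂).imp (fun o' h => ?_) (fun h => .assign h.1 h.2)⟩
      rw [← extStore_set_of_lt _ _ _ _ _ _ hx]
      exact .assign h.1 h.2
    · cases hx
      obtain ⟨rfl, ht₁⟩ := ht₁ rfl
      rw [← hσ₂] at hrun
      obtain ⟨y, hy, k'', hk'', σ₃, c₃, l₃, r₃, hσ₃, h₃, rfl, -⟩ := evalN_oracle hrun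
      rw [← hσ₂, ← hσ₃, extStore_set_one]
      refine ⟨_, _, _, _, _, hσ₃.trans hσ₂, rfl, fun hl => ⟨rfl, ?_⟩⟩
      subst hl
      rw [hσ₂] at h₃
      -- The offset published by the guess `z` is overwritten by the assignment, so the final store
      -- does not depend on it: the run is the same whether or not the read is falsified.
      have replay : ∀ {o' : List Guess} {z : Guess}, Eval (extStore σ c l l r) (G o')
            (extStore σ₁ c₁ l₁ l₁ r₁) (.num n) →
          (∀ τ U, Eval (extStore σ₂ c₂ l₂ l₂ r₂) (oracle Γ.length o' (G' o') (H' o')) τ U →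
            Eval (extStore σ₁ c₁ l₁ l₁ r₁) (F o') τ U) → o'[c₂]? = some z →
          Eval (extStore σ₂ (c₂ + 1) l₂ l₂ r₂) (perform Γ.length z (G' o') (H' o'))
            (extStore σ₃ c₃ l₃ l₃ n) .skip →
          Eval (extStore σ c l l r) (.assign (F o') (G o')) (extStore σ₃ c₃ n n n) .skip := by
        intro o' z h₁ h₂ hz h₃
        refine eval_assign.2 ⟨_, _, _, _, h₁, h₂ _ _ (hσ₂ ▸ eval_oracle.2 ⟨z, hz, _, _, _, _, hσ₃,
          by rwa [hσ₂], rfl, rfl⟩), .inl ⟨_, rfl, ?_, rfl⟩⟩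
        rw [← hσ₂, ← hσ₃, extStore_set_one]
      cases y with
      | write m =>
        obtain ⟨-, rfl, ht₃⟩ := ih.perform_write (by omega) hP hσ₂ h₃
        refine (((ht₁.and ht₂).and (.single hy (.inl rfl))).and ht₃).imp (fun o' h => ?_)
          (fun h => .assignMk h.1.1.1 h.1.1.2 h.2)
        exact replay h.1.1.1 h.1.1.2 h.1.2 h.2
      | read b =>
        obtain ⟨-, ht₃⟩ := ih.perform_read (by omega) hQ hσ₂ h₃
        have hb : Flip (.read b) (.read true) := by
          cases b
          · exact .inr ⟨rfl, rfl⟩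
          · exact .inl rfl
        refine (((ht₁.and ht₂).and (.single hy hb)).and ht₃).imp (fun o' h => ?_)
          (fun h => absurd rfl h.1.2)
        exact replay h.1.1.1 h.1.1.2 h.1.2 (h.2 _)
  | assignMk h₁ h₂ h₃ =>
    obtain ⟨σ₁, c₁, l₁, e₁, r₁, hσ₁, rfl, ht₁⟩ := (ih _ (by omega) hN hσ h₁).num
    obtain ⟨P, Q, G', H', rfl, rfl, hP, hQ, σ₂, c₂, l₂, e₂, r₂, hσ₂, rfl, ht₂⟩ :=
      (ih _ (by omega) hM hσ₁ h₂).mkvar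
    have ht := fun hl : l₂ = e₂ =>
      And.intro (ht₁ (ht₂ hl).1).1 ((ht₁ (ht₂ hl).1).2.and (ht₂ hl).2)
    exact Outcome.bind ht (ih _ (by omega) (hP.app (.num _)) hσ₂ h₃) (by omega)
      (fun o' h τ U hU => .assignMk h.1 h.2 hU) (fun h τ V hV => .assignMk h.1 h.2 hV)

/-- Reading changes neither cell. The cells agree after a read of the oracle location only if the
offset is zero, that is, if an honest read was guessed; then the number read is the value of `Q`. -/
lemma outcome_deref {k : ℕ} {Γ : List Ty} {M : Term} {F : List Guess → Term} {o : List Guess}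
    {σ τ : Store} {c l e r : ℕ} {U : Term} (ih : OutcomeBelow k) (hM : Rel Γ M .var F)
    (hσ : σ.length = Γ.length)
    (h : EvalN k (extStore σ c l e r) (.deref (F o)) τ U) :
    Outcome Γ .nat k (.deref M) (fun o => .deref (F o)) o σ c l e r τ U := by
  cases h with
  | value h => cases h
  | @deref _ _ _ _ n x h₂ hn =>
    refine Outcome.of_reach ?_ (.num n) (F' := fun _ => .num n) (fun _ => .num n) (.num n)
    rcases (ih _ (by omega) hM hσ h₂).reach_or with ⟨V, F', hr, hF, h⟩ |
      ⟨rfl, hx, σ₂, c₂, l₂, r₂, P, Q, G', H', hσ₂, hP, hQ, ⟨k', hk', hrun⟩, ht₂⟩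
    · obtain ⟨rfl, hx, rfl⟩ := hr.eq_var hF
      obtain ⟨σ₂, c₂, l₂, e₂, r₂, hσ₂, rfl, ht₂⟩ := h
      have hx : x < σ₂.length := hσ₂ ▸ (List.getElem?_eq_some_iff.1 hx).1
      refine ⟨_, _, _, _, _, hσ₂, rfl, fun hl => ?_⟩
      obtain ⟨hl₀, ht₂⟩ := ht₂ hl
      refine ⟨hl₀, ht₂.imp (fun o' h => .deref h hn) (fun h => .deref h ?_)⟩
      rwa [extStore_get_of_lt _ _ _ _ _ hx] at hn
    · cases hx
      rw [← hσ₂] at hrun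
      obtain ⟨y, hy, k'', hk'', σ₃, c₃, l₃, r₃, hσ₃, h₃, rfl, -⟩ := evalN_oracle hrun
      rw [← hσ₂, ← hσ₃, extStore_get_one] at hn
      cases hn
      refine ⟨_, _, _, _, _, hσ₃.trans hσ₂, rfl, fun hl => ⟨rfl, ?_⟩⟩
      rw [hσ₂] at h₃
      cases y with
      | write m => simp [Guess.offset] at hl
      | read b =>
        cases b with
        | true => simp [Guess.offset] at hl
        | false =>
          obtain ⟨-, ht₃⟩ := ih.perform_read (by omega) hQ hσ₂ h₃
          refine ((ht₂.and (.single hy (.inl rfl))).and ht₃).imp (fun o' h => ?_)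
            (fun h => .derefMk h.1.1 h.2)
          refine eval_deref.2 ⟨_, _, h.1.1 _ _ (hσ₂ ▸ eval_oracle.2 ⟨_, h.1.2, _, _, _, _, hσ₃,
            by rw [hσ₂]; exact h.2 false, rfl, rfl⟩), .inl ⟨_, _, rfl, rfl, ?_, rfl⟩⟩
          rw [← hσ₂, ← hσ₃, extStore_get_one]
  | derefMk h₂ h₃ =>
    obtain ⟨P, Q, G', H', rfl, rfl, hP, hQ, σ₂, c₂, l₂, e₂, r₂, hσ₂, rfl, ht₂⟩ :=
      (ih _ (by omega) hM hσ h₂).mkvar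
    exact Outcome.bind ht₂ (ih _ (by omega) hQ hσ₂ h₃) (by omega)
      (fun o' h τ U hU => .derefMk h hU) (fun h τ V hV => .derefMk h hV)

/-- Cells that disagree are never repaired: ordinary assignments cannot reach them, and the oracle
checks them before it overwrites them. So a run that ends in agreement has respected every guess, up
to assignments made at guessed reads. -/
lemma outcome_of_evalN {k : ℕ} {Γ : List Ty} {M : Term} {A : Ty} {F : List Guess → Term}
    {o : List Guess} {σ τ : Store} {c l e r : ℕ} {U : Term} (hr : Rel Γ M A F)
    (hσ : σ.length = Γ.length) (h : EvalN k (extStore σ c l e r) (F o) τ U) :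
    Outcome Γ A k M F o σ c l e r τ U := by
  induction k using Nat.strong_induction_on generalizing Γ M A F o σ τ c l e r U with
  | _ k ih =>
  replace ih : OutcomeBelow k := fun m hm => ih m hm
  have value : ∀ {V : Term} {F : List Guess → Term}, V.IsValue → (∀ o, (F o).IsValue) →
      Rel Γ V A F → EvalN k (extStore σ c l e r) (F o) τ U →
      Outcome Γ A k V F o σ c l e r τ U := by
    intro V F hV hF hr h
    obtain ⟨rfl, rfl⟩ := (eval_of_isValue (hF o)).1 h.eval
    exact .of_reach ⟨_, _, _, _, _, hσ, rfl, fun hl => ⟨hl, .refl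
      (fun o' => .value (hF o')) (.value hV)⟩⟩ hV hF hr
  cases hr with
  | var hi => exact value (.var _) (fun _ => .var _) (.var hi) h
  | lam hM => exact value (.lam _ _) (fun _ => .lam _ _) (.lam hM) h
  | num n => exact value (.num _) (fun _ => .num _) (.num n) h
  | skip => exact value .skip (fun _ => .skip) .skip h
  | mkvar hM hN => exact value (.mkvar _ _) (fun _ => .mkvar _ _) (.mkvar hM hN) h
  | app hM hN =>
    cases h with
    | value h => cases h
    | app h₁ h₂ =>
      obtain ⟨_, V, G, hA, rfl, hV, σ₁, c₁, l₁, e₁, r₁, hσ₁, rfl, ht⟩ :=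
        (ih _ (by omega) hM hσ h₁).lam
      cases hA
      exact Outcome.bind ht (ih _ (by omega) (hV.inst hN) hσ₁ h₂) (by omega)
        (fun o' h τ U hU => .app h hU) (fun h τ V hV => .app h hV)
  | op hM hN =>
    cases h with
    | value h => cases h
    | op h₁ h₂ =>
      obtain ⟨σ₁, c₁, l₁, e₁, r₁, hσ₁, rfl, ht₁⟩ := (ih _ (by omega) hM hσ h₁).num
      obtain ⟨σ₂, c₂, l₂, e₂, r₂, hσ₂, rfl, ht₂⟩ := (ih _ (by omega) hN hσ₁ h₂).num
      refine Outcome.of_reach ⟨_, _, _, _, _, hσ₂, rfl, fun hl => ?_⟩ (.num _)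
        (F' := fun _ => .num _) (fun _ => .num _) (.num _)
      obtain ⟨hl₁, ht₂⟩ := ht₂ hl
      obtain ⟨hl₀, ht₁⟩ := ht₁ hl₁
      exact ⟨hl₀, (ht₁.and ht₂).imp (fun o' h => .op h.1 h.2) (fun h => .op h.1 h.2)⟩
  | seq hM hN =>
    cases h with
    | value h => cases h
    | seq h₁ h₂ =>
      obtain ⟨σ₁, c₁, l₁, e₁, r₁, hσ₁, rfl, ht⟩ := (ih _ (by omega) hM hσ h₁).skip
      exact Outcome.bind ht (ih _ (by omega) hN hσ₁ h₂) (by omega)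
        (fun o' h τ U hU => .seq h hU) (fun h τ V hV => .seq h hV)
  | assign hM hN => exact outcome_assign ih hM hN hσ h
  | deref hM => exact outcome_deref ih hM hσ h
  | @whileDo _ _ _ F G hM hN =>
    cases h with
    | value h => cases h
    | whileExit hn h₁ =>
      obtain ⟨σ₁, c₁, l₁, e₁, r₁, hσ₁, rfl, ht⟩ := (ih _ (by omega) hM hσ h₁).num
      refine Outcome.of_reach ⟨_, _, _, _, _, hσ₁, rfl, fun hl => ?_⟩ .skip
        (F' := fun _ => .skip) (fun _ => .skip) .skip
      obtain ⟨hl₀, ht⟩ := ht hl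
      exact ⟨hl₀, ht.imp (fun o' h => .whileExit hn h) (fun h => .whileExit hn h)⟩
    | whileStep h₁ h₂ h₃ =>
      obtain ⟨σ₁, c₁, l₁, e₁, r₁, hσ₁, rfl, ht₁⟩ := (ih _ (by omega) hM hσ h₁).num
      obtain ⟨σ₂, c₂, l₂, e₂, r₂, hσ₂, rfl, ht₂⟩ := (ih _ (by omega) hN hσ₁ h₂).skip
      have h₃' := ih _ (by omega) (F := fun o => .whileDo (F o) (G o)) (.whileDo hM hN) hσ₂ h₃
      obtain ⟨σ₃, c₃, l₃, e₃, r₃, hσ₃, rfl, ht₃⟩ := h₃'.skip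
      refine Outcome.of_reach ⟨_, _, _, _, _, hσ₃, rfl, fun hl => ?_⟩ .skip
        (F' := fun _ => .skip) (fun _ => .skip) .skip
      obtain ⟨hl₂, ht₃⟩ := ht₃ hl
      obtain ⟨hl₁, ht₂⟩ := ht₂ hl₂
      obtain ⟨hl₀, ht₁⟩ := ht₁ hl₁
      exact ⟨hl₀, ((ht₁.and ht₂).and ht₃).imp (fun o' h => .whileStep h.1.1 h.1.2 h.2)
        (fun h => .whileStep h.1.1 h.1.2 h.2)⟩
  | ifZero hM hN₁ hN₂ =>
    cases h with
    | value h => cases h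
    | ifTrue h₁ h₂ =>
      obtain ⟨σ₁, c₁, l₁, e₁, r₁, hσ₁, rfl, ht⟩ := (ih _ (by omega) hM hσ h₁).num
      exact Outcome.bind ht (ih _ (by omega) hN₁ hσ₁ h₂) (by omega)
        (fun o' h τ U hU => .ifTrue h hU) (fun h τ V hV => .ifTrue h hV)
    | ifFalse hn h₁ h₂ =>
      obtain ⟨σ₁, c₁, l₁, e₁, r₁, hσ₁, rfl, ht⟩ := (ih _ (by omega) hM hσ h₁).num
      exact Outcome.bind ht (ih _ (by omega) hN₂ hσ₁ h₂) (by omega)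
        (fun o' h τ U hU => .ifFalse hn h hU) (fun h τ V hV => .ifFalse hn h hV)
  | newvar hM =>
    cases h with
    | value h => cases h
    | @newvar _ _ _ _ _ n hc h₁ =>
      have h₁' := ih _ (by omega) hM (σ := 0 :: σ) (by simpa using hσ) h₁
      -- The result of a block is a constant, so it is still related to its source after the local
      -- identifier is gone.
      obtain ⟨V, F', hV, hF, rfl, hrel, σ₁, c₁, l₁, e₁, r₁, hσ₁, hτ, ht⟩ :
          ∃ V F', V.IsConst ∧ (F' = fun _ => V) ∧ U = V ∧ Rel Γ V A F' ∧
            Reach (.var :: Γ) _ _ o (0 :: σ) c l e r (n :: τ) V F' := by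
        rcases h₁'.reach_or with ⟨V, F', hr, hF, h⟩ | ⟨-, rfl, -⟩
        · cases hc with
          | num n =>
            obtain ⟨rfl, rfl, rfl⟩ := hr.eq_num hF
            exact ⟨_, _, .num n, rfl, rfl, .num n, h⟩
          | skip =>
            obtain ⟨rfl, rfl, rfl⟩ := hr.eq_skip hF
            exact ⟨_, _, .skip, rfl, rfl, .skip, h⟩
        · cases hc
      subst hF
      obtain ⟨m, σ₁, rfl⟩ : ∃ m σ', σ₁ = m :: σ' := List.exists_cons_of_length_eq_add_one hσ₁
      rw [← cons_extStore] at hτ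
      obtain ⟨rfl, rfl⟩ := List.cons_eq_cons.1 hτ
      have hv : U.IsValue := by cases hV <;> constructor
      refine Outcome.of_reach (F' := fun _ => U) ⟨σ₁, c₁, l₁, e₁, r₁, by simpa using hσ₁, rfl,
        fun hl => ?_⟩ hv (fun _ => hv) hrel
      obtain ⟨hl₀, ht⟩ := ht hl
      exact ⟨hl₀, ht.imp (fun o' h => .newvar hV h) (fun h => .newvar hV h)⟩
  | @mark _ P Q G H hP hQ =>
    -- A replaced `mkvar` is a value on the source side, so nothing has happened yet there and the
    -- entire run is left pending. If the cells disagree, no such run exists, because of the check.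
    by_cases hl : l = e
    · exact .inr ⟨hl, σ, c, l, r, _, _, hσ, .mkvar _ _, .mark hP hQ,
        ⟨k, le_rfl, by rw [← hl] at h; exact h⟩,
        .refl (fun o' τ U hU => by rw [← hl]; exact hU) (.value (.mkvar _ _))⟩
    · rw [← hσ] at h
      obtain ⟨y, hy, k', hk', σ₁, c₁, l₁, r₁, hσ₁, h₁, -, -⟩ := evalN_oracle h
      rw [hσ] at h₁
      cases y with
      | write n => exact absurd (ih.perform_write (by omega) hP hσ h₁).1 hl
      | read b => exact absurd (ih.perform_read (by omega) hQ hσ h₁).1 hl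

/-! ### Runs with `mkvar` are runs of the oracle program -/

/-- By `outcome_of_evalN`: the alternative to a doomed end requires that the cells agree at the
start. -/
lemma Doomed.next {Γ : List Ty} {o : List Guess} {A B : Ty} {τ τ' : Store} {U W N : Term}
    {G : List Guess → Term} (h : Doomed Γ o A τ W) (hN : Rel Γ N B G) (hrun : Eval τ (G o) τ' U) :
    Doomed Γ o B τ' U := by
  obtain ⟨σ, c, l, e, r, V, F, rfl, hσ, hl, -, -⟩ := h
  obtain ⟨k, hrun⟩ := hrun.exists_evalN
  rcases outcome_of_evalN hN hσ hrun with h | ⟨he, -⟩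
  · exact h
  · exact absurd he hl

lemma Doomed.result {Γ : List Ty} {o : List Guess} {A B : Ty} {τ : Store} {W V : Term}
    {F : List Guess → Term} (h : Doomed Γ o A τ W) (hr : Rel Γ V B F) : Doomed Γ o B τ (F o) := by
  obtain ⟨σ, c, l, e, r, -, -, rfl, hσ, hl, -, -⟩ := h
  exact ⟨σ, c, l, e, r, V, F, rfl, hσ, hl, hr, rfl⟩

lemma Doomed.not_stable {Γ : List Ty} {o : List Guess} {A : Ty} {σ : Store} {c l r : ℕ}
    {U : Term} (h : Doomed Γ o A (extStore σ c l l r) U) : False := by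
  obtain ⟨σ, c, l, e, r, V, F, h, -, hl, -⟩ := h
  obtain ⟨-, -, rfl, rfl, -⟩ := extStore_inj h
  exact hl rfl

/-- Provided that the guesses in `o` from number `c` on arise from `t` by falsifying some
readings, `E` holds if they are equal to `t`, and `D` holds otherwise. -/
def Follow (o : List Guess) (c : ℕ) (t : List Guess) (E D : Prop) : Prop :=
  Along (fun i x => ∃ y, o[i]? = some y ∧ Flip x y) c t →
    Occurs o c t ∧ E ∨ ¬ Occurs o c t ∧ D

section Follow

variable {o : List Guess} {c : ℕ} {t u : List Guess} {E E' D D' : Prop}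

lemma Follow.nil (hE : E) : Follow o c [] E D := fun _ => .inl ⟨along_nil _ _, hE⟩

lemma Follow.append {p : ℕ → ℕ → Prop} (h : Follow o c t (∃ l r, p l r) D')
    (h' : ∀ l r, p l r → Follow o (c + t.length) u E D) (hD : D' → D) :
    Follow o c (t ++ u) E D := by
  intro hf
  obtain ⟨h₁, h₂⟩ := along_append.1 hf
  rcases h h₁ with ⟨ho, l, r, hp⟩ | ⟨ho, hd⟩
  · rcases h' l r hp h₂ with ⟨ho', hE⟩ | ⟨ho', hd⟩
    · exact .inl ⟨along_append.2 ⟨ho, ho'⟩, hE⟩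
    · exact .inr ⟨fun h => ho' (along_append.1 h).2, hd⟩
  · exact .inr ⟨fun h => ho (along_append.1 h).1, hD hd⟩

lemma Follow.imp (h : Follow o c t E' D') (hE : E' → E) (hD : D' → D) : Follow o c t E D :=
  fun hf => (h hf).imp (And.imp_right hE) (And.imp_right hD)

/-- Write guesses are never falsified, so they cannot be where the two lists part. -/
lemma Follow.write {n : ℕ} (h : o[c]? = some (.write n) → Follow o (c + 1) t E D) :
    Follow o c (.write n :: t) E D := by
  intro hf
  rw [← List.singleton_append] at hf ⊢
  obtain ⟨h₁, h₂⟩ := along_append.1 hf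
  obtain ⟨y, hy, rfl | ⟨h, -⟩⟩ := along_singleton.1 h₁
  · rcases h hy h₂ with ⟨ho', hE⟩ | ⟨ho', hd⟩
    · exact .inl ⟨along_append.2 ⟨along_singleton.2 hy, ho'⟩, hE⟩
    · exact .inr ⟨fun h => ho' (along_append.1 h).2, hd⟩
  · cases h

lemma Follow.read (h : o[c]? = some (.read false) → Follow o (c + 1) t E D)
    (h' : o[c]? = some (.read true) → D) : Follow o c (.read false :: t) E D := by
  intro hf
  rw [← List.singleton_append] at hf ⊢
  obtain ⟨h₁, h₂⟩ := along_append.1 hf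
  obtain ⟨y, hy, rfl | ⟨-, rfl⟩⟩ := along_singleton.1 h₁
  · rcases h hy h₂ with ⟨ho', hE⟩ | ⟨ho', hd⟩
    · exact .inl ⟨along_append.2 ⟨along_singleton.2 hy, ho'⟩, hE⟩
    · exact .inr ⟨fun h => ho' (along_append.1 h).2, hd⟩
  · refine .inr ⟨fun ho => ?_, h' hy⟩
    have := along_singleton.1 (along_append.1 ho).1
    rw [hy] at this
    cases this

end Follow

/-- With the guesses `t`, the evaluation of `F o` in `σ` leads to `F' o` in `σ'`, and it is doomed
if some readings are falsified. -/
def Shadow (Γ : List Ty) (A : Ty) (σ σ' : Store) (F F' : List Guess → Term) (t : List Guess) :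
    Prop :=
  ∀ o c l r, Follow o c t
    (∃ l' r', ∀ τ U, Eval (extStore σ c l l r) (F o) τ U ↔
      Eval (extStore σ' (c + t.length) l' l' r') (F' o) τ U)
    (∀ τ U, Eval (extStore σ c l l r) (F o) τ U → Doomed Γ o A τ U)

/-! ### Shadows of the individual constructs -/

section Shadow

variable {Γ : List Ty} {A B : Ty} {σ σ₁ σ₂ : Store} {M N : Term}
  {F F₁ F₂ G K : List Guess → Term} {t t₁ t₂ : List Guess}

/-- `Shadow` equates all evaluations of two programs instead of asserting one. This takes the place
of determinism of evaluation: a claim that every run is doomed can be moved back from the remaining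
program to the original one. -/
lemma Shadow.bind (h₁ : Shadow Γ A σ σ₁ F F₁ t₁) (h₂ : Shadow Γ B σ₁ σ₂ G F₂ t₂)
    (hE : ∀ {o c l r σ' c' l' r'}, (∀ τ U, Eval (extStore σ c l l r) (F o) τ U ↔
        Eval (extStore σ' c' l' l' r') (F₁ o) τ U) →
      ∀ τ U, Eval (extStore σ c l l r) (K o) τ U ↔ Eval (extStore σ' c' l' l' r') (G o) τ U)
    (hD : ∀ {o c l r}, (∀ τ U, Eval (extStore σ c l l r) (F o) τ U → Doomed Γ o A τ U) →
      ∀ τ U, Eval (extStore σ c l l r) (K o) τ U → Doomed Γ o B τ U) :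
    Shadow Γ B σ σ₂ K F₂ (t₁ ++ t₂) := by
  intro o c l r
  refine (h₁ o c l r).append (fun l' r' hp => ?_) hD
  refine (h₂ o _ l' r').imp ?_ ?_
  · rintro ⟨l₂, r₂, h⟩
    refine ⟨l₂, r₂, fun τ U => ?_⟩
    rw [hE hp, h, List.length_append, add_assoc]
  · intro h τ U hU
    exact h τ U ((hE hp τ U).1 hU)

lemma Shadow.num {n : ℕ} (h : Shadow Γ A σ σ₁ F (fun _ => .num n) t) (o : List Guess)
    (c l r : ℕ) : Follow o c t
      (∃ l' r', ∀ τ U, Eval (extStore σ c l l r) (F o) τ U ↔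
        τ = extStore σ₁ (c + t.length) l' l' r' ∧ U = .num n)
      (∀ τ U, Eval (extStore σ c l l r) (F o) τ U → Doomed Γ o A τ U) := by
  simpa only [eval_num] using h o c l r

lemma Shadow.skip (h : Shadow Γ A σ σ₁ F (fun _ => .skip) t) (o : List Guess)
    (c l r : ℕ) : Follow o c t
      (∃ l' r', ∀ τ U, Eval (extStore σ c l l r) (F o) τ U ↔
        τ = extStore σ₁ (c + t.length) l' l' r' ∧ U = .skip)
      (∀ τ U, Eval (extStore σ c l l r) (F o) τ U → Doomed Γ o A τ U) := by
  simpa only [eval_skip] using h o c l r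

lemma Shadow.op {f : ℕ → ℕ → ℕ} {m n : ℕ} (hN : Rel Γ N .nat G)
    (h₁ : Shadow Γ .nat σ σ₁ F (fun _ => .num m) t₁)
    (h₂ : Shadow Γ .nat σ₁ σ₂ G (fun _ => .num n) t₂) :
    Shadow Γ .nat σ σ₂ (fun o => .op f (F o) (G o)) (fun _ => .num (f m n)) (t₁ ++ t₂) := by
  intro o c l r
  refine (h₁.num o c l r).append (fun l' r' hp => ?_) ?_
  · refine (h₂.num o _ l' r').imp ?_ ?_
    · rintro ⟨l₂, r₂, h⟩
      refine ⟨l₂, r₂, fun τ U => ?_⟩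
      rw [eval_op, eval_num, List.length_append, ← add_assoc]
      constructor
      · rintro ⟨_, a, b, h₁, h₂, rfl⟩
        obtain ⟨rfl, ha⟩ := (hp _ _).1 h₁
        obtain ⟨rfl, hb⟩ := (h _ _).1 h₂
        cases ha
        cases hb
        exact ⟨rfl, rfl⟩
      · rintro ⟨rfl, rfl⟩
        exact ⟨_, _, _, (hp _ _).2 ⟨rfl, rfl⟩, (h _ _).2 ⟨rfl, rfl⟩, rfl⟩
    · intro h τ U hU
      obtain ⟨_, a, b, h₁, h₂, rfl⟩ := eval_op.1 hU
      obtain ⟨rfl, ha⟩ := (hp _ _).1 h₁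
      exact (h _ _ h₂).result (F := fun _ => .num (f a b)) (.num _)
  · intro h τ U hU
    obtain ⟨_, a, b, h₁, h₂, rfl⟩ := eval_op.1 hU
    exact ((h _ _ h₁).next hN h₂).result (F := fun _ => .num (f a b)) (.num _)

lemma Shadow.app {C : Ty} (hN : Rel Γ N C G)
    (h₁ : Shadow Γ (.fn C B) σ σ₁ F (fun o => .lam C (K o)) t₁)
    (h₂ : Shadow Γ B σ₁ σ₂ (fun o => (K o).inst (G o)) F₂ t₂) :
    Shadow Γ B σ σ₂ (fun o => .app (F o) (G o)) F₂ (t₁ ++ t₂) := by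
  refine h₁.bind h₂ (fun hp τ U => ?_) (fun h τ U hU => ?_)
  · rw [eval_app]
    constructor
    · rintro ⟨_, D, V', h₁, h₂⟩
      obtain ⟨rfl, hV'⟩ := eval_lam.1 ((hp _ _).1 h₁)
      cases hV'
      exact h₂
    · exact fun h => ⟨_, _, _, (hp _ _).2 (eval_lam.2 ⟨rfl, rfl⟩), h⟩
  · obtain ⟨_, D, V', h₁, h₂⟩ := eval_app.1 hU
    have hd := h _ _ h₁
    obtain ⟨_, _, _, _, _, V, F', rfl, -, -, hr, hF⟩ := id hd
    obtain ⟨E, V, K', rfl, hE, rfl, rfl, hV⟩ := hr.eq_lam hF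
    cases hE
    exact hd.next (hV.inst hN) h₂

lemma Shadow.seq (hN : Rel Γ N B G) (h₁ : Shadow Γ .comm σ σ₁ F (fun _ => .skip) t₁)
    (h₂ : Shadow Γ B σ₁ σ₂ G F₂ t₂) :
    Shadow Γ B σ σ₂ (fun o => .seq (F o) (G o)) F₂ (t₁ ++ t₂) := by
  refine h₁.bind h₂ (fun hp τ U => ?_) (fun h τ U hU => ?_)
  · simp [eval_seq, hp]
  · obtain ⟨_, h₁, h₂⟩ := eval_seq.1 hU
    exact (h _ _ h₁).next hN h₂

lemma Shadow.ifZero {N₁ N₂ : Term} {G₁ G₂ : List Guess → Term} {n : ℕ} (hN₁ : Rel Γ N₁ B G₁)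
    (hN₂ : Rel Γ N₂ B G₂) (h₁ : Shadow Γ .nat σ σ₁ F (fun _ => .num n) t₁)
    (h₂ : Shadow Γ B σ₁ σ₂ (fun o => if n = 0 then G₁ o else G₂ o) F₂ t₂) :
    Shadow Γ B σ σ₂ (fun o => .ifZero (F o) (G₁ o) (G₂ o)) F₂ (t₁ ++ t₂) := by
  refine h₁.bind h₂ (fun hp τ U => ?_) (fun h τ U hU => ?_)
  · rw [eval_ifZero]
    by_cases hn : n = 0 <;> simp [hp, hn]
  · obtain ⟨_, n, h₁, ⟨-, h₂⟩ | ⟨-, h₂⟩⟩ := eval_ifZero.1 hU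
    · exact (h _ _ h₁).next hN₁ h₂
    · exact (h _ _ h₁).next hN₂ h₂

lemma Shadow.whileExit {n : ℕ} (hn : n ≠ 0) (hM : Rel Γ M .nat F) (hN : Rel Γ N .comm G)
    (h₁ : Shadow Γ .nat σ σ₁ F (fun _ => .num n) t) :
    Shadow Γ .comm σ σ₁ (fun o => .whileDo (F o) (G o)) (fun _ => .skip) t := by
  intro o c l r
  refine (h₁.num o c l r).imp ?_ ?_
  · rintro ⟨l', r', h⟩
    refine ⟨l', r', fun τ U => ?_⟩
    rw [eval_whileDo, eval_skip]
    simp [h, hn]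
  · intro h τ U hU
    obtain ⟨_, n, h₁, ⟨-, rfl, rfl⟩ | ⟨-, σ₂, h₂, h₃, rfl⟩⟩ := eval_whileDo.1 hU
    · exact (h _ _ h₁).result (F := fun _ => .skip) .skip
    · exact ((h _ _ h₁).next hN h₂).next (.whileDo hM hN) h₃

lemma Shadow.whileStep {σ₃ : Store} {t₃ : List Guess} (hM : Rel Γ M .nat F) (hN : Rel Γ N .comm G)
    (h₁ : Shadow Γ .nat σ σ₁ F (fun _ => .num 0) t₁)
    (h₂ : Shadow Γ .comm σ₁ σ₂ G (fun _ => .skip) t₂)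
    (h₃ : Shadow Γ .comm σ₂ σ₃ (fun o => .whileDo (F o) (G o)) (fun _ => .skip) t₃) :
    Shadow Γ .comm σ σ₃ (fun o => .whileDo (F o) (G o)) (fun _ => .skip) (t₁ ++ (t₂ ++ t₃)) := by
  refine h₁.bind (h₂.seq (.whileDo hM hN) h₃) (fun hp τ U => ?_) (fun h τ U hU => ?_)
  · rw [eval_whileDo, eval_seq]
    simp only [hp, eval_num]
    constructor
    · rintro ⟨_, n, ⟨rfl, hn⟩, ⟨hn', -⟩ | ⟨-, σ₂, h₂, h₃, rfl⟩⟩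
      · cases hn
        exact absurd rfl hn'
      · exact ⟨_, h₂, h₃⟩
    · rintro ⟨_, h₂, h₃⟩
      have hU : U = .skip := by
        obtain ⟨_, n, h₁, ⟨-, rfl, rfl⟩ | ⟨-, σ₂, h₂, h₃, rfl⟩⟩ := eval_whileDo.1 h₃ <;> rfl
      subst hU
      exact ⟨_, _, ⟨rfl, rfl⟩, .inr ⟨rfl, _, h₂, h₃, rfl⟩⟩
  · obtain ⟨_, n, h₁, ⟨-, rfl, rfl⟩ | ⟨-, σ₂, h₂, h₃, rfl⟩⟩ := eval_whileDo.1 hU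
    · exact (h _ _ h₁).result (F := fun _ => .skip) .skip
    · exact ((h _ _ h₁).next hN h₂).next (.whileDo hM hN) h₃

lemma Shadow.newvar {n : ℕ} {V : Term} (hV : V.IsConst) (hr : Rel Γ V B fun _ => V)
    (h : Shadow (.var :: Γ) B (0 :: σ) (n :: σ₁) F (fun _ => V) t) :
    Shadow Γ B σ σ₁ (fun o => .newvar (F o)) (fun _ => V) t := by
  have hv : V.IsValue := by cases hV <;> constructor
  intro o c l r
  refine (h o c l r).imp ?_ ?_
  · rintro ⟨l', r', h⟩
    refine ⟨l', r', fun τ U => ?_⟩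
    simp only [eval_of_isValue hv, ← cons_extStore] at h ⊢
    rw [eval_newvar]
    simp only [h]
    constructor
    · rintro ⟨-, n, hn, rfl⟩
      exact ⟨(List.cons_eq_cons.1 hn).2, rfl⟩
    · rintro ⟨rfl, rfl⟩
      exact ⟨hV, n, rfl, rfl⟩
  · intro h τ U hU
    obtain ⟨hc, m, hrun⟩ := eval_newvar.1 hU
    obtain ⟨σ', c', l', e', r', W, F', hτ, hσ, hl, hr, hF⟩ := h _ _ hrun
    obtain ⟨m', σ', rfl⟩ : ∃ m σ'', σ' = m :: σ'' := List.exists_cons_of_length_eq_add_one hσ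
    rw [← cons_extStore] at hτ
    obtain ⟨rfl, rfl⟩ := List.cons_eq_cons.1 hτ
    obtain ⟨W', hr'⟩ : ∃ W', Rel Γ W' B F' := by
      cases hc with
      | num n =>
        obtain ⟨rfl, rfl, rfl⟩ := hr.eq_num hF
        exact ⟨_, .num n⟩
      | skip =>
        obtain ⟨rfl, rfl, rfl⟩ := hr.eq_skip hF
        exact ⟨_, .skip⟩
    exact ⟨σ', c', l', e', r', W', F', rfl, by simpa using hσ, hl, hr', hF⟩

lemma eval_assign_num {τ₀ τ : Store} {U : Term} {n : ℕ} :
    Eval τ₀ (.assign M (.num n)) τ U ↔ ∃ τ₁ W, Eval τ₀ M τ₁ W ∧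
      ((∃ x, W = .var x ∧ τ = τ₁.set x n ∧ U = .skip) ∨
        ∃ P Q, W = .mkvar P Q ∧ Eval τ₁ (.app P (.num n)) τ U) := by
  rw [eval_assign]
  constructor
  · rintro ⟨_, m, τ₁, W, hm, h₁, h₂⟩
    obtain ⟨rfl, hm⟩ := eval_num.1 hm
    cases hm
    exact ⟨τ₁, W, h₁, h₂⟩
  · rintro ⟨τ₁, W, h₁, h₂⟩
    exact ⟨τ₀, n, τ₁, W, eval_num.2 ⟨rfl, rfl⟩, h₁, h₂⟩

/-- An identifier that comes from the source lies below the oracle cells, so assigning to it cannot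
make them agree; a `mkvar` target that was not replaced continues with a related term. -/
lemma Doomed.assign {o : List Guess} {τ₁ τ : Store} {U W : Term} {n : ℕ}
    (hd : Doomed Γ o .var τ₁ W)
    (h : (∃ x, W = .var x ∧ τ = τ₁.set x n ∧ U = .skip) ∨
      ∃ P Q, W = .mkvar P Q ∧ Eval τ₁ (.app P (.num n)) τ U) : Doomed Γ o .comm τ U := by
  rcases h with ⟨x, rfl, rfl, rfl⟩ | ⟨P, Q, rfl, h₃⟩
  · obtain ⟨σ', c, l, e, r, V, K, rfl, hσ, hl, hr, hK⟩ := hd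
    obtain ⟨rfl, hx, rfl⟩ := hr.eq_var hK
    have hx : x < σ'.length := hσ ▸ (List.getElem?_eq_some_iff.1 hx).1
    rw [extStore_set_of_lt _ _ _ _ _ _ hx]
    exact ⟨_, _, _, _, _, _, fun _ => .skip, rfl, by simpa using hσ, hl, .skip, rfl⟩
  · obtain ⟨_, _, _, _, _, V, K, rfl, -, -, hr, hK⟩ := id hd
    obtain ⟨P, Q, G, H, rfl, rfl, rfl, rfl, hP, hQ⟩ := hr.eq_mkvar hK
    exact hd.next (hP.app (.num n)) h₃

lemma Doomed.deref {o : List Guess} {τ₁ τ : Store} {U W : Term} (hd : Doomed Γ o .var τ₁ W)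
    (h : (∃ x n, W = .var x ∧ τ = τ₁ ∧ τ₁[x]? = some n ∧ U = .num n) ∨
      ∃ P Q, W = .mkvar P Q ∧ Eval τ₁ Q τ U) : Doomed Γ o .nat τ U := by
  rcases h with ⟨x, n, rfl, rfl, hx, rfl⟩ | ⟨P, Q, rfl, h₃⟩
  · exact hd.result (F := fun _ => .num n) (.num n)
  · obtain ⟨_, _, _, _, _, V, K, rfl, -, -, hr, hK⟩ := id hd
    obtain ⟨P, Q, G, H, rfl, rfl, rfl, rfl, hP, hQ⟩ := hr.eq_mkvar hK
    exact hd.next hQ h₃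

lemma Shadow.assign {n : ℕ} (hM : Rel Γ M .var F)
    (h₁ : Shadow Γ .nat σ σ₁ G (fun _ => .num n) t₁)
    (h₂ : Shadow Γ .comm σ₁ σ₂ (fun o => .assign (F o) (.num n)) F₂ t₂) :
    Shadow Γ .comm σ σ₂ (fun o => .assign (F o) (G o)) F₂ (t₁ ++ t₂) := by
  refine h₁.bind h₂ (fun hp τ U => ?_) (fun h τ U hU => ?_)
  · rw [eval_assign, eval_assign_num]
    simp only [hp, eval_num]
    constructor
    · rintro ⟨_, m, τ₁, W, ⟨rfl, hm⟩, h⟩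
      cases hm
      exact ⟨τ₁, W, h⟩
    · rintro ⟨τ₁, W, h⟩
      exact ⟨_, n, τ₁, W, ⟨rfl, rfl⟩, h⟩
  · obtain ⟨_, n, _, W, h₁, h₂, h₃⟩ := eval_assign.1 hU
    exact ((h _ _ h₁).next hM h₂).assign h₃

lemma Shadow.assign_var {n x : ℕ} (hx : x < σ₁.length)
    (h₁ : Shadow Γ .var σ σ₁ F (fun _ => .var x) t) :
    Shadow Γ .comm σ (σ₁.set x n) (fun o => .assign (F o) (.num n)) (fun _ => .skip) t := by
  intro o c l r
  refine (h₁ o c l r).imp ?_ ?_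
  · rintro ⟨l', r', h⟩
    refine ⟨l', r', fun τ U => ?_⟩
    rw [eval_assign_num, eval_skip, ← extStore_set_of_lt _ _ _ _ _ _ hx]
    simp only [h, eval_var]
    constructor
    · rintro ⟨_, W, ⟨rfl, rfl⟩, ⟨y, hy, rfl, rfl⟩ | ⟨P, Q, hPQ, -⟩⟩
      · cases hy
        exact ⟨rfl, rfl⟩
      · cases hPQ
    · rintro ⟨rfl, rfl⟩
      exact ⟨_, _, ⟨rfl, rfl⟩, .inl ⟨x, rfl, rfl, rfl⟩⟩
  · intro h τ U hU
    obtain ⟨_, W, h₁, h₂⟩ := eval_assign_num.1 hU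
    exact (h _ _ h₁).assign h₂

lemma Shadow.assign_mkvar {n : ℕ} {H : List Guess → Term}
    (h₁ : Shadow Γ .var σ σ₁ F (fun o => .mkvar (G o) (H o)) t₁)
    (h₂ : Shadow Γ .comm σ₁ σ₂ (fun o => .app (G o) (.num n)) F₂ t₂) :
    Shadow Γ .comm σ σ₂ (fun o => .assign (F o) (.num n)) F₂ (t₁ ++ t₂) := by
  refine h₁.bind h₂ (fun hp τ U => ?_) (fun h τ U hU => ?_)
  · rw [eval_assign_num]
    simp only [hp, eval_mkvar]
    constructor
    · rintro ⟨_, W, ⟨rfl, rfl⟩, ⟨y, hy, -⟩ | ⟨P, Q, hPQ, h⟩⟩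
      · cases hy
      · cases hPQ
        exact h
    · intro h
      exact ⟨_, _, ⟨rfl, rfl⟩, .inr ⟨_, _, rfl, h⟩⟩
  · obtain ⟨_, W, h₁, h₂⟩ := eval_assign_num.1 hU
    exact (h _ _ h₁).assign h₂

/-- The program runs `P n`, publishes `n + 1` with expectation `n`, and the assignment then restores
agreement. If a read inside `P n` was falsified, the check after `perform` is never passed, so there
is no run at all. -/
lemma Shadow.assign_mark {n : ℕ} {H : List Guess → Term} (hσ₁ : σ₁.length = Γ.length)
    (hσ₂ : σ₂.length = σ₁.length)
    (h₁ : Shadow Γ .var σ σ₁ F (fun o => oracle Γ.length o (G o) (H o)) t₁)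
    (h₂ : Shadow Γ .comm σ₁ σ₂ (fun o => .app (G o) (.num n)) (fun _ => .skip) t₂) :
    Shadow Γ .comm σ σ₂ (fun o => .assign (F o) (.num n)) (fun _ => .skip)
      (t₁ ++ .write n :: t₂) := by
  intro o c l r
  refine (h₁ o c l r).append (fun l₁ r₁ hp => .write fun ho => ?_) ?_
  · have key : ∀ τ U, Eval (extStore σ c l l r) (.assign (F o) (.num n)) τ U ↔
        ∃ σ' c' l' r', σ'.length = σ₁.length ∧ τ = extStore σ' c' n n n ∧ U = .skip ∧
        Eval (extStore σ₁ (c + t₁.length + 1) l₁ l₁ r₁) (.app (G o) (.num n))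
          (extStore σ' c' l' l' r') .skip := by
      intro τ U
      rw [eval_assign_num]
      simp only [hp]
      rw [← hσ₁]
      simp only [eval_oracle]
      constructor
      · rintro ⟨_, W, ⟨x, hx, σ', c', l', r', hσ', hrun, rfl, rfl⟩,
          ⟨y, hy, rfl, rfl⟩ | ⟨P, Q, hPQ, -⟩⟩
        · rw [ho] at hx
          cases hx
          cases hy
          obtain ⟨_, hrun, h₂⟩ := eval_seq.1 hrun
          obtain ⟨_, k, hk, hτ, -⟩ := eval_assign_var.1 h₂
          obtain ⟨rfl, hk⟩ := eval_num.1 hk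
          cases hk
          obtain ⟨σ₃, c₃, l₃, e₃, r₃, hσ₃, rfl⟩ := hrun.exists_extStore
          rw [← hσ₃, extStore_set_three] at hτ
          obtain ⟨rfl, rfl, rfl, rfl, rfl⟩ := extStore_inj hτ
          rw [← hσ', extStore_set_one]
          exact ⟨_, _, _, _, rfl, rfl, rfl, hrun⟩
        · cases hPQ
      · rintro ⟨σ', c', l', r', hσ', rfl, rfl, hrun⟩
        refine ⟨_, _, ⟨_, ho, σ', c', l', n, hσ', eval_seq.2 ⟨_, hrun, eval_assign_var.2
          ⟨_, _, eval_num.2 ⟨rfl, rfl⟩, ?_, rfl⟩⟩, rfl, rfl⟩, .inl ⟨_, rfl, ?_, rfl⟩⟩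
        · rw [← hσ', extStore_set_three]
        · rw [← hσ', extStore_set_one]
    refine (h₂.skip o _ l₁ r₁).imp ?_ ?_
    · rintro ⟨l₂, r₂, h⟩
      refine ⟨n, n, fun τ U => ?_⟩
      rw [key, eval_skip, List.length_append, List.length_cons,
        show c + (t₁.length + (t₂.length + 1)) = c + t₁.length + 1 + t₂.length by omega]
      constructor
      · rintro ⟨σ', c', l', r', -, rfl, rfl, hrun⟩
        obtain ⟨rfl, rfl, -⟩ := extStore_inj ((h _ _).1 hrun).1
        exact ⟨rfl, rfl⟩
      · rintro ⟨rfl, rfl⟩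
        exact ⟨_, _, _, _, hσ₂, rfl, rfl, (h _ _).2 ⟨rfl, rfl⟩⟩
    · intro h τ U hU
      obtain ⟨σ', c', l', r', -, -, -, hrun⟩ := (key _ _).1 hU
      exact (h _ _ hrun).not_stable.elim
  · intro h τ U hU
    obtain ⟨_, W, h₁, h₂⟩ := eval_assign_num.1 hU
    exact (h _ _ h₁).assign h₂

lemma Shadow.deref_var {n x : ℕ} (hx : σ₁[x]? = some n)
    (h₁ : Shadow Γ .var σ σ₁ F (fun _ => .var x) t) :
    Shadow Γ .nat σ σ₁ (fun o => .deref (F o)) (fun _ => .num n) t := by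
  intro o c l r
  refine (h₁ o c l r).imp ?_ ?_
  · rintro ⟨l', r', h⟩
    refine ⟨l', r', fun τ U => ?_⟩
    rw [← extStore_get_of_lt _ _ _ _ _ (List.getElem?_eq_some_iff.1 hx).1] at hx
    rw [eval_deref, eval_num]
    simp only [h, eval_var]
    constructor
    · rintro ⟨_, W, ⟨rfl, rfl⟩, ⟨y, m, hy, rfl, hm, rfl⟩ | ⟨P, Q, hPQ, -⟩⟩
      · cases hy
        cases hx.symm.trans hm
        exact ⟨rfl, rfl⟩
      · cases hPQ
    · rintro ⟨rfl, rfl⟩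
      exact ⟨_, _, ⟨rfl, rfl⟩, .inl ⟨x, n, rfl, rfl, hx, rfl⟩⟩
  · intro h τ U hU
    obtain ⟨_, W, h₁, h₂⟩ := eval_deref.1 hU
    exact (h _ _ h₁).deref h₂

lemma Shadow.deref_mkvar {H : List Guess → Term}
    (h₁ : Shadow Γ .var σ σ₁ F (fun o => .mkvar (G o) (H o)) t₁)
    (h₂ : Shadow Γ .nat σ₁ σ₂ H F₂ t₂) :
    Shadow Γ .nat σ σ₂ (fun o => .deref (F o)) F₂ (t₁ ++ t₂) := by
  refine h₁.bind h₂ (fun hp τ U => ?_) (fun h τ U hU => ?_)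
  · rw [eval_deref]
    simp only [hp, eval_mkvar]
    constructor
    · rintro ⟨_, W, ⟨rfl, rfl⟩, ⟨y, _, hy, -⟩ | ⟨P, Q, hPQ, h⟩⟩
      · cases hy
      · cases hPQ
        exact h
    · intro h
      exact ⟨_, _, ⟨rfl, rfl⟩, .inr ⟨_, _, rfl, h⟩⟩
  · obtain ⟨_, W, h₁, h₂⟩ := eval_deref.1 hU
    exact (h _ _ h₁).deref h₂

/-- With the honest guess the cells agree on the value of `Q` after the read. With the falsified one
the location stays one above the expected content, so every run is doomed. -/
lemma Shadow.deref_mark {n : ℕ} {H : List Guess → Term} (hσ₁ : σ₁.length = Γ.length)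
    (hσ₂ : σ₂.length = σ₁.length)
    (h₁ : Shadow Γ .var σ σ₁ F (fun o => oracle Γ.length o (G o) (H o)) t₁)
    (h₂ : Shadow Γ .nat σ₁ σ₂ H (fun _ => .num n) t₂) :
    Shadow Γ .nat σ σ₂ (fun o => .deref (F o)) (fun _ => .num n) (t₁ ++ .read false :: t₂) := by
  intro o c l r
  refine (h₁ o c l r).append (fun l₁ r₁ hp => ?_) ?_
  · have key : ∀ b, o[c + t₁.length]? = some (.read b) → ∀ τ U,
        Eval (extStore σ c l l r) (.deref (F o)) τ U ↔
        ∃ σ' c' l' r' m, σ'.length = σ₁.length ∧ τ = extStore σ' c' (m + b.toNat) m m ∧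
        U = .num (m + b.toNat) ∧
        Eval (extStore σ₁ (c + t₁.length + 1) l₁ l₁ r₁) (H o)
          (extStore σ' c' l' l' r') (.num m) := by
      intro b ho τ U
      rw [eval_deref]
      simp only [hp]
      rw [← hσ₁]
      simp only [eval_oracle]
      constructor
      · rintro ⟨_, W, ⟨x, hx, σ', c', l', r', hσ', hrun, rfl, rfl⟩,
          ⟨y, m, hy, rfl, hm, rfl⟩ | ⟨P, Q, hPQ, -⟩⟩
        · rw [ho] at hx
          cases hx
          cases hy
          obtain ⟨_, k, hrun, hτ, -⟩ := eval_assign_var.1 hrun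
          obtain ⟨σ₃, c₃, l₃, e₃, r₃, hσ₃, rfl⟩ := hrun.exists_extStore
          rw [← hσ₃, extStore_set_three] at hτ
          obtain ⟨rfl, rfl, rfl, rfl, rfl⟩ := extStore_inj hτ
          rw [← hσ', extStore_get_one] at hm
          cases hm
          exact ⟨_, _, _, _, _, hσ', rfl, rfl, hrun⟩
        · cases hPQ
      · rintro ⟨σ', c', l', r', m, hσ', rfl, rfl, hrun⟩
        refine ⟨_, _, ⟨_, ho, σ', c', l', m, hσ', eval_assign_var.2 ⟨_, _, hrun, ?_, rfl⟩, rfl, rfl⟩,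
          .inl ⟨_, _, rfl, rfl, ?_, rfl⟩⟩
        · rw [← hσ', extStore_set_three]
        · rw [← hσ', extStore_get_one]
          rfl
    refine .read (fun ho => (h₂.num o _ l₁ r₁).imp ?_ ?_) (fun ho τ U hU => ?_)
    · rintro ⟨l₂, r₂, h⟩
      refine ⟨n, n, fun τ U => ?_⟩
      rw [key _ ho, eval_num, List.length_append, List.length_cons,
        show c + (t₁.length + (t₂.length + 1)) = c + t₁.length + 1 + t₂.length by omega]
      simp only [h]
      constructor
      · rintro ⟨σ', c', l', r', m, -, rfl, rfl, h, hm⟩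
        cases hm
        obtain ⟨rfl, rfl, -⟩ := extStore_inj h
        exact ⟨rfl, rfl⟩
      · rintro ⟨rfl, rfl⟩
        exact ⟨_, _, _, _, _, hσ₂, rfl, rfl, rfl, rfl⟩
    · intro h τ U hU
      obtain ⟨σ', c', l', r', m, -, -, -, hrun⟩ := (key _ ho _ _).1 hU
      exact (h _ _ hrun).not_stable.elim
    · obtain ⟨σ', c', l', r', m, hσ', rfl, rfl, hrun⟩ := (key _ ho _ _).1 hU
      exact ⟨_, _, _, _, _, _, fun _ => _, rfl, hσ'.trans hσ₁, by simp, .num _, rfl⟩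
  · intro h τ U hU
    obtain ⟨_, W, h₁, h₂⟩ := eval_deref.1 hU
    exact (h _ _ h₁).deref h₂

end Shadow

/-- The list `t` is the trace of the run: each use of a replaced `mkvar` contributes a write guess
or an honest read, followed by the guesses for the uses made while it is carried out. -/
lemma Eval.exists_shadow {σ σ' : Store} {M V : Term} (h : Eval σ M σ' V) {Γ : List Ty}
    (hΓ : ∀ B ∈ Γ, B = .var) (hσ : σ.length = Γ.length) {A : Ty} {F : List Guess → Term}
    (hr : Rel Γ M A F) :
    ∃ t F', .read true ∉ t ∧ Rel Γ V A F' ∧ Shadow Γ A σ σ' F F' t := by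
  induction h generalizing Γ A F with
  | value hV => exact ⟨[], F, by simp, hr, fun o c l r => .nil ⟨l, r, fun τ U => Iff.rfl⟩⟩
  | app h₁ _ ih₁ ih₂ =>
    cases hr with
    | app hM hN =>
      obtain ⟨t₁, F₁, ht₁, hr₁, hs₁⟩ := ih₁ hΓ hσ hM
      cases hr₁ with
      | lam hV =>
        obtain ⟨t₂, F₂, ht₂, hr₂, hs₂⟩ := ih₂ hΓ (h₁.length_eq.trans hσ) (hV.inst hN)
        exact ⟨_, F₂, by simp [*], hr₂, hs₁.app hN hs₂⟩
  | op h₁ _ ih₁ ih₂ =>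
    cases hr with
    | op hM hN =>
      obtain ⟨t₁, F₁, ht₁, hr₁, hs₁⟩ := ih₁ hΓ hσ hM
      obtain ⟨t₂, F₂, ht₂, hr₂, hs₂⟩ := ih₂ hΓ (h₁.length_eq.trans hσ) hN
      cases hr₁
      cases hr₂
      exact ⟨_, _, by simp [*], .num _, hs₁.op hN hs₂⟩
  | assign h₁ h₂ ih₁ ih₂ =>
    cases hr with
    | assign hM hN =>
      obtain ⟨t₁, F₁, ht₁, hr₁, hs₁⟩ := ih₁ hΓ hσ hN
      obtain ⟨t₂, F₂, ht₂, hr₂, hs₂⟩ := ih₂ hΓ (h₁.length_eq.trans hσ) hM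
      cases hr₁
      cases hr₂ with
      | var hx =>
        refine ⟨_, _, by simp [*], .skip, hs₁.assign hM (hs₂.assign_var ?_)⟩
        rw [h₂.length_eq, h₁.length_eq, hσ]
        exact (List.getElem?_eq_some_iff.1 hx).1
  | deref h₁ hx ih₁ =>
    cases hr with
    | deref hM =>
      obtain ⟨t₁, F₁, ht₁, hr₁, hs₁⟩ := ih₁ hΓ hσ hM
      cases hr₁ with
      | var _ => exact ⟨_, _, by simp [*], .num _, hs₁.deref_var hx⟩
  | seq h₁ _ ih₁ ih₂ =>
    cases hr with
    | seq hM hN =>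
      obtain ⟨t₁, F₁, ht₁, hr₁, hs₁⟩ := ih₁ hΓ hσ hM
      obtain ⟨t₂, F₂, ht₂, hr₂, hs₂⟩ := ih₂ hΓ (h₁.length_eq.trans hσ) hN
      cases hr₁
      exact ⟨_, F₂, by simp [*], hr₂, hs₁.seq hN hs₂⟩
  | whileExit hn _ ih₁ =>
    cases hr with
    | whileDo hM hN =>
      obtain ⟨t₁, F₁, ht₁, hr₁, hs₁⟩ := ih₁ hΓ hσ hM
      cases hr₁
      exact ⟨_, _, by simp [*], .skip, hs₁.whileExit hn hM hN⟩
  | whileStep h₁ h₂ _ ih₁ ih₂ ih₃ =>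
    cases hr with
    | whileDo hM hN =>
      obtain ⟨t₁, F₁, ht₁, hr₁, hs₁⟩ := ih₁ hΓ hσ hM
      obtain ⟨t₂, F₂, ht₂, hr₂, hs₂⟩ := ih₂ hΓ (h₁.length_eq.trans hσ) hN
      obtain ⟨t₃, F₃, ht₃, hr₃, hs₃⟩ := ih₃ hΓ (h₂.length_eq.trans (h₁.length_eq.trans hσ))
        (.whileDo hM hN)
      cases hr₁
      cases hr₂
      cases hr₃
      exact ⟨_, _, by simp [*], .skip, hs₁.whileStep hM hN hs₂ hs₃⟩
  | ifTrue h₁ _ ih₁ ih₂ =>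
    cases hr with
    | ifZero hM hN₁ hN₂ =>
      obtain ⟨t₁, F₁, ht₁, hr₁, hs₁⟩ := ih₁ hΓ hσ hM
      obtain ⟨t₂, F₂, ht₂, hr₂, hs₂⟩ := ih₂ hΓ (h₁.length_eq.trans hσ) hN₁
      cases hr₁
      exact ⟨_, F₂, by simp [*], hr₂, hs₁.ifZero hN₁ hN₂ hs₂⟩
  | ifFalse hn h₁ _ ih₁ ih₂ =>
    cases hr with
    | ifZero hM hN₁ hN₂ =>
      obtain ⟨t₁, F₁, ht₁, hr₁, hs₁⟩ := ih₁ hΓ hσ hM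
      obtain ⟨t₂, F₂, ht₂, hr₂, hs₂⟩ := ih₂ hΓ (h₁.length_eq.trans hσ) hN₂
      cases hr₁
      exact ⟨t₁ ++ t₂, F₂, by simp [*], hr₂,
        hs₁.ifZero hN₁ hN₂ (by simpa only [if_neg hn] using hs₂)⟩
  | newvar hc h₁ ih₁ =>
    cases hr with
    | newvar hM =>
      obtain ⟨t₁, F₁, ht₁, hr₁, hs₁⟩ := ih₁ (by simpa using hΓ) (by simpa using hσ) hM
      cases hc <;> cases hr₁
      · exact ⟨_, _, by simp [*], .num _, hs₁.newvar (.num _) (.num _)⟩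
      · exact ⟨_, _, by simp [*], .skip, hs₁.newvar .skip .skip⟩
  | assignMk h₁ h₂ h₃ ih₁ ih₂ ih₃ =>
    cases hr with
    | assign hM hN =>
      obtain ⟨t₁, F₁, ht₁, hr₁, hs₁⟩ := ih₁ hΓ hσ hN
      obtain ⟨t₂, F₂, ht₂, hr₂, hs₂⟩ := ih₂ hΓ (h₁.length_eq.trans hσ) hM
      have hσ₂ := h₂.length_eq.trans (h₁.length_eq.trans hσ)
      cases hr₁
      cases hr₂ with
      | mkvar hP hQ =>
        obtain ⟨t₃, F₃, ht₃, hr₃, hs₃⟩ := ih₃ hΓ hσ₂ (hP.app (.num _))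
        exact ⟨_, F₃, by simp [*], hr₃, hs₁.assign hM (hs₂.assign_mkvar hs₃)⟩
      | mark hP hQ =>
        obtain ⟨t₃, F₃, ht₃, hr₃, hs₃⟩ := ih₃ hΓ hσ₂ (hP.app (.num _))
        obtain ⟨rfl, rfl⟩ := hr₃.skip_of_isValue hΓ h₃.isValue
        exact ⟨_, _, by simp [*], .skip, hs₁.assign hM (hs₂.assign_mark hσ₂ h₃.length_eq hs₃)⟩
  | derefMk h₂ h₃ ih₂ ih₃ =>
    cases hr with
    | deref hM =>
      obtain ⟨t₂, F₂, ht₂, hr₂, hs₂⟩ := ih₂ hΓ hσ hM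
      have hσ₂ := h₂.length_eq.trans hσ
      cases hr₂ with
      | mkvar hP hQ =>
        obtain ⟨t₃, F₃, ht₃, hr₃, hs₃⟩ := ih₃ hΓ hσ₂ hQ
        exact ⟨_, F₃, by simp [*], hr₃, hs₂.deref_mkvar hs₃⟩
      | mark hP hQ =>
        obtain ⟨t₃, F₃, ht₃, hr₃, hs₃⟩ := ih₃ hΓ hσ₂ hQ
        obtain ⟨n, rfl, rfl⟩ := hr₃.num_of_isValue hΓ h₃.isValue
        exact ⟨_, _, by simp [*], .num _, hs₂.deref_mark hσ₂ h₃.length_eq hs₃⟩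

/-- The program `M` leaves the location of the oracle with the expected content. -/
def Passes (M V : Term) : Prop :=
  ∃ c l r, Eval (extStore [] 0 0 0 0) M (extStore [] c l l r) V

/-- A passing run ends with cells that agree, so it cannot be doomed: a proper falsification of the
trace `t` never passes. -/
lemma exists_guesses {M V : Term} {A : Ty} {F : List Guess → Term} (hr : Rel [] M A F)
    (hV : V.IsConst) (h : Eval [] M [] V) :
    ∃ t : List Guess, .read true ∉ t ∧ Passes (F t) V ∧
      ∀ o, Along (fun i x => ∃ y, o[i]? = some y ∧ Flip x y) 0 t → ¬ Occurs o 0 t →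
        ¬ Passes (F o) V := by
  obtain ⟨t, F', ht, hr', hs⟩ := h.exists_shadow (by simp) rfl hr
  obtain rfl : F' = fun _ => V := by cases hV <;> cases hr' <;> rfl
  refine ⟨t, ht, ?_, fun o ho hno => ?_⟩
  · have hocc : Occurs t 0 t := fun i x hi => by rwa [zero_add]
    rcases hs t 0 0 0 (fun i x hi => ⟨x, by rwa [zero_add], .inl rfl⟩) with
      ⟨-, l, r, h⟩ | ⟨h, -⟩
    · exact ⟨0 + t.length, l, r, (h _ _).2 (.value (by cases hV <;> constructor))⟩
    · exact absurd hocc h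
  · rintro ⟨c, l, r, hrun⟩
    rcases hs o 0 0 0 ho with ⟨h, -⟩ | ⟨-, h⟩
    · exact hno h
    · exact (h _ _ hrun).not_stable

/-- Here `t` records the guesses actually consumed, with the reads at which an assignment took place
falsified. Guesses in `o` beyond these are irrelevant. -/
lemma Passes.exists_guesses {M V : Term} {A : Ty} {F : List Guess → Term} (hr : Rel [] M A F)
    (hV : V.IsConst) {o : List Guess} (h : Passes (F o) V) :
    ∃ t : List Guess, Along (fun i x => ∃ y, o[i]? = some y ∧ Flip y x) 0 t ∧
      (∀ o', Occurs o' 0 t → Passes (F o') V) ∧ (.read true ∉ t → Eval [] M [] V) := by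
  obtain ⟨c, l, r, hrun⟩ := h
  obtain ⟨k, hrun⟩ := hrun.exists_evalN
  have hout := outcome_of_evalN hr rfl hrun
  obtain ⟨F', hF, hreach⟩ : ∃ F', (F' = fun _ => V) ∧
      Reach [] M F o [] 0 0 0 0 (extStore [] c l l r) V F' := by
    cases hV
    · exact ⟨_, rfl, hout.num⟩
    · exact ⟨_, rfl, hout.skip⟩
  subst hF
  obtain ⟨σ', c', l', e', r', hσ, hτ, h⟩ := hreach
  obtain ⟨rfl, rfl, rfl, rfl, rfl⟩ := extStore_inj hτ
  obtain ⟨-, t, rfl, h₁, h₂, h₃⟩ := h rfl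
  exact ⟨t, h₁, fun o' ho' => ⟨_, _, _, h₂ o' ho'⟩, h₃⟩

/-- If `M` and `N` cannot be told apart after the replacement of an `mkvar` term by any oracle
program, then a run of `M` with that `mkvar` term is matched by a run of `N`. -/
lemma eval_of_passes_iff {M N V : Term} {A B : Ty} {F G : List Guess → Term}
    (hM : Rel [] M A F) (hN : Rel [] N B G) (hV : V.IsConst)
    (hFG : ∀ o, Passes (F o) V ↔ Passes (G o) V) (h : Eval [] M [] V) : Eval [] N [] V := by
  obtain ⟨t, ht, hpass, hfail⟩ := SCI.exists_guesses hM hV h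
  obtain ⟨u, hu, hpass', hreal⟩ := ((hFG t).1 hpass).exists_guesses hN hV
  refine hreal fun hmem => ?_
  -- The run of `N` may consume fewer guesses than `t` has. Padding `u` by the rest of `t` gives a
  -- falsification of all of `t`, as `hfail` requires.
  have hocc : Occurs (u ++ t.drop u.length) 0 u := fun i x hi => by
    show (u ++ _)[0 + i]? = some x
    rw [zero_add, List.getElem?_append_left (List.getElem?_eq_some_iff.1 hi).1, hi]
  refine hfail (u ++ t.drop u.length) (fun i x hi => ?_) (fun hocc' => ?_)
    ((hFG _).2 (hpass' _ hocc))
  · rw [zero_add]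
    rcases lt_or_ge i u.length with hlt | hge
    · obtain ⟨y, hy, hxy⟩ := hu i u[i] (List.getElem?_eq_getElem hlt)
      rw [zero_add, hi] at hy
      cases hy
      exact ⟨u[i], by rw [List.getElem?_append_left hlt, List.getElem?_eq_getElem hlt], hxy⟩
    · refine ⟨x, ?_, .inl rfl⟩
      rw [List.getElem?_append_right hge, List.getElem?_drop, Nat.add_sub_cancel' hge, hi]
  -- If the padded list agreed with `t`, the falsified read in `u` would already occur in `t`.
  · obtain ⟨i, hi, hui⟩ := List.getElem_of_mem hmem
    obtain ⟨y, hy, -⟩ := hu i u[i] (List.getElem?_eq_getElem hi)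
    rw [zero_add] at hy
    have hy' := hocc' i y hy
    rw [zero_add, List.getElem?_append_left hi, List.getElem?_eq_getElem hi, hui] at hy'
    cases hy'
    exact ht (List.mem_of_getElem? hy)

/-! ### Elimination of an `mkvar` from a context -/

lemma HasType.lt_length_of_mem_fv {Ops : Set (ℕ → ℕ → ℕ)} {L : Lang} {Γ : List Ty} {M : Term}
    {A : Ty} (h : HasType Ops L Γ M A) {i : ℕ} (hi : i ∈ M.fv) : i < Γ.length := by
  induction h generalizing i with
  | var h =>
    cases hi
    exact (List.getElem?_eq_some_iff.1 h).1
  | lam _ ih | newvar _ _ ih =>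
    have := ih hi
    simpa using this
  | _ => simp only [fv, Set.mem_union, Set.mem_empty_iff_false] at hi <;> grind

lemma HasType.append {Ops : Set (ℕ → ℕ → ℕ)} {L : Lang} {Γ : List Ty} {M : Term}
    {A : Ty} (h : HasType Ops L Γ M A) (Δ : List Ty) : HasType Ops L (Γ ++ Δ) M A := by
  induction h with
  | var h =>
    exact .var (by rw [List.getElem?_append_left (List.getElem?_eq_some_iff.1 h).1, h])
  | lam _ h => exact .lam h
  | app _ _ hd h₁ h₂ => exact .app h₁ h₂ hd
  | num n => exact .num n
  | op hf _ _ h₁ h₂ => exact .op hf h₁ h₂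
  | skip => exact .skip
  | seq hB _ _ h₁ h₂ => exact .seq hB h₁ h₂
  | assign _ _ h₁ h₂ => exact .assign h₁ h₂
  | deref _ h => exact .deref h
  | whileDo _ _ h₁ h₂ => exact .whileDo h₁ h₂
  | ifZero hB _ _ _ h₁ h₂ h₃ => exact .ifZero hB h₁ h₂ h₃
  | newvar hB _ h => exact .newvar hB h
  | mkvar hL _ _ h₁ h₂ => exact .mkvar hL h₁ h₂

lemma mem_fv_rename {M : Term} {ρ : ℕ → ℕ} {i : ℕ} (hi : i ∈ M.fv) : ρ i ∈ (M.rename ρ).fv := by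
  induction M generalizing ρ i with
  | var j =>
    cases hi
    rfl
  | lam A M ih =>
    have := ih (ρ := liftRen ρ) hi
    exact this
  | newvar M ih =>
    have := ih (ρ := liftRen ρ) hi
    exact this
  | _ => simp only [fv, rename, Set.mem_union, Set.mem_empty_iff_false] at hi ⊢ <;> grind

lemma rename_congr {M : Term} {ρ ρ' : ℕ → ℕ} (h : ∀ i ∈ M.fv, ρ i = ρ' i) :
    M.rename ρ = M.rename ρ' := by
  have lift : ∀ {M : Term} {ρ ρ' : ℕ → ℕ}, (∀ i, i + 1 ∈ M.fv → ρ i = ρ' i) →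
      ∀ i ∈ M.fv, liftRen ρ i = liftRen ρ' i := by
    intro M ρ ρ' h i hi
    cases i with
    | zero => rfl
    | succ i => exact congrArg (· + 1) (h i hi)
  induction M generalizing ρ ρ' with
  | var j => exact congrArg Term.var (h j rfl)
  | lam A M ih => exact congrArg (Term.lam A) (ih (lift h))
  | newvar M ih => exact congrArg Term.newvar (ih (lift h))
  | _ => simp only [fv, rename, Set.mem_union] at h ⊢ <;> grind

namespace Ctx

/-- The number of `mkvar`s in a context. -/
def mkvars : Ctx → ℕ
  | hole _ => 0
  | num _ => 0
  | op _ C D => mkvars C + mkvars D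
  | skip => 0
  | seq C D => mkvars C + mkvars D
  | assign C D => mkvars C + mkvars D
  | deref C => mkvars C
  | whileDo C D => mkvars C + mkvars D
  | ifZero C D E => mkvars C + mkvars D + mkvars E
  | var _ => 0
  | lam _ C => mkvars C
  | app C D => mkvars C + mkvars D
  | newvar C => mkvars C
  | mkvar C D => mkvars C + mkvars D + 1

/-- A term as a context without holes. -/
def ofTerm : Term → Ctx
  | .num n => num n
  | .op f M N => op f (ofTerm M) (ofTerm N)
  | .skip => skip
  | .seq M N => seq (ofTerm M) (ofTerm N)
  | .assign M N => assign (ofTerm M) (ofTerm N)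
  | .deref M => deref (ofTerm M)
  | .whileDo M N => whileDo (ofTerm M) (ofTerm N)
  | .ifZero M N P => ifZero (ofTerm M) (ofTerm N) (ofTerm P)
  | .var i => var i
  | .lam A M => lam A (ofTerm M)
  | .app M N => app (ofTerm M) (ofTerm N)
  | .newvar M => newvar (ofTerm M)
  | .mkvar M N => mkvar (ofTerm M) (ofTerm N)

@[simp] lemma fill_ofTerm (M X : Term) : (ofTerm M).fill X = M := by
  induction M <;> simp_all [ofTerm, fill]

@[simp] lemma fits_ofTerm (M : Term) (Γ Δ : List Ty) : (ofTerm M).Fits Γ Δ := by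
  induction M generalizing Δ <;> simp_all [ofTerm, Fits]

/-- The oracle program for contexts in place of terms, with the guesses from number `j` on. -/
def oracleFrom (d : ℕ) (P Q : Ctx) : ℕ → List Guess → Ctx
  | _, [] => ofTerm (.seq omega (.var (d + 1)))
  | j, x :: o =>
    ifZero (ofTerm (.op (fun m n => m - n) (.deref (.var d)) (.num j)))
      (seq (ofTerm (.assign (.var d) (.num (j + 1))))
        (seq (match x with
            | .write n => seq (app P (num n)) (ofTerm (.assign (.var (d + 3)) (.num n)))
            | .read _ => assign (var (d + 3)) Q)
          (ofTerm (publish d x.offset))))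
      (oracleFrom d P Q (j + 1) o)

lemma fill_oracleFrom (d : ℕ) (P Q : Ctx) (j : ℕ) (o : List Guess) (X : Term) :
    (oracleFrom d P Q j o).fill X = SCI.oracleFrom d (P.fill X) (Q.fill X) j o := by
  induction o generalizing j with
  | nil => simp [oracleFrom, SCI.oracleFrom]
  | cons x o ih => cases x <;> simp [oracleFrom, SCI.oracleFrom, fill, perform, ih]

lemma mkvars_oracleFrom {d : ℕ} {P Q : Ctx} (hP : P.mkvars = 0) (hQ : Q.mkvars = 0) (j : ℕ)
    (o : List Guess) : (oracleFrom d P Q j o).mkvars = 0 := by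
  induction o generalizing j with
  | nil => rfl
  | cons x o ih =>
    cases x <;> simp [oracleFrom, mkvars, ofTerm, publish, check, dist, omega, ih, hP, hQ]

lemma fits_oracleFrom {d : ℕ} {P Q : Ctx} {Γ Δ : List Ty} (hP : P.Fits Γ Δ) (hQ : Q.Fits Γ Δ)
    (j : ℕ) (o : List Guess) : (oracleFrom d P Q j o).Fits Γ Δ := by
  induction o generalizing j with
  | nil => simp [oracleFrom]
  | cons x o ih => cases x <;> simp [oracleFrom, Fits, ih, hP, hQ]

/-- `Elim d b C D`: the context `D o`, in the scope of `d` identifiers and of the four identifiers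
of the oracle, arises from the context `C` in the scope of `d` identifiers by the replacement of
some `mkvar`s by oracle programs. If `b` is false, then nothing is replaced. -/
inductive Elim : ℕ → Bool → Ctx → (List Guess → Ctx) → Prop
  -- Identifiers that are not captured at the hole are moved past the four new ones; otherwise these
  -- would capture them, possibly at a wrong type.
  | hole {d : ℕ} {ρ : ℕ → ℕ} :
      Elim d false (hole ρ) (fun _ => .hole fun i => if ρ i < d then ρ i else ρ i + 4)
  | num {d n : ℕ} : Elim d false (.num n) (fun _ => .num n)
  | op {d : ℕ} {a b : Bool} {f : ℕ → ℕ → ℕ} {C C' : Ctx} {D D' : List Guess → Ctx} :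
      Elim d a C D → Elim d b C' D' → Elim d (a || b) (.op f C C') (fun o => .op f (D o) (D' o))
  | skip {d : ℕ} : Elim d false .skip (fun _ => .skip)
  | seq {d : ℕ} {a b : Bool} {C C' : Ctx} {D D' : List Guess → Ctx} :
      Elim d a C D → Elim d b C' D' → Elim d (a || b) (.seq C C') (fun o => .seq (D o) (D' o))
  | assign {d : ℕ} {a b : Bool} {C C' : Ctx} {D D' : List Guess → Ctx} :
      Elim d a C D → Elim d b C' D' →
      Elim d (a || b) (.assign C C') (fun o => .assign (D o) (D' o))
  | deref {d : ℕ} {a : Bool} {C : Ctx} {D : List Guess → Ctx} :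
      Elim d a C D → Elim d a (.deref C) (fun o => .deref (D o))
  | whileDo {d : ℕ} {a b : Bool} {C C' : Ctx} {D D' : List Guess → Ctx} :
      Elim d a C D → Elim d b C' D' →
      Elim d (a || b) (.whileDo C C') (fun o => .whileDo (D o) (D' o))
  | ifZero {d : ℕ} {a b c : Bool} {C C' C'' : Ctx} {D D' D'' : List Guess → Ctx} :
      Elim d a C D → Elim d b C' D' → Elim d c C'' D'' →
      Elim d (a || b || c) (.ifZero C C' C'') (fun o => .ifZero (D o) (D' o) (D'' o))
  | var {d i : ℕ} : Elim d false (.var i) (fun _ => .var i)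
  | lam {d : ℕ} {a : Bool} {A : Ty} {C : Ctx} {D : List Guess → Ctx} :
      Elim (d + 1) a C D → Elim d a (.lam A C) (fun o => .lam A (D o))
  -- Function and argument must not both use the oracle cells: this is what affine application
  -- demands.
  | app {d : ℕ} {a b : Bool} {C C' : Ctx} {D D' : List Guess → Ctx} :
      ¬ (a = true ∧ b = true) → Elim d a C D → Elim d b C' D' →
      Elim d (a || b) (.app C C') (fun o => .app (D o) (D' o))
  | newvar {d : ℕ} {a : Bool} {C : Ctx} {D : List Guess → Ctx} :
      Elim (d + 1) a C D → Elim d a (.newvar C) (fun o => .newvar (D o))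
  | mkvar {d : ℕ} {a b : Bool} {C C' : Ctx} {D D' : List Guess → Ctx} :
      Elim d a C D → Elim d b C' D' →
      Elim d (a || b) (.mkvar C C') (fun o => .mkvar (D o) (D' o))
  -- Only an innermost `mkvar` is replaced, since each guess makes a copy of one of its components.
  | mark {d : ℕ} {C C' : Ctx} {D D' : List Guess → Ctx} :
      C.mkvars = 0 → C'.mkvars = 0 → Elim d false C D → Elim d false C' D' →
      Elim d true (.mkvar C C') (fun o => oracleFrom d (D o) (D' o) 0 o)

/-- For `true`, descend into one component that still contains an `mkvar` and leave the others
alone, until an `mkvar` without further ones inside is found. -/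
lemma exists_elim (C : Ctx) (d : ℕ) :
    (∃ D, Elim d false C D) ∧ (C.mkvars ≠ 0 → ∃ D, Elim d true C D) := by
  induction C generalizing d with
  | hole ρ => exact ⟨⟨_, .hole⟩, fun h => absurd rfl h⟩
  | num n => exact ⟨⟨_, .num⟩, fun h => absurd rfl h⟩
  | skip => exact ⟨⟨_, .skip⟩, fun h => absurd rfl h⟩
  | var n => exact ⟨⟨_, .var⟩, fun h => absurd rfl h⟩
  | deref C ih =>
    obtain ⟨⟨D, hD⟩, h⟩ := ih d
    exact ⟨⟨_, hD.deref⟩, fun hC => let ⟨D, hD⟩ := h hC; ⟨_, hD.deref⟩⟩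
  | lam A C ih =>
    obtain ⟨⟨D, hD⟩, h⟩ := ih (d + 1)
    exact ⟨⟨_, hD.lam⟩, fun hC => let ⟨D, hD⟩ := h hC; ⟨_, hD.lam⟩⟩
  | newvar C ih =>
    obtain ⟨⟨D, hD⟩, h⟩ := ih (d + 1)
    exact ⟨⟨_, hD.newvar⟩, fun hC => let ⟨D, hD⟩ := h hC; ⟨_, hD.newvar⟩⟩
  | ifZero C C' C'' ih ih' ih'' =>
    obtain ⟨⟨D, hD⟩, h⟩ := ih d
    obtain ⟨⟨D', hD'⟩, h'⟩ := ih' d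
    obtain ⟨⟨D'', hD''⟩, h''⟩ := ih'' d
    refine ⟨⟨_, hD.ifZero hD' hD''⟩, fun hC => ?_⟩
    by_cases h₁ : C.mkvars = 0
    · by_cases h₂ : C'.mkvars = 0
      · obtain ⟨D, hD''⟩ := h'' (by simpa [mkvars, h₁, h₂] using hC)
        exact ⟨_, hD.ifZero hD' hD''⟩
      · obtain ⟨D, hD'⟩ := h' h₂
        exact ⟨_, hD.ifZero hD' hD''⟩
    · obtain ⟨D, hD⟩ := h h₁
      exact ⟨_, hD.ifZero hD' hD''⟩
  | mkvar C C' ih ih' =>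
    obtain ⟨⟨D, hD⟩, h⟩ := ih d
    obtain ⟨⟨D', hD'⟩, h'⟩ := ih' d
    refine ⟨⟨_, hD.mkvar hD'⟩, fun _ => ?_⟩
    by_cases h₁ : C.mkvars = 0
    · by_cases h₂ : C'.mkvars = 0
      · exact ⟨_, .mark h₁ h₂ hD hD'⟩
      · obtain ⟨D, hD'⟩ := h' h₂
        exact ⟨_, hD.mkvar hD'⟩
    · obtain ⟨D, hD⟩ := h h₁
      exact ⟨_, hD.mkvar hD'⟩
  | app C C' ih ih' =>
    obtain ⟨⟨D, hD⟩, h⟩ := ih d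
    obtain ⟨⟨D', hD'⟩, h'⟩ := ih' d
    refine ⟨⟨_, .app (by simp) hD hD'⟩, fun hC => ?_⟩
    by_cases h₁ : C.mkvars = 0
    · obtain ⟨D, hD'⟩ := h' (by simpa [mkvars, h₁] using hC)
      exact ⟨_, .app (by simp) hD hD'⟩
    · obtain ⟨D, hD⟩ := h h₁
      exact ⟨_, .app (by simp) hD hD'⟩
  | op f C C' ih ih' =>
    obtain ⟨⟨D, hD⟩, h⟩ := ih d
    obtain ⟨⟨D', hD'⟩, h'⟩ := ih' d
    refine ⟨⟨_, hD.op hD'⟩, fun hC => ?_⟩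
    by_cases h₁ : C.mkvars = 0
    · obtain ⟨D, hD'⟩ := h' (by simpa [mkvars, h₁] using hC)
      exact ⟨_, hD.op hD'⟩
    · obtain ⟨D, hD⟩ := h h₁
      exact ⟨_, hD.op hD'⟩
  | seq C C' ih ih' =>
    obtain ⟨⟨D, hD⟩, h⟩ := ih d
    obtain ⟨⟨D', hD'⟩, h'⟩ := ih' d
    refine ⟨⟨_, hD.seq hD'⟩, fun hC => ?_⟩
    by_cases h₁ : C.mkvars = 0
    · obtain ⟨D, hD'⟩ := h' (by simpa [mkvars, h₁] using hC)
      exact ⟨_, hD.seq hD'⟩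
    · obtain ⟨D, hD⟩ := h h₁
      exact ⟨_, hD.seq hD'⟩
  | assign C C' ih ih' =>
    obtain ⟨⟨D, hD⟩, h⟩ := ih d
    obtain ⟨⟨D', hD'⟩, h'⟩ := ih' d
    refine ⟨⟨_, hD.assign hD'⟩, fun hC => ?_⟩
    by_cases h₁ : C.mkvars = 0
    · obtain ⟨D, hD'⟩ := h' (by simpa [mkvars, h₁] using hC)
      exact ⟨_, hD.assign hD'⟩
    · obtain ⟨D, hD⟩ := h h₁
      exact ⟨_, hD.assign hD'⟩
  | whileDo C C' ih ih' =>
    obtain ⟨⟨D, hD⟩, h⟩ := ih d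
    obtain ⟨⟨D', hD'⟩, h'⟩ := ih' d
    refine ⟨⟨_, hD.whileDo hD'⟩, fun hC => ?_⟩
    by_cases h₁ : C.mkvars = 0
    · obtain ⟨D, hD'⟩ := h' (by simpa [mkvars, h₁] using hC)
      exact ⟨_, hD.whileDo hD'⟩
    · obtain ⟨D, hD⟩ := h h₁
      exact ⟨_, hD.whileDo hD'⟩

section Elim

variable {d : ℕ} {b : Bool} {C : Ctx} {D : List Guess → Ctx}

lemma Elim.mkvars_add_le (h : Elim d b C D) (o : List Guess) :
    (D o).mkvars + b.toNat ≤ C.mkvars := by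
  induction h with
  | mark h₁ h₂ _ _ ih ih' =>
    rw [mkvars_oracleFrom (by omega) (by omega)]
    simp [mkvars]
  | _ =>
    simp only [mkvars] at *
    grind [Bool.toNat]

lemma Elim.fits (h : Elim d b C D) {Γ Δ Θ : List Ty} (hd : d = Δ.length) (hΘ : Θ.length = 4)
    (hC : C.Fits Γ Δ) (o : List Guess) : (D o).Fits Γ (Δ ++ Θ) := by
  induction h generalizing Δ with
  | hole =>
    subst hd
    refine ⟨fun i hi j hj hij => hC.1 hi hj ?_, fun i A A' hA hA' => ?_⟩
    · dsimp only at hij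
      split_ifs at hij <;> omega
    · dsimp only at hA'
      split_ifs at hA' with h
      · rw [List.getElem?_append_left h] at hA'
        exact hC.2 i A A' hA hA'
      · rw [List.getElem?_eq_none (by simp only [List.length_append]; omega)] at hA'
        cases hA'
  | num => trivial
  | skip => trivial
  | var => trivial
  | lam _ ih => exact ih (by simp [hd]) hC
  | newvar _ ih => exact ih (by simp [hd]) hC
  | deref _ ih => exact ih hd hC
  | ifZero _ _ _ ih₁ ih₂ ih₃ => exact ⟨ih₁ hd hC.1, ih₂ hd hC.2.1, ih₃ hd hC.2.2⟩
  | mark _ _ _ _ ih ih' => exact fits_oracleFrom (ih hd hC.1) (ih' hd hC.2) 0 o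
  | app _ _ _ ih ih' => exact ⟨ih hd hC.1, ih' hd hC.2⟩
  | _ =>
    rename_i ih ih'
    exact ⟨ih hd hC.1, ih' hd hC.2⟩

end Elim

end Ctx

lemma mem_fv_oracleFrom {d j : ℕ} {P Q : Term} {o : List Guess} {i : ℕ}
    (hi : i ∈ (oracleFrom d P Q j o).fv) : i ∈ P.fv ∨ i ∈ Q.fv ∨ d ≤ i := by
  induction o generalizing j with
  | nil =>
    simp [oracleFrom, fv, omega] at hi
    omega
  | cons x o ih =>
    by_contra! hn
    obtain ⟨hP, hQ, hd⟩ := hn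
    have hk : ∀ k, i ≠ d + k := fun k => by omega
    have ho : i ∉ (oracleFrom d P Q (j + 1) o).fv := fun h => by
      rcases ih h with h | h | h
      exacts [hP h, hQ h, absurd hd (by omega)]
    cases x <;>
      simp [oracleFrom, fv, perform, publish, check, dist, omega, hP, hQ, hk, ho, hd.ne] at hi

/-! ### Typing of the oracle program -/

section typing

variable {Ops : Set (ℕ → ℕ → ℕ)} {L : Lang} {Γ Δ : List Ty}

lemma hasType_oracle_var {i : ℕ} (hi : i < 4) :
    HasType Ops L (Δ ++ List.replicate 4 .var) (.var (Δ.length + i)) .var :=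
  .var (by rw [List.getElem?_append_right (by omega), Nat.add_sub_cancel_left,
    List.getElem?_replicate, if_pos hi])

lemma hasType_omega : HasType Ops L Γ omega .comm := .whileDo (.num 0) .skip

lemma hasType_check (hadd : (fun m n : ℕ => m + n) ∈ Ops) (hsub : (fun m n : ℕ => m - n) ∈ Ops) :
    HasType Ops L (Δ ++ List.replicate 4 .var) (check Δ.length) .comm := by
  have hl : HasType Ops L (Δ ++ List.replicate 4 .var) (.deref (.var (Δ.length + 1))) .nat :=
    .deref (hasType_oracle_var (by omega))
  have he : HasType Ops L (Δ ++ List.replicate 4 .var) (.deref (.var (Δ.length + 2))) .nat :=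
    .deref (hasType_oracle_var (by omega))
  exact .ifZero (.inl rfl) (.op hadd (.op hsub hl he) (.op hsub he hl)) .skip hasType_omega

lemma hasType_publish (hadd : (fun m n : ℕ => m + n) ∈ Ops)
    (hsub : (fun m n : ℕ => m - n) ∈ Ops) (b : ℕ) :
    HasType Ops L (Δ ++ List.replicate 4 .var) (publish Δ.length b) .var :=
  have hr : HasType Ops L (Δ ++ List.replicate 4 .var) (.deref (.var (Δ.length + 3))) .nat :=
    .deref (hasType_oracle_var (by omega))
  .seq (.inr (.inr rfl)) (hasType_check hadd hsub)
    (.seq (.inr (.inr rfl)) (.assign (hasType_oracle_var (by omega)) hr)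
      (.seq (.inr (.inr rfl)) (.assign (hasType_oracle_var (by omega)) (.op hadd hr (.num b)))
        (hasType_oracle_var (by omega))))

lemma hasType_oracleFrom (hadd : (fun m n : ℕ => m + n) ∈ Ops)
    (hsub : (fun m n : ℕ => m - n) ∈ Ops) {P Q : Term}
    (hP : HasType Ops L (Δ ++ List.replicate 4 .var) P (.fn .nat .comm))
    (hQ : HasType Ops L (Δ ++ List.replicate 4 .var) Q .nat) (j : ℕ) (o : List Guess) :
    HasType Ops L (Δ ++ List.replicate 4 .var) (oracleFrom Δ.length P Q j o) .var := by
  induction o generalizing j with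
  | nil => exact .seq (.inr (.inr rfl)) hasType_omega (hasType_oracle_var (by omega))
  | cons x o ih =>
    have hc : HasType Ops L (Δ ++ List.replicate 4 .var) (.var Δ.length) .var :=
      hasType_oracle_var (i := 0) (by omega)
    refine .ifZero (.inr (.inr rfl)) (.op hsub (.deref hc) (.num j))
      (.seq (.inr (.inr rfl)) (.assign hc (.num _)) (.seq (.inr (.inr rfl)) ?_
        (hasType_publish hadd hsub _))) (ih _)
    cases x with
    | write n =>
      exact .seq (.inl rfl) (.app hP (.num n) (by simp [fv]))
        (.assign (hasType_oracle_var (by omega)) (.num n))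
    | read b => exact .assign (hasType_oracle_var (by omega)) hQ

end typing

namespace Ctx

section Elim

variable {d : ℕ} {b : Bool} {C : Ctx} {D : List Guess → Ctx} {X : Term}

lemma rename_hole {ρ : ℕ → ℕ} (h : ∀ i ∈ (X.rename ρ).fv, i < d) :
    (X.rename fun i => if ρ i < d then ρ i else ρ i + 4) = X.rename ρ :=
  rename_congr fun _ hi => if_pos (h _ (mem_fv_rename hi))

/-- The replacement adds at most oracle cells to the free identifiers, and these only where
something is replaced. -/
lemma Elim.mem_fv (h : Elim d b C D) (hC : ∀ i ∈ (C.fill X).fv, i < d) {o : List Guess} {i : ℕ}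
    (hi : i ∈ ((D o).fill X).fv) : i ∈ (C.fill X).fv ∨ b = true ∧ d ≤ i := by
  induction h generalizing i with
  | hole =>
    left
    rwa [fill, rename_hole hC] at hi
  | @lam _ _ _ C _ _ ih | @newvar _ _ C _ _ ih =>
    have hC' : ∀ i ∈ (C.fill X).fv, i < _ + 1 := fun i hi => by
      cases i with
      | zero => omega
      | succ i => exact Nat.succ_lt_succ (hC i hi)
    exact (ih hC' hi).imp_right fun h => ⟨h.1, by omega⟩
  | mark _ _ _ _ ih ih' =>
    rw [fill_oracleFrom] at hi
    simp only [fill, fv, Set.mem_union] at hC ⊢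
    rcases mem_fv_oracleFrom hi with h | h | h
    · exact (ih (fun i hi => hC i (.inl hi)) h).imp .inl (fun h => absurd h.1 (by simp))
    · exact (ih' (fun i hi => hC i (.inr hi)) h).imp .inr (fun h => absurd h.1 (by simp))
    · exact .inr ⟨trivial, h⟩
  | _ =>
    simp only [fill, fv, Set.mem_union, Set.mem_empty_iff_false] at hC hi ⊢ <;>
      grind

variable {Ops : Set (ℕ → ℕ → ℕ)} {L : Lang} {Δ : List Ty} {A : Ty}

lemma Elim.hasType (h : Elim d b C D) (hd : d = Δ.length)
    (hadd : (fun m n : ℕ => m + n) ∈ Ops) (hsub : (fun m n : ℕ => m - n) ∈ Ops)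
    (hC : HasType Ops L Δ (C.fill X) A) (o : List Guess) :
    HasType Ops L (Δ ++ List.replicate 4 .var) ((D o).fill X) A := by
  induction h generalizing Δ A with
  | hole =>
    rw [fill, rename_hole fun i hi => hd ▸ hC.lt_length_of_mem_fv hi]
    exact hC.append _
  | num | skip | var => exact hC.append _
  | lam _ ih =>
    cases hC with
    | lam h => exact .lam (ih (by simp [hd]) h)
  | newvar _ ih =>
    cases hC with
    | newvar hB h => exact .newvar hB (ih (by simp [hd]) h)
  | deref _ ih =>
    cases hC with
    | deref h => exact .deref (ih hd h)
  | op _ _ ih ih' =>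
    cases hC with
    | op hf h h' => exact .op hf (ih hd h) (ih' hd h')
  | seq _ _ ih ih' =>
    cases hC with
    | seq hB h h' => exact .seq hB (ih hd h) (ih' hd h')
  | assign _ _ ih ih' =>
    cases hC with
    | assign h h' => exact .assign (ih hd h) (ih' hd h')
  | whileDo _ _ ih ih' =>
    cases hC with
    | whileDo h h' => exact .whileDo (ih hd h) (ih' hd h')
  | ifZero _ _ _ ih ih' ih'' =>
    cases hC with
    | ifZero hB h h' h'' => exact .ifZero hB (ih hd h) (ih' hd h') (ih'' hd h'')
  | mkvar _ _ ih ih' =>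
    cases hC with
    | mkvar hL h h' => exact .mkvar hL (ih hd h) (ih' hd h')
  | mark _ _ _ _ ih ih' =>
    cases hC with
    | mkvar hL h h' =>
      rw [fill_oracleFrom, hd]
      exact hasType_oracleFrom hadd hsub (ih hd h) (ih' hd h') 0 o
  | app hab hE hE' ih ih' =>
    cases hC with
    | app h h' hdis =>
      -- A shared identifier is either old, and excluded by the original typing, or an oracle cell
      -- on both sides, and excluded by the side condition of `Elim.app`.
      refine .app (ih hd h) (ih' hd h') (Set.disjoint_left.2 fun i hi hi' => ?_)
      have hlt : ∀ i ∈ _, i < _ := fun i hi => hd ▸ h.lt_length_of_mem_fv hi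
      have hlt' : ∀ i ∈ _, i < _ := fun i hi => hd ▸ h'.lt_length_of_mem_fv hi
      rcases hE.mem_fv hlt hi with hi | ⟨ha, hi⟩
      · rcases hE'.mem_fv hlt' hi' with hi' | ⟨hb, hi'⟩
        · exact Set.disjoint_left.1 hdis hi hi'
        · exact absurd (hlt i hi) (by omega)
      · rcases hE'.mem_fv hlt' hi' with hi' | ⟨hb, hi'⟩
        · exact absurd (hlt' i hi') (by omega)
        · exact hab ⟨ha, hb⟩

lemma Elim.rel (h : Elim d b C D) (hd : d = Δ.length) (hC : HasType Ops L Δ (C.fill X) A) :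
    Rel Δ (C.fill X) A (fun o => (D o).fill X) := by
  induction h generalizing Δ A with
  | hole =>
    simp only [fill]
    rw [rename_hole fun i hi => hd ▸ hC.lt_length_of_mem_fv hi]
    exact hC.rel
  | num | skip | var => exact hC.rel
  | lam _ ih =>
    cases hC with
    | lam h => exact .lam (ih (by simp [hd]) h)
  | newvar _ ih =>
    cases hC with
    | newvar hB h => exact .newvar (ih (by simp [hd]) h)
  | deref _ ih =>
    cases hC with
    | deref h => exact .deref (ih hd h)
  | op _ _ ih ih' =>
    cases hC with
    | op hf h h' => exact .op (ih hd h) (ih' hd h')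
  | seq _ _ ih ih' =>
    cases hC with
    | seq hB h h' => exact .seq (ih hd h) (ih' hd h')
  | assign _ _ ih ih' =>
    cases hC with
    | assign h h' => exact .assign (ih hd h) (ih' hd h')
  | whileDo _ _ ih ih' =>
    cases hC with
    | whileDo h h' => exact .whileDo (ih hd h) (ih' hd h')
  | ifZero _ _ _ ih ih' ih'' =>
    cases hC with
    | ifZero hB h h' h'' => exact .ifZero (ih hd h) (ih' hd h') (ih'' hd h'')
  | app _ _ _ ih ih' =>
    cases hC with
    | app h h' _ => exact .app (ih hd h) (ih' hd h')
  | mkvar _ _ ih ih' =>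
    cases hC with
    | mkvar hL h h' => exact .mkvar (ih hd h) (ih' hd h')
  | mark _ _ _ _ ih ih' =>
    cases hC with
    | mkvar hL h h' =>
      simp only [fill_oracleFrom]
      rw [hd]
      exact .mark (ih hd h) (ih' hd h')

end Elim

end Ctx

/-! ### Contexts without `mkvar` -/

namespace Term

/-- The term contains no `mkvar`. -/
def MkvarFree : Term → Prop
  | num _ => True
  | op _ M N => MkvarFree M ∧ MkvarFree N
  | skip => True
  | seq M N => MkvarFree M ∧ MkvarFree N
  | assign M N => MkvarFree M ∧ MkvarFree N
  | deref M => MkvarFree M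
  | whileDo M N => MkvarFree M ∧ MkvarFree N
  | ifZero M N P => MkvarFree M ∧ MkvarFree N ∧ MkvarFree P
  | var _ => True
  | lam _ M => MkvarFree M
  | app M N => MkvarFree M ∧ MkvarFree N
  | newvar M => MkvarFree M
  | mkvar _ _ => False

lemma MkvarFree.rename {M : Term} (h : M.MkvarFree) (ρ : ℕ → ℕ) : (M.rename ρ).MkvarFree := by
  induction M generalizing ρ <;> simp_all [MkvarFree, Term.rename]

end Term

lemma HasType.mkvarFree {Ops : Set (ℕ → ℕ → ℕ)} {Γ : List Ty} {M : Term} {A : Ty}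
    (h : HasType Ops .sci Γ M A) : M.MkvarFree := by
  induction h <;> simp_all [Term.MkvarFree]

lemma HasType.of_mkvarFree {Ops : Set (ℕ → ℕ → ℕ)} {L L' : Lang} {Γ : List Ty} {M : Term} {A : Ty}
    (h : HasType Ops L Γ M A) (hM : M.MkvarFree) : HasType Ops L' Γ M A := by
  induction h with
  | var h => exact .var h
  | lam _ h => exact .lam (h hM)
  | app _ _ hd h₁ h₂ => exact .app (h₁ hM.1) (h₂ hM.2) hd
  | num n => exact .num n
  | op hf _ _ h₁ h₂ => exact .op hf (h₁ hM.1) (h₂ hM.2)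
  | skip => exact .skip
  | seq hB _ _ h₁ h₂ => exact .seq hB (h₁ hM.1) (h₂ hM.2)
  | assign _ _ h₁ h₂ => exact .assign (h₁ hM.1) (h₂ hM.2)
  | deref _ h => exact .deref (h hM)
  | whileDo _ _ h₁ h₂ => exact .whileDo (h₁ hM.1) (h₂ hM.2)
  | ifZero hB _ _ _ h₁ h₂ h₃ => exact .ifZero hB (h₁ hM.1) (h₂ hM.2.1) (h₃ hM.2.2)
  | newvar hB _ h => exact .newvar hB (h hM)
  | mkvar => exact hM.elim

lemma Ctx.mkvars_eq_zero {C : Ctx} {X : Term} (h : (C.fill X).MkvarFree) : C.mkvars = 0 := by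
  induction C <;> simp_all [Ctx.mkvars, Ctx.fill, Term.MkvarFree]

lemma Ctx.mkvarFree_fill {C : Ctx} {X : Term} (hC : C.mkvars = 0) (hX : X.MkvarFree) :
    (C.fill X).MkvarFree := by
  induction C <;> simp_all [Ctx.mkvars, Ctx.fill, Term.MkvarFree, Term.MkvarFree.rename]

/-! ### Conservativity -/

/-- The block that declares the identifiers of the oracle and performs the final check. -/
def oracleBlock (A : Ty) (M : Term) : Term :=
  .newvar (.newvar (.newvar (.newvar (match A with
    -- Operands are evaluated from left to right: adding `check; 0` on the right performs the check
    -- after `M` and keeps the result of `M`.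
    | .nat => .op (fun m n => m + n) M (.seq (check 0) (.num 0))
    | _ => .seq M (check 0)))))

/-- The block around a context in place of a term. -/
def oracleBlockCtx (A : Ty) (C : Ctx) : Ctx :=
  .newvar (.newvar (.newvar (.newvar (match A with
    | .nat => .op (fun m n => m + n) C (.ofTerm (.seq (check 0) (.num 0)))
    | _ => .seq C (.ofTerm (check 0))))))

lemma fill_oracleBlockCtx {A : Ty} {C : Ctx} {X : Term} :
    (oracleBlockCtx A C).fill X = oracleBlock A (C.fill X) := by
  cases A <;> simp [oracleBlockCtx, oracleBlock, Ctx.fill]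

lemma mkvars_oracleBlockCtx {A : Ty} {C : Ctx} : (oracleBlockCtx A C).mkvars = C.mkvars := by
  cases A <;>
    simp [oracleBlockCtx, Ctx.mkvars, Ctx.ofTerm, check, dist, omega]

lemma fits_oracleBlockCtx {Γ : List Ty} {A : Ty} {C : Ctx}
    (h : C.Fits Γ (List.replicate 4 .var)) : (oracleBlockCtx A C).Fits Γ [] := by
  cases A <;> simpa [oracleBlockCtx, Ctx.Fits] using h

lemma hasType_oracleBlock {Ops : Set (ℕ → ℕ → ℕ)} {L : Lang}
    (hadd : (fun m n : ℕ => m + n) ∈ Ops) (hsub : (fun m n : ℕ => m - n) ∈ Ops) {A : Ty}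
    (hA : A = .comm ∨ A = .nat) {M : Term} (hM : HasType Ops L (List.replicate 4 .var) M A) :
    HasType Ops L [] (oracleBlock A M) A := by
  have hc : HasType Ops L (List.replicate 4 .var) (check 0) .comm :=
    hasType_check (Δ := []) hadd hsub
  rcases hA with rfl | rfl
  · exact .newvar (.inl rfl) (.newvar (.inl rfl) (.newvar (.inl rfl) (.newvar (.inl rfl)
      (.seq (.inl rfl) hM hc))))
  · exact .newvar (.inr rfl) (.newvar (.inr rfl) (.newvar (.inr rfl) (.newvar (.inr rfl)
      (.op hadd hM (.seq (.inr (.inl rfl)) hc (.num 0))))))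

lemma eval_newvar_four {M V : Term} :
    Converges (.newvar (.newvar (.newvar (.newvar M)))) V ↔
      V.IsConst ∧ ∃ c l e r, Eval (extStore [] 0 0 0 0) M (extStore [] c l e r) V := by
  simp only [Converges, eval_newvar]
  constructor
  · rintro ⟨hV, r, -, e, -, l, -, c, h⟩
    exact ⟨hV, c, l, e, r, h⟩
  · rintro ⟨hV, c, l, e, r, h⟩
    exact ⟨hV, r, hV, e, hV, l, hV, c, h⟩

lemma eval_check_zero {σ τ : Store} {c l e r : ℕ} (hσ : σ = extStore [] c l e r) {U : Term} :
    Eval σ (check 0) τ U ↔ l = e ∧ τ = σ ∧ U = .skip := by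
  subst hσ
  exact eval_check (σ := [])

lemma converges_oracleBlock {A : Ty} {M V : Term}
    (hV : A = .nat ∧ (∃ n, V = .num n) ∨ A = .comm ∧ V = .skip) :
    Converges (oracleBlock A M) V ↔ Passes M V := by
  have split : ∀ {M U τ}, Eval (extStore [] 0 0 0 0) M τ U →
      ∃ c l e r, τ = extStore [] c l e r := by
    intro M U τ h
    obtain ⟨σ, c, l, e, r, hσ, rfl⟩ := h.exists_extStore
    obtain rfl : σ = [] := List.length_eq_zero_iff.1 hσ
    exact ⟨c, l, e, r, rfl⟩
  rcases hV with ⟨rfl, n, rfl⟩ | ⟨rfl, rfl⟩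
  · simp only [oracleBlock, eval_newvar_four, eval_op, eval_seq]
    constructor
    · rintro ⟨-, c, l, e, r, τ, a, b, h₁, ⟨_, h₂, h₃⟩, hab⟩
      obtain ⟨c', l', e', r', rfl⟩ := split h₁
      obtain ⟨rfl, rfl, -⟩ := (eval_check_zero rfl).1 h₂
      obtain ⟨-, hb⟩ := eval_num.1 h₃
      cases hb
      cases hab
      exact ⟨_, _, _, h₁⟩
    · rintro ⟨c, l, r, h⟩
      exact ⟨.num n, c, l, l, r, _, n, 0, h, ⟨_, (eval_check_zero rfl).2 ⟨rfl, rfl, rfl⟩,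
        eval_num.2 ⟨rfl, rfl⟩⟩, rfl⟩
  · simp only [oracleBlock, eval_newvar_four, eval_seq]
    constructor
    · rintro ⟨-, c, l, e, r, τ, h₁, h₂⟩
      obtain ⟨c', l', e', r', rfl⟩ := split h₁
      obtain ⟨rfl, -, -⟩ := (eval_check_zero rfl).1 h₂
      exact ⟨_, _, _, h₁⟩
    · rintro ⟨c, l, r, h⟩
      exact ⟨.skip, c, l, l, r, _, h, (eval_check_zero rfl).2 ⟨rfl, rfl, rfl⟩⟩

lemma HasType.value_cases {Ops : Set (ℕ → ℕ → ℕ)} {L : Lang} {V : Term} {B : Ty}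
    (h : HasType Ops L [] V B) (hV : V.IsValue) (hB : B = .comm ∨ B = .nat) :
    B = .nat ∧ (∃ n, V = .num n) ∨ B = .comm ∧ V = .skip := by
  rcases hB with rfl | rfl <;> cases hV <;> cases h <;> simp_all

/-- Equivalence with respect to the contexts with at most `k` `mkvar`s. -/
def EquivUpTo (Ops : Set (ℕ → ℕ → ℕ)) (k : ℕ) (Γ : List Ty) (M N : Term) : Prop :=
  ∀ (C : Ctx) (B : Ty), C.mkvars ≤ k → C.Fits Γ [] → (B = .comm ∨ B = .nat) →
    HasType Ops .sciMk [] (C.fill M) B → HasType Ops .sciMk [] (C.fill N) B →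
    ∀ V : Term, V.IsValue → HasType Ops .sciMk [] V B →
      (Converges (C.fill M) V ↔ Converges (C.fill N) V)

section

variable {Ops : Set (ℕ → ℕ → ℕ)} {Γ : List Ty} {M N : Term}

lemma EquivUpTo.symm {k : ℕ} (h : EquivUpTo Ops k Γ M N) : EquivUpTo Ops k Γ N M :=
  fun C B hC hf hB hN hM V hV hV' => (h C B hC hf hB hM hN V hV hV').symm

/-- A single implication with `k + 1` `mkvar`s uses both directions with `k`: one carries the trace
from `M` to `N`, the other carries the falsified trace back. This is why the argument fails for the
preorder. -/
lemma EquivUpTo.converges (hadd : (fun m n : ℕ => m + n) ∈ Ops)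
    (hsub : (fun m n : ℕ => m - n) ∈ Ops) {k : ℕ} (h : EquivUpTo Ops k Γ M N) {C : Ctx} {B : Ty}
    (hC : C.mkvars = k + 1) (hf : C.Fits Γ []) (hB : B = .comm ∨ B = .nat)
    (hM : HasType Ops .sciMk [] (C.fill M) B) (hN : HasType Ops .sciMk [] (C.fill N) B)
    {V : Term} (hV : V.IsValue) (hV' : HasType Ops .sciMk [] V B)
    (hconv : Converges (C.fill M) V) : Converges (C.fill N) V := by
  obtain ⟨D, hD⟩ := (C.exists_elim 0).2 (by omega)
  have hVB := hV'.value_cases hV hB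
  have hVc : V.IsConst := by
    rcases hVB with ⟨-, n, rfl⟩ | ⟨-, rfl⟩ <;> constructor
  refine eval_of_passes_iff (hD.rel (Δ := []) rfl hM) (hD.rel (Δ := []) rfl hN) hVc
    (fun o => ?_) hconv
  rw [← converges_oracleBlock hVB, ← converges_oracleBlock hVB, ← fill_oracleBlockCtx,
    ← fill_oracleBlockCtx]
  refine h _ B ?_ (fits_oracleBlockCtx ?_) hB ?_ ?_ V hV hV'
  · have := hD.mkvars_add_le o
    rw [mkvars_oracleBlockCtx]
    simp only [Bool.toNat_true] at this
    omega
  · exact hD.fits (Δ := []) rfl rfl hf o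
  · rw [fill_oracleBlockCtx]
    exact hasType_oracleBlock hadd hsub hB (hD.hasType (Δ := []) rfl hadd hsub hM o)
  · rw [fill_oracleBlockCtx]
    exact hasType_oracleBlock hadd hsub hB (hD.hasType (Δ := []) rfl hadd hsub hN o)

lemma CtxEquiv.equivUpTo (hadd : (fun m n : ℕ => m + n) ∈ Ops)
    (hsub : (fun m n : ℕ => m - n) ∈ Ops) {A : Ty} (hM : HasType Ops .sci Γ M A)
    (hN : HasType Ops .sci Γ N A) (h : CtxEquiv Ops .sci Γ M N) (k : ℕ) :
    EquivUpTo Ops k Γ M N := by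
  induction k with
  | zero =>
    intro C B hC hf hB hCM hCN V hV hV'
    have hC : C.mkvars = 0 := by omega
    refine h C B hf hB (hCM.of_mkvarFree (C.mkvarFree_fill hC hM.mkvarFree))
      (hCN.of_mkvarFree (C.mkvarFree_fill hC hN.mkvarFree)) V hV ?_
    rcases hV'.value_cases hV hB with ⟨rfl, n, rfl⟩ | ⟨rfl, rfl⟩
    · exact .num n
    · exact .skip
  | succ k ih =>
    intro C B hC hf hB hCM hCN V hV hV'
    rcases hC.lt_or_eq with hC | hC
    · exact ih C B (by omega) hf hB hCM hCN V hV hV'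
    · exact ⟨ih.converges hadd hsub hC hf hB hCM hCN hV hV',
        ih.symm.converges hadd hsub hC hf hB hCN hCM hV hV'⟩

end

/-! ### The contextual preorder -/

/-- `Sub M N`: the term `N` arises from the term `M` of SCI by the replacement of some subterms that
check for the content `0` by assignments of `0`. -/
inductive Sub : Term → Term → Prop
  | num (n : ℕ) : Sub (.num n) (.num n)
  | op {f : ℕ → ℕ → ℕ} {M M' N N' : Term} : Sub M M' → Sub N N' → Sub (.op f M N) (.op f M' N')
  | skip : Sub .skip .skip
  | seq {M M' N N' : Term} : Sub M M' → Sub N N' → Sub (.seq M N) (.seq M' N')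
  | assign {M M' N N' : Term} : Sub M M' → Sub N N' → Sub (.assign M N) (.assign M' N')
  | deref {M M' : Term} : Sub M M' → Sub (.deref M) (.deref M')
  | whileDo {M M' N N' : Term} : Sub M M' → Sub N N' → Sub (.whileDo M N) (.whileDo M' N')
  | ifZero {M M' N N' P P' : Term} :
      Sub M M' → Sub N N' → Sub P P' → Sub (.ifZero M N P) (.ifZero M' N' P')
  | var (i : ℕ) : Sub (.var i) (.var i)
  | lam (A : Ty) {M M' : Term} : Sub M M' → Sub (.lam A M) (.lam A M')
  | app {M M' N N' : Term} : Sub M M' → Sub N N' → Sub (.app M N) (.app M' N')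
  | newvar {M M' : Term} : Sub M M' → Sub (.newvar M) (.newvar M')
  | test {M M' : Term} :
      Sub M M' → Sub (.ifZero (.deref M) .skip omega) (.assign M' (.num 0))

lemma Sub.rename {M N : Term} (h : Sub M N) (ρ : ℕ → ℕ) : Sub (M.rename ρ) (N.rename ρ) := by
  induction h generalizing ρ with
  | test _ ih => exact .test (ih ρ)
  | _ => constructor <;> simp_all

lemma Sub.subst {M N : Term} (h : Sub M N) {s s' : ℕ → Term} (hs : ∀ i, Sub (s i) (s' i)) :
    Sub (M.subst s) (N.subst s') := by
  have lift : ∀ {s s' : ℕ → Term}, (∀ i, Sub (s i) (s' i)) →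
      ∀ i, Sub (liftSub s i) (liftSub s' i) := by
    intro s s' hs i
    cases i with
    | zero => exact .var 0
    | succ i => exact (hs i).rename _
  induction h generalizing s s' with
  | var i => exact hs i
  | test _ ih => exact .test (ih hs)
  | lam A _ ih => exact .lam A (ih (lift hs))
  | newvar _ ih => exact .newvar (ih (lift hs))
  | _ => constructor <;> simp_all

lemma Sub.inst {M M' N N' : Term} (h : Sub M M') (h' : Sub N N') :
    Sub (M.inst N) (M'.inst N') :=
  h.subst fun i => by
    cases i with
    | zero => exact h'
    | succ i => exact .var i

lemma Sub.fill {C : Ctx} {M N : Term} (h : Sub M N) (hC : C.mkvars = 0) :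
    Sub (C.fill M) (C.fill N) := by
  induction C with
  | hole ρ => exact h.rename ρ
  | mkvar => simp [Ctx.mkvars] at hC
  | _ => constructor <;> simp_all [Ctx.mkvars]

/-- A successful test leaves the store as an assignment of `0` would. The last conjunct keeps, for a
dereference, the location that was read, which the `test` case needs as the target of the
assignment. -/
lemma Sub.eval {σ τ : Store} {M N V : Term} (hM : Sub M N) (h : Eval σ M τ V) :
    ∃ W, Sub V W ∧ Eval σ N τ W ∧
      ∀ N', N = .deref N' → ∃ x n, Eval σ N' τ (.var x) ∧ τ[x]? = some n ∧ W = .num n := by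
  induction h generalizing N with
  | value hV =>
    refine ⟨N, hM, .value ?_, ?_⟩ <;> cases hV <;> cases hM <;> first | constructor | nofun
  | app _ _ ih₁ ih₂ =>
    cases hM with
    | app hM hN =>
      obtain ⟨W, hW, h₁, -⟩ := ih₁ hM
      cases hW with
      | lam A hV =>
        obtain ⟨W, hW, h₂, -⟩ := ih₂ (hV.inst hN)
        exact ⟨W, hW, .app h₁ h₂, nofun⟩
  | op _ _ ih₁ ih₂ =>
    cases hM with
    | op hM hN =>
      obtain ⟨W, hW, h₁, -⟩ := ih₁ hM
      cases hW
      obtain ⟨W, hW, h₂, -⟩ := ih₂ hN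
      cases hW
      exact ⟨_, .num _, .op h₁ h₂, nofun⟩
  | assign _ _ ih₁ ih₂ =>
    cases hM with
    | assign hM hN =>
      obtain ⟨W, hW, h₁, -⟩ := ih₁ hN
      cases hW
      obtain ⟨W, hW, h₂, -⟩ := ih₂ hM
      cases hW
      exact ⟨_, .skip, .assign h₁ h₂, nofun⟩
  | deref _ hx ih₁ =>
    cases hM with
    | deref hM =>
      obtain ⟨W, hW, h₁, -⟩ := ih₁ hM
      cases hW
      exact ⟨_, .num _, .deref h₁ hx, fun N' h => by cases h; exact ⟨_, _, h₁, hx, rfl⟩⟩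
  | seq _ _ ih₁ ih₂ =>
    cases hM with
    | seq hM hN =>
      obtain ⟨W, hW, h₁, -⟩ := ih₁ hM
      cases hW
      obtain ⟨W, hW, h₂, -⟩ := ih₂ hN
      exact ⟨W, hW, .seq h₁ h₂, nofun⟩
  | whileExit hn _ ih₁ =>
    cases hM with
    | whileDo hM hN =>
      obtain ⟨W, hW, h₁, -⟩ := ih₁ hM
      cases hW
      exact ⟨_, .skip, .whileExit hn h₁, nofun⟩
  | whileStep _ _ _ ih₁ ih₂ ih₃ =>
    cases hM with
    | whileDo hM hN =>
      obtain ⟨W, hW, h₁, -⟩ := ih₁ hM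
      cases hW
      obtain ⟨W, hW, h₂, -⟩ := ih₂ hN
      cases hW
      obtain ⟨W, hW, h₃, -⟩ := ih₃ (.whileDo hM hN)
      cases hW
      exact ⟨_, .skip, .whileStep h₁ h₂ h₃, nofun⟩
  | ifTrue h₁ h₂ ih₁ ih₂ =>
    cases hM with
    | ifZero hM hN _ =>
      obtain ⟨W, hW, h₁, -⟩ := ih₁ hM
      cases hW
      obtain ⟨W, hW, h₂, -⟩ := ih₂ hN
      exact ⟨W, hW, .ifTrue h₁ h₂, nofun⟩
    | test hM =>
      obtain ⟨rfl, rfl⟩ := eval_skip.1 h₂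
      obtain ⟨W, hW, -, h₁⟩ := ih₁ (.deref hM)
      cases hW
      obtain ⟨x, n, h₁, hx, hn⟩ := h₁ _ rfl
      cases hn
      refine ⟨.skip, .skip, ?_, nofun⟩
      have h := Eval.assign (.value (.num 0)) h₁
      obtain ⟨hlt, hx⟩ := List.getElem?_eq_some_iff.1 hx
      -- The location contains `0`, so the store is unchanged by the assignment.
      rwa [← hx, List.set_getElem_self, hx] at h
  | ifFalse hn _ h₂ ih₁ ih₂ =>
    cases hM with
    | ifZero hM _ hN =>
      obtain ⟨W, hW, h₁, -⟩ := ih₁ hM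
      cases hW
      obtain ⟨W, hW, h₂, -⟩ := ih₂ hN
      exact ⟨W, hW, .ifFalse hn h₁ h₂, nofun⟩
    | test hM => exact absurd h₂ not_eval_omega
  | newvar hc _ ih₁ =>
    cases hM with
    | newvar hM =>
      obtain ⟨W, hW, h₁, -⟩ := ih₁ hM
      cases hc <;> cases hW
      · exact ⟨_, .num _, .newvar (.num _) h₁, nofun⟩
      · exact ⟨_, .skip, .newvar .skip h₁, nofun⟩
  | assignMk _ _ _ _ ih₂ _ =>
    cases hM with
    | assign hM hN =>
      obtain ⟨W, hW, -⟩ := ih₂ hM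
      cases hW
  | derefMk _ _ ih₁ _ =>
    cases hM with
    | deref hM =>
      obtain ⟨W, hW, -⟩ := ih₁ hM
      cases hW

lemma ctxLE_test_assign {Ops : Set (ℕ → ℕ → ℕ)} {Γ : List Ty} :
    CtxLE Ops .sci Γ (.ifZero (.deref (.var 0)) .skip omega) (.assign (.var 0) (.num 0)) := by
  intro C B _ hB hM _ V hV hV' hconv
  have hC : C.mkvars = 0 := C.mkvars_eq_zero hM.mkvarFree
  obtain ⟨W, hW, h, -⟩ := ((Sub.test (.var 0)).fill hC).eval hconv
  have hVW : W = V := by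
    rcases hV'.value_cases hV hB with ⟨-, n, rfl⟩ | ⟨-, rfl⟩ <;> cases hW <;> rfl
  rwa [hVW] at h

/-- The free identifier is bound to an `mkvar` with reader `0` and diverging writer, on which the
test succeeds and the assignment diverges. -/
lemma not_ctxLE_test_assign {Ops : Set (ℕ → ℕ → ℕ)} :
    ¬ CtxLE Ops .sciMk [.var] (.ifZero (.deref (.var 0)) .skip omega)
      (.assign (.var 0) (.num 0)) := by
  intro h
  have hmk : HasType Ops .sciMk [] (.mkvar (.lam .nat omega) (.num 0)) .var :=
    .mkvar rfl (.lam hasType_omega) (.num 0)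
  have hx : HasType Ops .sciMk [.var] (.var 0) .var := .var rfl
  have h := h (.app (.lam .var (.hole id)) (.ofTerm (.mkvar (.lam .nat omega) (.num 0)))) .comm
    ⟨⟨Function.injective_id.injOn, fun i A A' hA hA' => Option.some.inj (hA.symm.trans hA')⟩,
      Ctx.fits_ofTerm _ _ _⟩ (.inl rfl)
    (.app (.lam (.ifZero (.inl rfl) (.deref hx) .skip hasType_omega)) (by simpa using hmk)
      (by simp [fv, omega, Ctx.fill, rename]))
    (.app (.lam (.assign hx (.num 0))) (by simpa using hmk)
      (by simp [fv, omega, Ctx.fill, rename]))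
    .skip .skip .skip
  simp only [Ctx.fill, Ctx.fill_ofTerm, Converges] at h
  have h₀ : ∀ {M N : Term} {B : Ty}, Eval [] (.app (.lam B M) N) [] .skip ↔
      Eval [] (M.inst N) [] .skip := by
    intro M N B
    rw [eval_app]
    constructor
    · rintro ⟨_, _, _, h, h'⟩
      obtain ⟨rfl, h⟩ := eval_lam.1 h
      cases h
      exact h'
    · exact fun h => ⟨_, _, _, eval_lam.2 ⟨rfl, rfl⟩, h⟩
  rw [h₀, h₀] at h
  have h₁ := h (.ifTrue (.derefMk (.value (.mkvar _ _)) (.value (.num 0))) (.value .skip))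
  obtain ⟨_, n, _, W, hn, hW, ⟨x, rfl, -⟩ | ⟨P, Q, rfl, h₂⟩⟩ := eval_assign.1 h₁
  · cases (eval_mkvar.1 hW).2
  · obtain ⟨rfl, hW⟩ := eval_mkvar.1 hW
    cases hW
    obtain ⟨_, _, _, h₃, h₄⟩ := eval_app.1 h₂
    cases (eval_lam.1 h₃).2
    exact not_eval_omega h₄

end SCI

theorem mainTheorem3 (Ops : Set (ℕ → ℕ → ℕ))
    (hadd : (fun m n : ℕ => m + n) ∈ Ops) (hsub : (fun m n : ℕ => m - n) ∈ Ops) :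
    (∀ (Γ : List SCI.Ty) (A : SCI.Ty) (M N : SCI.Term),
        SCI.HasType Ops .sci Γ M A → SCI.HasType Ops .sci Γ N A →
        SCI.CtxEquiv Ops .sci Γ M N → SCI.CtxEquiv Ops .sciMk Γ M N) ∧
      (∃ (Γ : List SCI.Ty) (A : SCI.Ty) (M N : SCI.Term),
        SCI.HasType Ops .sci Γ M A ∧ SCI.HasType Ops .sci Γ N A ∧
        SCI.CtxLE Ops .sci Γ M N ∧ ¬ SCI.CtxLE Ops .sciMk Γ M N) := by
  refine ⟨fun Γ A M N hM hN h C => fun B => ?_, [.var], .comm, _, _, ?_, ?_,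
    SCI.ctxLE_test_assign, SCI.not_ctxLE_test_assign⟩
  · exact h.equivUpTo hadd hsub hM hN C.mkvars C B le_rfl
  · exact .ifZero (.inl rfl) (.deref (.var rfl)) .skip SCI.hasType_omega
  · exact .assign (.var rfl) (.num 0)
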